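/- \textbf{Theorem (Equations for the spacetime dynamics of fluids).} \emph{Conventions.} For a $(0,2)$-tensor $T$ on a semi-Riemannian manifold $(\mathscr M,g)$ with Levi-Civita connection $\nabla$, ${}^eT$ is the endomorphism field with $g(u,{}^eT(v))=T(u,v)$, $\nabla\cdot T$ is the vector field $\nabla_iT^{ij}$, $|T|_g:=T_{ij}T^{ij}$, and $\nabla\cdot V=\nabla_iV^i$ for a vector field $V$. We write $\langle\cdot,\cdot\rangle=g$, and $V\otimes V'$ also denotes the $(0,2)$-tensor $V^\flat\otimes V'^\flat$. For 1-forms, $d\omega(u,v)=u(\omega(v))-v(\omega(u))-\omega([u,v])$. $G=\mathrm{Ric}-\tfrac12 S\,g$ is the Einstein curvature. \emph{Spacetime.} Let $W$ be a compact manifold of dimension $m\ge 0$ and $(\mathscr M,g)$ a smooth semi-Riemannian manifold of dimension $5+m$ with a multi-fiber bundle structure of fibers $(S^1,W)$: a smooth fiber bundle $\pi:\mathscr M\to\overline{\mathscr M}$ over a 4-manifold with fiber $S^1\times W$, and a smooth map $\Phi=(h,f):\mathscr M\to S^1\times W$ whose restriction to each fiber of $\pi$ is a diffeomorphism onto $S^1\times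 W$. The fibers at $x$ are $S^1_x=\{y:\pi(y)=\pi(x),f(y)=f(x)\}$ and $W_x=\{y:\pi(y)=\pi(x),h(y)=h(x)\}$; the horizontal space $H_x$ is the $g$-orthogonal of $T_x(\pi^{-1}(\pi(x)))$. Assume that $g$ has signature $(-)$ on every $S^1_x$, $(+,\dots,+)$ on every $W_x$ and $(-,+,+,+)$ on every $H_x$. Let $Y$ be the vector field tangent to the fibers $S^1_x$, positively oriented for the standard orientation of $S^1$, with $g(Y,Y)=-1$; assume that $Y$ is a Killing field, and let $F=d(Y^\flat)$. \emph{Fluid.} Let $D\subset\mathscr M$ be open, and let $X_0$ (a vector field), $\mu>0$, $e$, $\alpha$ (functions) and $P$ (a $(0,2)$-tensor field) be smooth on $D$ and such that, at each point $x$ of $D$: \begin{itemize} \item $X_0\in H_x$, $g(X_0,X_0)=-1$, and the eigenspace of $\mathrm{pr}_{H}\circ{}^eG|_{H}$ for the eigenvalue $-\mu$ is the line generated by $X_0$; \item $G=\mu\,X\otimes X+\alpha\,Y\otimes Y+P$ with $X=X_0+\frac e\mu Y$; \item $P$ vanishes on $\mathrm T_x\times\mathrm T_x$, where $\mathrm T_x$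 is the plane generated by $X_0(x)$ and $Y(x)$. \end{itemize} Then on $D$: \begin{itemize} \item Energy conservation: $\nabla\cdot(\mu X)=\nabla\cdot(\mu X_0)=\langle X_0,\nabla\cdot P\rangle$. \item Electric charge conservation: $\nabla\cdot(eX)=\nabla\cdot(eX_0)=\nabla\cdot({}^eP(Y))=\langle Y,\nabla\cdot P\rangle$. \item Motion of the fluid: $\mu\nabla_XX=-\nabla\cdot P-\langle X_0,\nabla\cdot P\rangle X$. \item Motion of the apparent fluid: $\mu\nabla_{X_0}X_0=e\,{}^eF(X_0)-\mathrm{pr}_{\mathrm T^\perp}(\nabla\cdot P)$. \item Maxwell equations: $dF=0$ and $\nabla\cdot F=2e\,X_0+\tfrac12|F|_g\,Y-2\,{}^eP(Y)$. \end{itemize} -/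

import Mathlib

set_option maxSynthPendingDepth 3

open scoped Manifold ContDiff Topology
open ContinuousLinearMap (compL)

noncomputable section

namespace KaluzaKlein

/-! ### Semi-Riemannian calculus on a finite-dimensional vector space

Here `g u` is the value at `u : E` of a metric given on (an open subset of) `E`, that is, the matrix
`g_ij` of a metric in a coordinate chart, written without indices. -/

section Local

variable {E : Type*} [NormedAddCommGroup E] [NormedSpace ℝ E] [FiniteDimensional ℝ E]

/-- The trace of an endomorphism, as a continuous linear functional. -/
def traceCLM : (E →L[ℝ] E) →L[ℝ] ℝ :=
  LinearMap.toContinuousLinearMap (LinearMap.trace ℝ E ∘ₗ ContinuousLinearMap.coeLM ℝ)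

/-- Exchange of the two arguments of a bilinear map, as a continuous linear map. -/
def flipCLM (E F : Type*) [NormedAddCommGroup E] [NormedSpace ℝ E] [NormedAddCommGroup F]
    [NormedSpace ℝ F] : (E →L[ℝ] E →L[ℝ] F) →L[ℝ] (E →L[ℝ] E →L[ℝ] F) :=
  (ContinuousLinearMap.flipₗᵢ ℝ E E F).toContinuousLinearEquiv.toContinuousLinearMap

/-- The musical isomorphism `♯ : E* → E` of a nondegenerate form `b`. -/
def sharpL (b : E →L[ℝ] E →L[ℝ] ℝ) : (E →L[ℝ] ℝ) →L[ℝ] E :=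
  ContinuousLinearMap.inverse b

/-- `(v, w, z) ↦ ∂_v g(w, z) + ∂_w g(v, z) - ∂_z g(v, w)`. -/
def koszulL (g : E → E →L[ℝ] E →L[ℝ] ℝ) (u : E) : E →L[ℝ] E →L[ℝ] E →L[ℝ] ℝ :=
  fderiv ℝ g u + (fderiv ℝ g u).flip - (flipCLM E ℝ).comp (fderiv ℝ g u).flip

/-- The Christoffel symbols `Γ(v, w)` of the Levi-Civita connection of `g`. -/
def christoffelL (g : E → E →L[ℝ] E →L[ℝ] ℝ) (u : E) : E →L[ℝ] E →L[ℝ] E :=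
  (1 / 2 : ℝ) • (compL ℝ E (E →L[ℝ] ℝ) E (sharpL (g u)) ∘L koszulL g u)

/-- `(v, w, z) ↦ (∂_v Γ)(w, z) + Γ(v, Γ(w, z))`. -/
def riemannAuxL (g : E → E →L[ℝ] E →L[ℝ] ℝ) (u : E) : E →L[ℝ] E →L[ℝ] E →L[ℝ] E :=
  fderiv ℝ (christoffelL g) u +
    (compL ℝ E E E).bilinearComp (christoffelL g u) (christoffelL g u)

/-- The Riemann curvature `R(v, w) z = ∇_v ∇_w z - ∇_w ∇_v z` (for constant `v`, `w`, `z`). -/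
def riemannL (g : E → E →L[ℝ] E →L[ℝ] ℝ) (u : E) : E →L[ℝ] E →L[ℝ] E →L[ℝ] E :=
  riemannAuxL g u - (riemannAuxL g u).flip

/-- The Ricci curvature `Ric(w, z) = tr (v ↦ R(v, w) z)`. -/
def ricciL (g : E → E →L[ℝ] E →L[ℝ] ℝ) (u : E) : E →L[ℝ] E →L[ℝ] ℝ :=
  compL ℝ E (E →L[ℝ] E) ℝ traceCLM ∘L flipCLM E E ∘L (riemannL g u).flip

/-- The scalar curvature, the `g`-trace of the Ricci curvature. -/
def scalarL (g : E → E →L[ℝ] E →L[ℝ] ℝ) (u : E) : ℝ :=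
  traceCLM (sharpL (g u) ∘L ricciL g u)

/-- The Einstein curvature `Ric - (1/2) S g`. -/
def einsteinL (g : E → E →L[ℝ] E →L[ℝ] ℝ) (u : E) : E →L[ℝ] E →L[ℝ] ℝ :=
  ricciL g u - ((1 / 2 : ℝ) * scalarL g u) • g u

/-- The covariant derivative `v ↦ ∇_v V` of a vector field. -/
def covDerivL (g : E → E →L[ℝ] E →L[ℝ] ℝ) (V : E → E) (u : E) : E →L[ℝ] E :=
  fderiv ℝ V u + (christoffelL g u).flip (V u)

/-- The covariant derivative `(v, a, b) ↦ (∇_v T)(a, b)` of a `(0,2)`-tensor field. -/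
def covDerivTensorL (g T : E → E →L[ℝ] E →L[ℝ] ℝ) (u : E) : E →L[ℝ] E →L[ℝ] E →L[ℝ] ℝ :=
  fderiv ℝ T u - (compL ℝ E E (E →L[ℝ] ℝ) (T u)).comp (christoffelL g u)
    - (flipCLM E ℝ).comp ((compL ℝ E E (E →L[ℝ] ℝ) (T u).flip).comp (christoffelL g u))

/-- The divergence `∇^i T_ij` of a `(0,2)`-tensor field, as a covector. -/
def divTensorCovectorL (g T : E → E →L[ℝ] E →L[ℝ] ℝ) (u : E) : E →L[ℝ] ℝ :=
  traceCLM ∘L compL ℝ E (E →L[ℝ] ℝ) E (sharpL (g u)) ∘L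
    (flipCLM E ℝ ∘L covDerivTensorL g T u).flip

/-- The exterior derivative `(v, w) ↦ ∂_v θ(w) - ∂_w θ(v)` of a `1`-form. -/
def extDerivOneL (θ : E → E →L[ℝ] ℝ) (u : E) : E →L[ℝ] E →L[ℝ] ℝ :=
  fderiv ℝ θ u - (fderiv ℝ θ u).flip

/-- The exterior derivative of a `2`-form. -/
def extDerivTwoL (F : E → E →L[ℝ] E →L[ℝ] ℝ) (u a b c : E) : ℝ :=
  fderiv ℝ F u a b c + fderiv ℝ F u b c a + fderiv ℝ F u c a b

end Local

/-! ### Tensor fields on manifolds and their expressions in charts -/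

section Manifold

variable {E : Type*} [NormedAddCommGroup E] [NormedSpace ℝ E]
variable {M : Type*} [TopologicalSpace M] [ChartedSpace E M]

/-- Vector fields on `M` (no regularity required). -/
abbrev VectorField (E : Type*) [NormedAddCommGroup E] [NormedSpace ℝ E]
    (M : Type*) [TopologicalSpace M] [ChartedSpace E M] :=
  (x : M) → TangentSpace 𝓘(ℝ, E) x

/-- `1`-forms on `M`. -/
abbrev OneForm (E : Type*) [NormedAddCommGroup E] [NormedSpace ℝ E]
    (M : Type*) [TopologicalSpace M] [ChartedSpace E M] :=
  (x : M) → TangentSpace 𝓘(ℝ, E) x →L[ℝ] ℝ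

/-- `(0,2)`-tensor fields on `M`. -/
abbrev TensorField (E : Type*) [NormedAddCommGroup E] [NormedSpace ℝ E]
    (M : Type*) [TopologicalSpace M] [ChartedSpace E M] :=
  (x : M) → TangentSpace 𝓘(ℝ, E) x →L[ℝ] TangentSpace 𝓘(ℝ, E) x →L[ℝ] ℝ

/-- Smoothness of a vector field on a set. -/
def SmoothVectorOn [IsManifold 𝓘(ℝ, E) ∞ M] (V : VectorField E M) (s : Set M) : Prop :=
  ContMDiffOn 𝓘(ℝ, E) (𝓘(ℝ, E).prod 𝓘(ℝ, E)) ∞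
    (fun x ↦ (⟨x, V x⟩ : TangentBundle 𝓘(ℝ, E) M)) s

/-- Smoothness of a `(0,2)`-tensor field on a set. -/
def SmoothTensorOn [IsManifold 𝓘(ℝ, E) ∞ M] (T : TensorField E M) (s : Set M) : Prop :=
  ContMDiffOn 𝓘(ℝ, E) (𝓘(ℝ, E).prod 𝓘(ℝ, E →L[ℝ] E →L[ℝ] ℝ)) ∞
    (fun x ↦ Bundle.TotalSpace.mk' (E →L[ℝ] E →L[ℝ] ℝ)
      (E := fun x : M ↦ TangentSpace 𝓘(ℝ, E) x →L[ℝ] TangentSpace 𝓘(ℝ, E) x →L[ℝ] ℝ) x (T x)) s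

/-- A smooth semi-Riemannian metric on `M`. -/
structure SemiRiemannianMetric (E : Type*) [NormedAddCommGroup E] [NormedSpace ℝ E]
    (M : Type*) [TopologicalSpace M] [ChartedSpace E M] [IsManifold 𝓘(ℝ, E) ∞ M] where
  val : TensorField E M
  symm : ∀ x v w, val x v w = val x w v
  nondegenerate : ∀ x v, (∀ w, val x v w = 0) → v = 0
  smooth : SmoothTensorOn val Set.univ

/-- The preferred chart at `c`, as a partial equivalence `M → E`. -/
abbrev chart (E : Type*) [NormedAddCommGroup E] [NormedSpace ℝ E]
    {M : Type*} [TopologicalSpace M] [ChartedSpace E M] (c : M) : PartialEquiv M E :=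
  extChartAt 𝓘(ℝ, E) c

/-- A vector field read in the chart at `c`. -/
def vectorIn (c : M) (V : VectorField E M) : E → E :=
  VectorField.mpullback 𝓘(ℝ, E) 𝓘(ℝ, E) (chart E c).symm V

/-- A `1`-form read in the chart at `c`. -/
def formIn (c : M) (θ : OneForm E M) (u : E) : E →L[ℝ] ℝ :=
  θ ((chart E c).symm u) ∘L mfderiv 𝓘(ℝ, E) 𝓘(ℝ, E) (chart E c).symm u

/-- The pullback of a bilinear form by a linear map. -/
def pullbackForm {V W : Type*} [TopologicalSpace V] [AddCommGroup V] [Module ℝ V]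
    [IsTopologicalAddGroup V] [ContinuousSMul ℝ V] [TopologicalSpace W] [AddCommGroup W]
    [Module ℝ W] [IsTopologicalAddGroup W] [ContinuousSMul ℝ W]
    (A : V →L[ℝ] W) (b : W →L[ℝ] W →L[ℝ] ℝ) : V →L[ℝ] V →L[ℝ] ℝ :=
  ContinuousLinearMap.precomp ℝ A ∘L b ∘L A

/-- A `(0,2)`-tensor field read in the chart at `c`. -/
def tensorIn (c : M) (T : TensorField E M) (u : E) : E →L[ℝ] E →L[ℝ] ℝ :=
  pullbackForm (mfderiv 𝓘(ℝ, E) 𝓘(ℝ, E) (chart E c).symm u) (T ((chart E c).symm u))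

/-- The coordinates of a tangent vector at `x` in the chart at `x`. -/
def toCoords (x : M) : TangentSpace 𝓘(ℝ, E) x →L[ℝ] E :=
  mfderiv 𝓘(ℝ, E) 𝓘(ℝ, E) (chart E x) x

/-- The tangent vector at `x` with given coordinates in the chart at `x`. -/
def ofCoords (x : M) : E →L[ℝ] TangentSpace 𝓘(ℝ, E) x :=
  ContinuousLinearMap.inverse (toCoords x)

end Manifold

/-! ### Semi-Riemannian operators on a manifold

Each operator is evaluated at `x` by its coordinate formula in the chart at `x`. -/

section Operators

variable {E : Type*} [NormedAddCommGroup E] [NormedSpace ℝ E] [FiniteDimensional ℝ E]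
variable {M : Type*} [TopologicalSpace M] [ChartedSpace E M] [IsManifold 𝓘(ℝ, E) ∞ M]
variable (g : SemiRiemannianMetric E M)

/-- The Levi-Civita covariant derivative `∇_v V` at `x`, for `v ∈ T_x M`. -/
def covDeriv (V : VectorField E M) (x : M) (v : TangentSpace 𝓘(ℝ, E) x) :
    TangentSpace 𝓘(ℝ, E) x :=
  ofCoords x (covDerivL (tensorIn x g.val) (vectorIn x V) (chart E x x) (toCoords x v))

/-- The divergence `∇ · V` of a vector field. -/
def divergence (V : VectorField E M) (x : M) : ℝ :=
  traceCLM (covDerivL (tensorIn x g.val) (vectorIn x V) (chart E x x))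

/-- The divergence `∇ · T` of a `(0,2)`-tensor field, as the vector field `∇_i T^{ij}`. -/
def divTensor (T : TensorField E M) : VectorField E M := fun x ↦
  ofCoords x (sharpL (tensorIn x g.val (chart E x x))
    (divTensorCovectorL (tensorIn x g.val) (tensorIn x T) (chart E x x)))

/-- The Einstein curvature `G = Ric - (1/2) S g`. -/
def einstein : TensorField E M := fun x ↦
  pullbackForm (toCoords x) (einsteinL (tensorIn x g.val) (chart E x x))

/-- The endomorphism `ᵉT` associated with `T`: `g(u, ᵉT v) = T(u, v)`. -/
def endo (T : TensorField E M) (x : M) (v : TangentSpace 𝓘(ℝ, E) x) : TangentSpace 𝓘(ℝ, E) x :=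
  ofCoords x (sharpL (tensorIn x g.val (chart E x x))
    ((tensorIn x T (chart E x x)).flip (toCoords x v)))

/-- The full contraction `|T|_g = T_{ij} T^{ij}`. -/
def normSq (T : TensorField E M) (x : M) : ℝ :=
  traceCLM ((sharpL (tensorIn x g.val (chart E x x)) ∘L tensorIn x T (chart E x x)) ∘L
    (sharpL (tensorIn x g.val (chart E x x)) ∘L (tensorIn x T (chart E x x)).flip))

/-- The exterior derivative of a `1`-form. -/
def extDerivOne (θ : OneForm E M) : TensorField E M := fun x ↦
  pullbackForm (toCoords x) (extDerivOneL (formIn x θ) (chart E x x))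

/-- The exterior derivative of a `2`-form. -/
def extDerivTwo (F : TensorField E M) (x : M) (a b c : TangentSpace 𝓘(ℝ, E) x) : ℝ :=
  extDerivTwoL (tensorIn x F) (chart E x x) (toCoords x a) (toCoords x b) (toCoords x c)

/-- Killing vector fields, through Killing's equation `g(∇_v Y, w) + g(v, ∇_w Y) = 0`. -/
def IsKilling (Y : VectorField E M) : Prop :=
  ∀ x v w, g.val x (covDeriv g Y x v) w + g.val x v (covDeriv g Y x w) = 0

/-- The orthogonal of a subspace of `T_x M`. -/
def orth (x : M) (K : Submodule ℝ (TangentSpace 𝓘(ℝ, E) x)) :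
    Submodule ℝ (TangentSpace 𝓘(ℝ, E) x) where
  carrier := {v | ∀ w ∈ K, g.val x v w = 0}
  add_mem' ha hb w hw := by simp [ha w hw, hb w hw]
  zero_mem' w _ := by simp
  smul_mem' c v hv w hw := by simp [hv w hw]

open Classical in
/-- The orthogonal projection `pr_K` on a subspace `K` of `T_x M` (zero at `v` if `v` has no
decomposition in `K + K^⊥`, which does not happen if `g` is nondegenerate on `K`). -/
def orthProj (x : M) (K : Submodule ℝ (TangentSpace 𝓘(ℝ, E) x))
    (v : TangentSpace 𝓘(ℝ, E) x) : TangentSpace 𝓘(ℝ, E) x :=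
  if h : ∃ w ∈ K, v - w ∈ orth g x K then h.choose else 0

end Operators

/-! ### Multi-fiber bundles and Kaluza-Klein spacetimes -/

section Fibers

variable {E EB ES EW : Type*} [NormedAddCommGroup E] [NormedSpace ℝ E]
  [NormedAddCommGroup EB] [NormedSpace ℝ EB] [NormedAddCommGroup ES] [NormedSpace ℝ ES]
  [NormedAddCommGroup EW] [NormedSpace ℝ EW]
variable {M B S W : Type*} [TopologicalSpace M] [ChartedSpace E M]
  [TopologicalSpace B] [ChartedSpace EB B] [TopologicalSpace S] [ChartedSpace ES S]
  [TopologicalSpace W] [ChartedSpace EW W]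

/-- `(π, Φ)` is a multi-fiber bundle structure on `M` with base `B` and fibers `(S, W)`: `π` is a
smooth fiber bundle with fiber `S × W`, and the smooth map `Φ` restricts to a diffeomorphism of each
fiber of `π` onto `S × W` (with inverse `σ` below). -/
structure IsMultiFiberBundle (E EB ES EW : Type*) [NormedAddCommGroup E] [NormedSpace ℝ E]
    [NormedAddCommGroup EB] [NormedSpace ℝ EB] [NormedAddCommGroup ES] [NormedSpace ℝ ES]
    [NormedAddCommGroup EW] [NormedSpace ℝ EW]
    {M B S W : Type*} [TopologicalSpace M] [ChartedSpace E M]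
    [TopologicalSpace B] [ChartedSpace EB B] [TopologicalSpace S] [ChartedSpace ES S]
    [TopologicalSpace W] [ChartedSpace EW W] (π : M → B) (Φ : M → S × W) : Prop where
  smooth_proj : ContMDiff 𝓘(ℝ, E) 𝓘(ℝ, EB) ∞ π
  smooth_splitting : ContMDiff 𝓘(ℝ, E) (𝓘(ℝ, ES).prod 𝓘(ℝ, EW)) ∞ Φ
  locally_trivial : ∀ b : B, ∃ e : Bundle.Trivialization (S × W) π, b ∈ e.baseSet ∧
    ContMDiffOn 𝓘(ℝ, E) (𝓘(ℝ, EB).prod (𝓘(ℝ, ES).prod 𝓘(ℝ, EW))) ∞ e e.source ∧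
    ContMDiffOn (𝓘(ℝ, EB).prod (𝓘(ℝ, ES).prod 𝓘(ℝ, EW))) 𝓘(ℝ, E) ∞
      e.toOpenPartialHomeomorph.symm e.target
  fiber_diffeo : ∀ b : B, ∃ σ : S × W → M,
    ContMDiff (𝓘(ℝ, ES).prod 𝓘(ℝ, EW)) 𝓘(ℝ, E) ∞ σ ∧
    (∀ q, π (σ q) = b) ∧ (∀ q, Φ (σ q) = q) ∧ ∀ y, π y = b → σ (Φ y) = y

/-- The tangent space at `x` of the `π`-fiber through `x`. -/
def tangentFiber (EB : Type*) [NormedAddCommGroup EB] [NormedSpace ℝ EB] [ChartedSpace EB B]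
    (π : M → B) (x : M) : Submodule ℝ (TangentSpace 𝓘(ℝ, E) x) :=
  LinearMap.ker (mfderiv 𝓘(ℝ, E) 𝓘(ℝ, EB) π x).toLinearMap

/-- The tangent space at `x` of the `S`-fiber `{y | π y = π x ∧ f y = f x}`, where `Φ = (h, f)`. -/
def tangentFiberS (EB EW : Type*) [NormedAddCommGroup EB] [NormedSpace ℝ EB] [ChartedSpace EB B]
    [NormedAddCommGroup EW] [NormedSpace ℝ EW] [ChartedSpace EW W]
    (π : M → B) (Φ : M → S × W) (x : M) : Submodule ℝ (TangentSpace 𝓘(ℝ, E) x) :=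
  tangentFiber EB π x ⊓
    LinearMap.ker (mfderiv 𝓘(ℝ, E) 𝓘(ℝ, EW) (fun y ↦ (Φ y).2) x).toLinearMap

/-- The tangent space at `x` of the `W`-fiber `{y | π y = π x ∧ h y = h x}`, where `Φ = (h, f)`. -/
def tangentFiberW (EB ES : Type*) [NormedAddCommGroup EB] [NormedSpace ℝ EB] [ChartedSpace EB B]
    [NormedAddCommGroup ES] [NormedSpace ℝ ES] [ChartedSpace ES S]
    (π : M → B) (Φ : M → S × W) (x : M) : Submodule ℝ (TangentSpace 𝓘(ℝ, E) x) :=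
  tangentFiber EB π x ⊓
    LinearMap.ker (mfderiv 𝓘(ℝ, E) 𝓘(ℝ, ES) (fun y ↦ (Φ y).1) x).toLinearMap

end Fibers

section Spacetime

variable {E EB EW : Type*} [NormedAddCommGroup E] [NormedSpace ℝ E] [FiniteDimensional ℝ E]
  [NormedAddCommGroup EB] [NormedSpace ℝ EB] [NormedAddCommGroup EW] [NormedSpace ℝ EW]
variable {M B W : Type*} [TopologicalSpace M] [ChartedSpace E M] [IsManifold 𝓘(ℝ, E) ∞ M]
  [TopologicalSpace B] [ChartedSpace EB B] [TopologicalSpace W] [ChartedSpace EW W]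

/-- The horizontal space `H_x`, orthogonal to the tangent space of the `π`-fiber. -/
def horizontal (EB : Type*) [NormedAddCommGroup EB] [NormedSpace ℝ EB] [ChartedSpace EB B]
    (g : SemiRiemannianMetric E M) (π : M → B) (x : M) : Submodule ℝ (TangentSpace 𝓘(ℝ, E) x) :=
  orth g x (tangentFiber EB π x)

/-- `(M, g)` with `(π, Φ)` is a multi-fiber Kaluza-Klein spacetime of dimension `5 + m` with fiber
`S¹ × W`: the metric has signature `(-)` on the `S¹`-fibers, `(+, …, +)` on the `W`-fibers and
`(-, +, +, +)` on the horizontal spaces. -/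
structure IsSpacetime (EB EW : Type*) [NormedAddCommGroup EB] [NormedSpace ℝ EB]
    [ChartedSpace EB B] [NormedAddCommGroup EW] [NormedSpace ℝ EW] [ChartedSpace EW W]
    (m : ℕ) (g : SemiRiemannianMetric E M) (π : M → B) (Φ : M → Circle × W) : Prop where
  dim_total : Module.finrank ℝ E = 5 + m
  dim_base : Module.finrank ℝ EB = 4
  dim_fiber : Module.finrank ℝ EW = m
  bundle : IsMultiFiberBundle E EB (EuclideanSpace ℝ (Fin 1)) EW π Φ
  signature_circle : ∀ x, ∀ v ∈ tangentFiberS EB EW π Φ x, v ≠ 0 → g.val x v v < 0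
  signature_W : ∀ x, ∀ v ∈ tangentFiberW EB (EuclideanSpace ℝ (Fin 1)) π Φ x,
    v ≠ 0 → 0 < g.val x v v
  signature_horizontal : ∀ x, ∃ u ∈ horizontal EB g π x, g.val x u u < 0 ∧
    ∀ v ∈ horizontal EB g π x, g.val x u v = 0 → v ≠ 0 → 0 < g.val x v v

/-- `Y` is the electromagnetic potential: the smooth vector field tangent to the `S¹`-fibers with
`g(Y, Y) = -1` that is positive for the standard (counterclockwise) orientation of `S¹`, where
`Φ = (h, f)` and `h` is read in `ℂ`. -/
structure IsElectromagneticPotential (EB EW : Type*) [NormedAddCommGroup EB] [NormedSpace ℝ EB]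
    [ChartedSpace EB B] [NormedAddCommGroup EW] [NormedSpace ℝ EW] [ChartedSpace EW W]
    (g : SemiRiemannianMetric E M) (π : M → B) (Φ : M → Circle × W)
    (Y : VectorField E M) : Prop where
  smooth : SmoothVectorOn Y Set.univ
  tangent : ∀ x, Y x ∈ tangentFiberS EB EW π Φ x
  unit : ∀ x, g.val x (Y x) (Y x) = -1
  oriented : ∀ x, ∃ c : ℝ, 0 < c ∧
    mfderiv 𝓘(ℝ, E) 𝓘(ℝ, ℂ) (fun y ↦ ((Φ y).1 : ℂ)) x (Y x)
      = (c : ℂ) * (Complex.I * ((Φ x).1 : ℂ))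

/-- The electromagnetic field `F = d(Y^♭)`. -/
def electromagneticField (g : SemiRiemannianMetric E M) (Y : VectorField E M) : TensorField E M :=
  extDerivOne (fun x ↦ g.val x (Y x))

/-- The vector field `X = X₀ + (e / μ) Y` of the fluid. -/
def fluidField (X₀ Y : VectorField E M) (μ e : M → ℝ) : VectorField E M :=
  fun x ↦ X₀ x + (e x / μ x) • Y x

/-- The plane `T_x` generated by `X₀(x)` and `Y(x)`. -/
def fluidPlane (X₀ Y : VectorField E M) (x : M) : Submodule ℝ (TangentSpace 𝓘(ℝ, E) x) :=
  Submodule.span ℝ {X₀ x, Y x}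

/-- `D` is a general charged fluid domain with apparent field `X₀`, mass density `μ`, charge density
`e`, coefficient `α` and pressure tensor `P`: on `D`,
`G = μ X ⊗ X + α Y ⊗ Y + P` with `X = X₀ + (e / μ) Y`, where `X₀` is horizontal, unit, timelike, and
spans the eigenspace of `ᵉG_H = pr_H ∘ ᵉG|_H` of eigenvalue `-μ < 0`, and `P` is the part of `G`
outside the plane `T_x`. -/
structure IsFluidDomain (EB : Type*) [NormedAddCommGroup EB] [NormedSpace ℝ EB]
    [ChartedSpace EB B] (g : SemiRiemannianMetric E M) (π : M → B) (Y : VectorField E M)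
    (D : Set M) (X₀ : VectorField E M) (μ e α : M → ℝ) (P : TensorField E M) : Prop where
  isOpen : IsOpen D
  smooth_field : SmoothVectorOn X₀ D
  smooth_mass : ContMDiffOn 𝓘(ℝ, E) 𝓘(ℝ) ∞ μ D
  smooth_charge : ContMDiffOn 𝓘(ℝ, E) 𝓘(ℝ) ∞ e D
  smooth_coeff : ContMDiffOn 𝓘(ℝ, E) 𝓘(ℝ) ∞ α D
  smooth_pressure : SmoothTensorOn P D
  mass_pos : ∀ x ∈ D, 0 < μ x
  field_horizontal : ∀ x ∈ D, X₀ x ∈ horizontal EB g π x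
  field_unit : ∀ x ∈ D, g.val x (X₀ x) (X₀ x) = -1
  eigenspace : ∀ x ∈ D, ∀ v ∈ horizontal EB g π x,
    orthProj g x (horizontal EB g π x) (endo g (einstein g) x v) = (-μ x) • v ↔
      v ∈ Submodule.span ℝ {X₀ x}
  einstein_eq : ∀ x ∈ D, ∀ v w, einstein g x v w =
    μ x * (g.val x (fluidField X₀ Y μ e x) v * g.val x (fluidField X₀ Y μ e x) w)
      + α x * (g.val x (Y x) v * g.val x (Y x) w) + P x v w
  pressure_plane : ∀ x ∈ D, ∀ v ∈ fluidPlane X₀ Y x, ∀ w ∈ fluidPlane X₀ Y x, P x v w = 0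

end Spacetime

end KaluzaKlein

end

open KaluzaKlein

/-!
The equations are consequences of two facts: the Einstein curvature `G` is divergence-free, and
everything in sight is invariant under the Killing field `Y`. Since every operator is defined by its
coordinate formula in the chart at the point of evaluation, the argument is carried out on an open
subset of `E` (`IsFluidOn`), and transported to the manifold through the naturality of the
Levi-Civita connection and of the curvature under changes of charts (`IsIsometryOn`), which makes it
possible to read all the data in the single chart at `x` (`IsFluidDomain.isFluidOn`).

*Invariance.* The flow of `Y` preserves `g`, hence `G`, which is expressed by the vanishing of Lie
derivatives (`IsKillingOn.lie_einsteinL`). It also preserves the vertical vectors, hence the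
horizontal ones. The eigenvector equation says that the vector dual to `G(X₀, ·) + μ g(X₀, ·)` is
vertical. Its Lie derivative along `Y` is vertical too, and testing it against `X₀` and against an
arbitrary horizontal vector gives `Y(μ) = 0` and then that `[Y, X₀]` is an eigenvector for `-μ`.
As the eigenspace is a line and `X₀` has constant length, `[Y, X₀] = 0`
(`IsFluidOn.bracket_eq_zero`). Evaluating `G` on `(X₀, Y)` and `(Y, Y)` then gives `Y(e) = 0` and
`Y(α) = 0`.

*Conservation laws and motion.* A Killing field of constant length satisfies `∇_Y Y = 0` and
`∇ · Y = 0`, so `α Y ⊗ Y` has no divergence, and `∇ · G = 0`, the contracted second Bianchi identity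
(`IsMetricOn.divTensorCovectorL_einsteinL`), becomes `∇ · P = -(∇ · (μX)) X - μ ∇_X X`
(`IsFluidOn.divTensorCovectorL_pressure`). The products with `X₀` and `Y` are the conservation of
energy and charge, and what remains is the motion of the fluid. Since `[Y, X₀] = 0` and the
endomorphism of `F` is `-2 ∇Y`, expanding `X = X₀ + (e/μ) Y` gives the motion of the apparent fluid
(`IsFluidOn.apparent_motion`). The divergence of `ᵉP(Y)` is `⟨Y, ∇ · P⟩` because the symmetric `P`
contracts to zero with the skew-symmetric `∇Y`.

*Maxwell equations.* `F` is exact. From `∇²_{a,b} Y = -R(Y, a) b` follow `∇ · F = -2 Ric(Y)` and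
`Ric(Y, Y) = |∇Y|²`, and `Ric(Y)` is read off the decomposition of `G` (`IsFluidOn.maxwell`).
-/

set_option linter.unusedSectionVars false

namespace KaluzaKlein

section LocalCalculus

variable {E : Type*} [NormedAddCommGroup E] [NormedSpace ℝ E] [FiniteDimensional ℝ E]
variable {F F' G : Type*} [NormedAddCommGroup F] [NormedSpace ℝ F]
  [NormedAddCommGroup F'] [NormedSpace ℝ F'] [NormedAddCommGroup G] [NormedSpace ℝ G]

/-! ### Semi-Riemannian metrics and traces -/

theorem flipCLM_apply (b : E →L[ℝ] E →L[ℝ] F) (v w : E) : flipCLM E F b v w = b w v := rfl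

/-- The Leibniz rule for the evaluation of a field of linear maps at a vector field. -/
theorem fderiv_clm_apply_apply
    {c : G → F →L[ℝ] F'} {v : G → F} {u : G} (hc : DifferentiableAt ℝ c u)
    (hv : DifferentiableAt ℝ v u) (a : G) :
    fderiv ℝ (fun y ↦ c y (v y)) u a = fderiv ℝ c u a (v u) + c u (fderiv ℝ v u a) := by
  rw [fderiv_clm_apply hc hv]
  simp [add_comm]

theorem fderiv_clm_apply_const
    {c : G → F →L[ℝ] F'} {u : G} (hc : DifferentiableAt ℝ c u) (v : F) (a : G) :
    fderiv ℝ (fun y ↦ c y v) u a = fderiv ℝ c u a v := by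
  rw [fderiv_clm_apply_apply hc (by fun_prop)]
  simp

theorem fderiv_clm_apply_const₂ {H : Type*} [NormedAddCommGroup H] [NormedSpace ℝ H]
    {c : G → H →L[ℝ] F →L[ℝ] F'} {u : G} (hc : DifferentiableAt ℝ c u) (v : H) (w : F) (a : G) :
    fderiv ℝ (fun y ↦ c y v w) u a = fderiv ℝ c u a v w := by
  rw [fderiv_clm_apply_const (by fun_prop), fderiv_clm_apply_const hc]

/-- A smooth semi-Riemannian metric on an open subset `U` of `E`. -/
structure IsMetricOn (g : E → E →L[ℝ] E →L[ℝ] ℝ) (U : Set E) : Prop where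
  isOpen : IsOpen U
  contDiffOn : ContDiffOn ℝ ∞ g U
  symm : ∀ u ∈ U, ∀ v w, g u v w = g u w v
  nondegenerate : ∀ u ∈ U, ∀ v, (∀ w, g u v w = 0) → v = 0

/-- A nondegenerate form, as an isomorphism onto the dual. -/
theorem exists_equiv_of_nondegenerate {b : E →L[ℝ] E →L[ℝ] ℝ}
    (hb : ∀ v, (∀ w, b v w = 0) → v = 0) :
    ∃ f : E ≃L[ℝ] (E →L[ℝ] ℝ), (f : E →L[ℝ] E →L[ℝ] ℝ) = b := by
  have hinj : Function.Injective b.toLinearMap := by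
    rw [injective_iff_map_eq_zero]
    intro v hv
    refine hb v fun w ↦ ?_
    have : b v = 0 := hv
    simp [this]
  have hdim : Module.finrank ℝ E = Module.finrank ℝ (E →L[ℝ] ℝ) := by
    rw [← (LinearMap.toContinuousLinearMap (𝕜 := ℝ) (E := E) (F' := ℝ)).finrank_eq]
    exact (Subspace.dual_finrank_eq (K := ℝ) (V := E)).symm
  refine ⟨(LinearEquiv.ofInjectiveOfFinrankEq b.toLinearMap hinj hdim).toContinuousLinearEquiv,
    ?_⟩
  ext v w
  rfl

theorem sharpL_apply_apply {b : E →L[ℝ] E →L[ℝ] ℝ} (hb : ∀ v, (∀ w, b v w = 0) → v = 0)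
    (θ : E →L[ℝ] ℝ) (w : E) : b (sharpL b θ) w = θ w := by
  obtain ⟨f, rfl⟩ := exists_equiv_of_nondegenerate hb
  have := f.apply_symm_apply θ
  simp only [sharpL, ContinuousLinearMap.inverse_equiv]
  exact congrArg (fun φ : E →L[ℝ] ℝ ↦ φ w) this

theorem eq_of_form_eq {b : E →L[ℝ] E →L[ℝ] ℝ} (hb : ∀ v, (∀ w, b v w = 0) → v = 0)
    {v v' : E} (h : ∀ w, b v w = b v' w) : v = v' :=
  sub_eq_zero.1 <| hb _ fun w ↦ by simp [h w]

theorem sharpL_eq_iff {b : E →L[ℝ] E →L[ℝ] ℝ} (hb : ∀ v, (∀ w, b v w = 0) → v = 0)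
    (θ : E →L[ℝ] ℝ) (v : E) : sharpL b θ = v ↔ ∀ w, b v w = θ w := by
  constructor
  · rintro rfl w
    exact sharpL_apply_apply hb θ w
  · intro h
    exact eq_of_form_eq hb fun w ↦ by rw [sharpL_apply_apply hb, h]

/-- A basis of `E` together with its dual basis with respect to a nondegenerate symmetric form `b`.
All the traces and contractions below are computed with such a pair of bases. -/
structure IsDualPair {ι : Type*} [Fintype ι] (b : E →L[ℝ] E →L[ℝ] ℝ) (e e' : ι → E) : Prop where
  trace : ∀ L : E →L[ℝ] E, traceCLM L = ∑ i, b (L (e i)) (e' i)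
  swap : ∀ T : E →L[ℝ] E →L[ℝ] ℝ, ∑ i, T (e i) (e' i) = ∑ i, T (e' i) (e i)
  expand : ∀ v, ∑ i, b v (e' i) • e i = v

theorem exists_isDualPair {b : E →L[ℝ] E →L[ℝ] ℝ} (hb : ∀ v, (∀ w, b v w = 0) → v = 0)
    (hs : ∀ v w, b v w = b w v) :
    ∃ e e' : Fin (Module.finrank ℝ E) → E, IsDualPair b e e' := by
  let β := Module.finBasis ℝ E
  let e' : Fin (Module.finrank ℝ E) → E :=
    fun i ↦ sharpL b (LinearMap.toContinuousLinearMap (β.coord i))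
  have he' : ∀ i w, b (e' i) w = β.repr w i := fun i w ↦ by
    simp only [e']
    rw [sharpL_apply_apply hb]
    simp
  have hexp : ∀ v, ∑ i, b v (e' i) • β i = v := fun v ↦ by
    simp only [hs v, he']
    exact β.sum_repr v
  refine ⟨β, e', ?_, ?_, hexp⟩
  · intro L
    have : traceCLM L = LinearMap.trace ℝ E L.toLinearMap := rfl
    rw [this, LinearMap.trace_eq_matrix_trace ℝ β, Matrix.trace]
    refine Finset.sum_congr rfl fun i _ ↦ ?_
    rw [hs, he']
    simp [LinearMap.toMatrix_apply]
  · intro T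
    have h1 : ∀ i, T (β i) (e' i) = ∑ j, b (e' i) (e' j) * T (β i) (β j) := fun i ↦ by
      conv_lhs => rw [← hexp (e' i)]
      simp
    have h2 : ∀ j, T (e' j) (β j) = ∑ i, b (e' i) (e' j) * T (β i) (β j) := fun j ↦ by
      conv_lhs => rw [← hexp (e' j)]
      simp [hs (e' j)]
    simp only [h1, h2]
    exact Finset.sum_comm

theorem IsDualPair.trace_sharpL {ι : Type*} [Fintype ι] {b : E →L[ℝ] E →L[ℝ] ℝ} {e e' : ι → E}
    (h : IsDualPair b e e') (hb : ∀ v, (∀ w, b v w = 0) → v = 0) (T : E →L[ℝ] E →L[ℝ] ℝ) :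
    traceCLM (sharpL b ∘L T) = ∑ i, T (e i) (e' i) := by
  rw [h.trace]
  refine Finset.sum_congr rfl fun i _ ↦ ?_
  exact sharpL_apply_apply hb _ _

variable {g : E → E →L[ℝ] E →L[ℝ] ℝ} {U : Set E}

theorem contDiffOn_fderiv {U : Set G} (hU : IsOpen U) {f : G → F} (hf : ContDiffOn ℝ ∞ f U) :
    ContDiffOn ℝ ∞ (fderiv ℝ f) U :=
  hf.fderiv_of_isOpen hU (by simp)

theorem differentiableAt_of_contDiffOn {U : Set G} (hU : IsOpen U) {f : G → F}
    (hf : ContDiffOn ℝ ∞ f U) {u : G} (hu : u ∈ U) : DifferentiableAt ℝ f u :=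
  (hf.contDiffAt (hU.mem_nhds hu)).differentiableAt (by simp)

theorem fderiv_congr_of_eqOn {U : Set G} (hU : IsOpen U) {f f' : G → F}
    (h : ∀ u ∈ U, f u = f' u) {u : G} (hu : u ∈ U) : fderiv ℝ f u = fderiv ℝ f' u :=
  Filter.EventuallyEq.fderiv_eq (Filter.eventually_of_mem (hU.mem_nhds hu) h)

theorem fderiv_fderiv_symm {U : Set G} (hU : IsOpen U) {f : G → F} (hf : ContDiffOn ℝ ∞ f U)
    {u : G} (hu : u ∈ U) (a b : G) :
    fderiv ℝ (fderiv ℝ f) u a b = fderiv ℝ (fderiv ℝ f) u b a :=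
  ((hf.contDiffAt (hU.mem_nhds hu)).isSymmSndFDerivAt (by
    simpa using WithTop.coe_le_coe.2 (le_top : (2 : ℕ∞) ≤ ⊤))).eq a b

namespace IsMetricOn

theorem contDiffOn_sharpL (hg : IsMetricOn g U) : ContDiffOn ℝ ∞ (fun u ↦ sharpL (g u)) U := by
  intro u hu
  have : CompleteSpace E := FiniteDimensional.complete ℝ E
  obtain ⟨f, hf⟩ := exists_equiv_of_nondegenerate (hg.nondegenerate u hu)
  have h1 : ContDiffAt ℝ ∞ (ContinuousLinearMap.inverse : (E →L[ℝ] E →L[ℝ] ℝ) → _) (g u) := by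
    rw [← hf]
    exact contDiffAt_map_inverse f
  exact h1.comp_contDiffWithinAt u (hg.contDiffOn u hu)

theorem contDiffOn_koszulL (hg : IsMetricOn g U) : ContDiffOn ℝ ∞ (koszulL g) U := by
  have h := contDiffOn_fderiv hg.isOpen hg.contDiffOn
  have h1 : ContDiffOn ℝ ∞ (fun u ↦ flipCLM E (E →L[ℝ] ℝ) (fderiv ℝ g u)) U :=
    (ContinuousLinearMap.contDiff _).comp_contDiffOn h
  have h2 : ContDiffOn ℝ ∞ (fun u ↦ (compL ℝ E _ _ (flipCLM E ℝ))
      (flipCLM E (E →L[ℝ] ℝ) (fderiv ℝ g u))) U :=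
    (ContinuousLinearMap.contDiff _).comp_contDiffOn h1
  exact (h.add h1).sub h2

theorem contDiffOn_christoffelL (hg : IsMetricOn g U) : ContDiffOn ℝ ∞ (christoffelL g) U := by
  have h1 : ContDiffOn ℝ ∞ (fun u ↦ compL ℝ E (E →L[ℝ] ℝ) E (sharpL (g u))) U :=
    (ContinuousLinearMap.contDiff _).comp_contDiffOn hg.contDiffOn_sharpL
  exact (h1.clm_comp hg.contDiffOn_koszulL).const_smul (1 / 2 : ℝ)

theorem contDiffOn_riemannAuxL (hg : IsMetricOn g U) : ContDiffOn ℝ ∞ (riemannAuxL g) U := by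
  have h := hg.contDiffOn_christoffelL
  have h1 : ContDiffOn ℝ ∞ (fun u ↦ ContinuousLinearMap.flipₗᵢ ℝ E (E →L[ℝ] E) (E →L[ℝ] E)
      (compL ℝ E E E ∘L christoffelL g u)) U :=
    (ContinuousLinearMap.flipₗᵢ ℝ E (E →L[ℝ] E) (E →L[ℝ] E)).contDiff.comp_contDiffOn
      (contDiffOn_const.clm_comp h)
  have h2 : ContDiffOn ℝ ∞ (fun u ↦ flipCLM E (E →L[ℝ] E)
      (ContinuousLinearMap.flipₗᵢ ℝ E (E →L[ℝ] E) (E →L[ℝ] E)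
        (compL ℝ E E E ∘L christoffelL g u) ∘L christoffelL g u)) U :=
    (ContinuousLinearMap.contDiff _).comp_contDiffOn (h1.clm_comp h)
  exact (contDiffOn_fderiv hg.isOpen h).add h2

theorem contDiffOn_riemannL (hg : IsMetricOn g U) : ContDiffOn ℝ ∞ (riemannL g) U :=
  hg.contDiffOn_riemannAuxL.sub
    ((flipCLM E (E →L[ℝ] E)).contDiff.comp_contDiffOn hg.contDiffOn_riemannAuxL)

/-- The Ricci curvature is the image of the Riemann curvature under a fixed linear map. -/
theorem _root_.KaluzaKlein.ricciL_eq (g : E → E →L[ℝ] E →L[ℝ] ℝ) :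
    ricciL g = fun u ↦ compL ℝ E _ _ (compL ℝ E (E →L[ℝ] E) ℝ traceCLM ∘L flipCLM E E)
      (flipCLM E (E →L[ℝ] E) (riemannL g u)) := by
  funext u
  rw [ContinuousLinearMap.compL_apply, ricciL, ContinuousLinearMap.comp_assoc]
  congr 1

theorem contDiffOn_ricciL (hg : IsMetricOn g U) : ContDiffOn ℝ ∞ (ricciL g) U := by
  have h1 := (flipCLM E (E →L[ℝ] E)).contDiff.comp_contDiffOn hg.contDiffOn_riemannL
  have h2 := (compL ℝ E (E →L[ℝ] E →L[ℝ] E) (E →L[ℝ] ℝ)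
    (compL ℝ E (E →L[ℝ] E) ℝ traceCLM ∘L flipCLM E E)).contDiff.comp_contDiffOn h1
  rw [ricciL_eq]
  exact h2

theorem contDiffOn_scalarL (hg : IsMetricOn g U) : ContDiffOn ℝ ∞ (scalarL g) U :=
  (traceCLM (E := E)).contDiff.comp_contDiffOn
    (hg.contDiffOn_sharpL.clm_comp hg.contDiffOn_ricciL)

end IsMetricOn

/-! ### The Levi-Civita connection -/

theorem koszulL_apply (g : E → E →L[ℝ] E →L[ℝ] ℝ) (u a b c : E) :
    koszulL g u a b c = fderiv ℝ g u a b c + fderiv ℝ g u b a c - fderiv ℝ g u c a b := rfl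

theorem riemannAuxL_apply (g : E → E →L[ℝ] E →L[ℝ] ℝ) (u a b c : E) :
    riemannAuxL g u a b c =
      fderiv ℝ (christoffelL g) u a b c + christoffelL g u a (christoffelL g u b c) := rfl

theorem riemannL_apply (g : E → E →L[ℝ] E →L[ℝ] ℝ) (u a b c : E) :
    riemannL g u a b c = riemannAuxL g u a b c - riemannAuxL g u b a c := rfl

theorem covDerivL_apply (g : E → E →L[ℝ] E →L[ℝ] ℝ) (V : E → E) (u a : E) :
    covDerivL g V u a = fderiv ℝ V u a + christoffelL g u a (V u) := rfl

theorem covDerivTensorL_apply (g T : E → E →L[ℝ] E →L[ℝ] ℝ) (u a b c : E) :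
    covDerivTensorL g T u a b c = fderiv ℝ T u a b c - T u (christoffelL g u a b) c
      - T u b (christoffelL g u a c) := rfl

namespace IsMetricOn

theorem fderiv_symm (hg : IsMetricOn g U) {u : E} (hu : u ∈ U) (a b c : E) :
    fderiv ℝ g u a b c = fderiv ℝ g u a c b := by
  have hd := differentiableAt_of_contDiffOn hg.isOpen hg.contDiffOn hu
  have h := fderiv_congr_of_eqOn hg.isOpen (fun u hu ↦ hg.symm u hu b c) hu
  have h' := congrArg (fun φ ↦ φ a) h
  rwa [fderiv_clm_apply_const₂ hd, fderiv_clm_apply_const₂ hd] at h'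

/-- The Koszul formula. -/
theorem two_mul_christoffelL (hg : IsMetricOn g U) {u : E} (hu : u ∈ U) (a b c : E) :
    2 * g u (christoffelL g u a b) c = koszulL g u a b c := by
  have : christoffelL g u a b = (1 / 2 : ℝ) • sharpL (g u) (koszulL g u a b) := rfl
  rw [this, map_smul, smul_apply,
    sharpL_apply_apply (hg.nondegenerate u hu), smul_eq_mul]
  ring

theorem christoffelL_symm (hg : IsMetricOn g U) {u : E} (hu : u ∈ U) (a b : E) :
    christoffelL g u a b = christoffelL g u b a := by
  refine eq_of_form_eq (hg.nondegenerate u hu) fun c ↦ ?_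
  have h1 := hg.two_mul_christoffelL hu a b c
  have h2 := hg.two_mul_christoffelL hu b a c
  have h3 := hg.fderiv_symm hu c a b
  simp only [koszulL_apply] at h1 h2
  linarith

/-- The Levi-Civita connection is compatible with the metric. -/
theorem fderiv_metric (hg : IsMetricOn g U) {u : E} (hu : u ∈ U) (a b c : E) :
    fderiv ℝ g u a b c = g u (christoffelL g u a b) c + g u b (christoffelL g u a c) := by
  have h1 := hg.two_mul_christoffelL hu a b c
  have h2 := hg.two_mul_christoffelL hu a c b
  rw [hg.symm u hu b]
  simp only [koszulL_apply] at h1 h2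
  linarith [hg.fderiv_symm hu a b c, hg.fderiv_symm hu b a c, hg.fderiv_symm hu c a b]

/-- The Leibniz rule for the derivative of the scalar product of two vector fields. -/
theorem fderiv_inner (hg : IsMetricOn g U) {V V' : E → E} {u : E} (hu : u ∈ U)
    (hV : DifferentiableAt ℝ V u) (hV' : DifferentiableAt ℝ V' u) (a : E) :
    fderiv ℝ (fun y ↦ g y (V y) (V' y)) u a =
      g u (covDerivL g V u a) (V' u) + g u (V u) (covDerivL g V' u a) := by
  have hd := differentiableAt_of_contDiffOn hg.isOpen hg.contDiffOn hu
  rw [fderiv_clm_apply_apply (hd.clm_apply hV) hV', fderiv_clm_apply_apply hd hV]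
  simp only [add_apply, covDerivL_apply, map_add, hg.fderiv_metric hu]
  ring

end IsMetricOn

/-! ### Symmetries of the curvature tensor and the Bianchi identities -/

/-- The contraction `R ↦ ((w, z) ↦ tr (v ↦ R(v, w) z))` which yields the Ricci curvature. -/
noncomputable def ricciTraceL : (E →L[ℝ] E →L[ℝ] E →L[ℝ] E) →L[ℝ] (E →L[ℝ] E →L[ℝ] ℝ) :=
  compL ℝ E (E →L[ℝ] E →L[ℝ] E) (E →L[ℝ] ℝ)
    (compL ℝ E (E →L[ℝ] E) ℝ traceCLM ∘L flipCLM E E) ∘L flipCLM E (E →L[ℝ] E)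

theorem ricciTraceL_apply (R : E →L[ℝ] E →L[ℝ] E →L[ℝ] E) (w z : E) :
    ricciTraceL R w z = traceCLM (flipCLM E E (flipCLM E (E →L[ℝ] E) R w) z) := rfl

theorem ricciL_eq_ricciTraceL (g : E → E →L[ℝ] E →L[ℝ] ℝ) :
    ricciL g = fun u ↦ ricciTraceL (riemannL g u) := ricciL_eq g

theorem IsDualPair.ricciTraceL_apply {ι : Type*} [Fintype ι] {b : E →L[ℝ] E →L[ℝ] ℝ}
    {e e' : ι → E} (h : IsDualPair b e e') (R : E →L[ℝ] E →L[ℝ] E →L[ℝ] E) (w z : E) :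
    ricciTraceL R w z = ∑ i, b (R (e i) w z) (e' i) := by
  rw [KaluzaKlein.ricciTraceL_apply, h.trace]
  rfl

theorem trace_comp_comm (A B : E →L[ℝ] E) : traceCLM (A ∘L B) = traceCLM (B ∘L A) :=
  LinearMap.trace_mul_comm ℝ A.toLinearMap B.toLinearMap

theorem IsDualPair.divTensorCovectorL_apply {ι : Type*} [Fintype ι] {u : E} {e e' : ι → E}
    (h : IsDualPair (g u) e e') (hb : ∀ v, (∀ w, g u v w = 0) → v = 0)
    (T : E → E →L[ℝ] E →L[ℝ] ℝ) (c : E) :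
    divTensorCovectorL g T u c = ∑ i, covDerivTensorL g T u (e i) (e' i) c := by
  have : divTensorCovectorL g T u c =
      traceCLM (sharpL (g u) ∘L (flipCLM E ℝ ∘L covDerivTensorL g T u).flip c) := rfl
  rw [this, h.trace_sharpL hb]
  rfl

/-- The covariant derivative `(∇_a R)(b, c) z` of the curvature tensor. -/
noncomputable def covDerivRiemannL (g : E → E →L[ℝ] E →L[ℝ] ℝ) (u a b c z : E) : E :=
  fderiv ℝ (riemannL g) u a b c z + christoffelL g u a (riemannL g u b c z)
    - riemannL g u (christoffelL g u a b) c z - riemannL g u b (christoffelL g u a c) z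
    - riemannL g u b c (christoffelL g u a z)

theorem riemannL_swap (g : E → E →L[ℝ] E →L[ℝ] ℝ) (u a b c : E) :
    riemannL g u a b c = -riemannL g u b a c := by
  simp only [riemannL_apply]
  abel

theorem fderiv_clm_apply_const₃ {H : Type*} [NormedAddCommGroup H] [NormedSpace ℝ H]
    {c : G → E →L[ℝ] F →L[ℝ] F' →L[ℝ] H} {u : G}
    (hc : DifferentiableAt ℝ c u) (v : E) (w : F) (z : F') (a : G) :
    fderiv ℝ (fun y ↦ c y v w z) u a = fderiv ℝ c u a v w z := by
  rw [fderiv_clm_apply_const₂ (hc.clm_apply (differentiableAt_const v)), fderiv_clm_apply_const hc]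

theorem fderiv_add_apply {f f' : G → F} {u : G} (hf : DifferentiableAt ℝ f u)
    (hf' : DifferentiableAt ℝ f' u) (a : G) :
    fderiv ℝ (fun y ↦ f y + f' y) u a = fderiv ℝ f u a + fderiv ℝ f' u a := by
  rw [show (fun y ↦ f y + f' y) = f + f' from rfl, fderiv_add hf hf']
  rfl

theorem fderiv_sub_apply {f f' : G → F} {u : G} (hf : DifferentiableAt ℝ f u)
    (hf' : DifferentiableAt ℝ f' u) (a : G) :
    fderiv ℝ (fun y ↦ f y - f' y) u a = fderiv ℝ f u a - fderiv ℝ f' u a := by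
  rw [show (fun y ↦ f y - f' y) = f - f' from rfl, fderiv_sub hf hf']
  rfl

namespace IsMetricOn

variable {u : E}

theorem differentiableAt (hg : IsMetricOn g U) (hu : u ∈ U) : DifferentiableAt ℝ g u :=
  differentiableAt_of_contDiffOn hg.isOpen hg.contDiffOn hu

theorem differentiableAt_christoffelL (hg : IsMetricOn g U) (hu : u ∈ U) :
    DifferentiableAt ℝ (christoffelL g) u :=
  differentiableAt_of_contDiffOn hg.isOpen hg.contDiffOn_christoffelL hu

theorem differentiableAt_fderiv_christoffelL (hg : IsMetricOn g U) (hu : u ∈ U) :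
    DifferentiableAt ℝ (fderiv ℝ (christoffelL g)) u :=
  differentiableAt_of_contDiffOn hg.isOpen
    (contDiffOn_fderiv hg.isOpen hg.contDiffOn_christoffelL) hu

theorem differentiableAt_riemannAuxL (hg : IsMetricOn g U) (hu : u ∈ U) :
    DifferentiableAt ℝ (riemannAuxL g) u :=
  differentiableAt_of_contDiffOn hg.isOpen hg.contDiffOn_riemannAuxL hu

theorem differentiableAt_riemannL (hg : IsMetricOn g U) (hu : u ∈ U) :
    DifferentiableAt ℝ (riemannL g) u :=
  differentiableAt_of_contDiffOn hg.isOpen hg.contDiffOn_riemannL hu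

theorem differentiableAt_ricciL (hg : IsMetricOn g U) (hu : u ∈ U) :
    DifferentiableAt ℝ (ricciL g) u :=
  differentiableAt_of_contDiffOn hg.isOpen hg.contDiffOn_ricciL hu

theorem fderiv_christoffelL_symm (hg : IsMetricOn g U) (hu : u ∈ U) (a b c : E) :
    fderiv ℝ (christoffelL g) u a b c = fderiv ℝ (christoffelL g) u a c b := by
  have hd := hg.differentiableAt_christoffelL hu
  rw [← fderiv_clm_apply_const₂ hd, ← fderiv_clm_apply_const₂ hd,
    fderiv_congr_of_eqOn hg.isOpen (fun u hu ↦ hg.christoffelL_symm hu b c) hu]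

theorem riemannL_bianchi (hg : IsMetricOn g U) (hu : u ∈ U) (a b c : E) :
    riemannL g u a b c + riemannL g u b c a + riemannL g u c a b = 0 := by
  simp only [riemannL_apply, riemannAuxL_apply]
  rw [hg.fderiv_christoffelL_symm hu a b c, hg.fderiv_christoffelL_symm hu b c a,
    hg.fderiv_christoffelL_symm hu c a b, hg.christoffelL_symm hu b c, hg.christoffelL_symm hu c a,
    hg.christoffelL_symm hu a b]
  abel

/-- The endomorphism `R(a, b)` is skew-symmetric: differentiate twice the metric. -/
theorem riemannL_skew (hg : IsMetricOn g U) (hu : u ∈ U) (a b z w : E) :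
    g u (riemannL g u a b z) w = -g u (riemannL g u a b w) z := by
  have hd := hg.differentiableAt hu
  have hΓ := hg.differentiableAt_christoffelL hu
  have hd' : DifferentiableAt ℝ (fderiv ℝ g) u :=
    differentiableAt_of_contDiffOn hg.isOpen (contDiffOn_fderiv hg.isOpen hg.contDiffOn) hu
  have hc : ∀ p q, DifferentiableAt ℝ (fun y ↦ christoffelL g y p q) u := fun p q ↦
    (hΓ.clm_apply (differentiableAt_const p)).clm_apply (differentiableAt_const q)
  have key : ∀ a b, fderiv ℝ (fderiv ℝ g) u a b z w =
      g u (riemannAuxL g u a b z) w + g u (riemannAuxL g u a b w) z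
        + g u (christoffelL g u b z) (christoffelL g u a w)
        + g u (christoffelL g u b w) (christoffelL g u a z) := by
    intro a b
    have h := congrArg (fun φ ↦ φ a) (fderiv_congr_of_eqOn hg.isOpen
      (fun u hu ↦ (hg.fderiv_metric hu b z w).trans (congrArg _ (hg.symm u hu _ _))) hu)
    have h1 : ∀ p q r, DifferentiableAt ℝ (fun y ↦ g y (christoffelL g y p q) r) u := fun p q r ↦
      (hd.clm_apply (hc p q)).clm_apply (differentiableAt_const r)
    rw [fderiv_clm_apply_const₃ hd', fderiv_add_apply (h1 b z w) (h1 b w z),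
      fderiv_clm_apply_const (hd.clm_apply (hc b z)),
      fderiv_clm_apply_const (hd.clm_apply (hc b w)), fderiv_clm_apply_apply hd (hc b z),
      fderiv_clm_apply_apply hd (hc b w), fderiv_clm_apply_const₂ hΓ,
      fderiv_clm_apply_const₂ hΓ] at h
    rw [h]
    simp only [add_apply, hg.fderiv_metric hu, riemannAuxL_apply, map_add]
    ring
  have h1 := key a b
  have h2 := key b a
  rw [fderiv_fderiv_symm hg.isOpen hg.contDiffOn hu b a] at h2
  simp only [riemannL_apply, map_sub, sub_apply]
  linarith [hg.symm u hu (christoffelL g u a w) (christoffelL g u b z),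
    hg.symm u hu (christoffelL g u a z) (christoffelL g u b w)]

theorem covDerivRiemannL_swap (hg : IsMetricOn g U) (hu : u ∈ U) (a b c z : E) :
    covDerivRiemannL g u a b c z = -covDerivRiemannL g u a c b z := by
  have hR := hg.differentiableAt_riemannL hu
  have h : fderiv ℝ (riemannL g) u a b c z = -fderiv ℝ (riemannL g) u a c b z := by
    rw [← fderiv_clm_apply_const₃ hR, ← fderiv_clm_apply_const₃ hR,
      fderiv_congr_of_eqOn hg.isOpen (fun u hu ↦ riemannL_swap g u b c z) hu, fderiv_fun_neg]
    rfl
  simp only [covDerivRiemannL, h]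
  rw [riemannL_swap g u b c z, riemannL_swap g u _ c z, riemannL_swap g u b _ z,
    riemannL_swap g u b c, map_neg]
  abel

theorem covDerivRiemannL_skew (hg : IsMetricOn g U) (hu : u ∈ U) (a b c z w : E) :
    g u (covDerivRiemannL g u a b c z) w = -g u (covDerivRiemannL g u a b c w) z := by
  have hd := hg.differentiableAt hu
  have hR := hg.differentiableAt_riemannL hu
  have hc : ∀ q, DifferentiableAt ℝ (fun y ↦ riemannL g y b c q) u := fun q ↦
    ((hR.clm_apply (differentiableAt_const b)).clm_apply (differentiableAt_const c)).clm_apply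
      (differentiableAt_const q)
  have h := congrArg (fun φ ↦ φ a) (fderiv_congr_of_eqOn hg.isOpen
    (fun u hu ↦ hg.riemannL_skew hu b c z w) hu)
  rw [fderiv_fun_neg, neg_apply, fderiv_clm_apply_const (hd.clm_apply (hc z)),
    fderiv_clm_apply_const (hd.clm_apply (hc w)), fderiv_clm_apply_apply hd (hc z),
    fderiv_clm_apply_apply hd (hc w), fderiv_clm_apply_const₃ hR,
    fderiv_clm_apply_const₃ hR] at h
  simp only [add_apply, hg.fderiv_metric hu] at h
  simp only [covDerivRiemannL, map_add, map_sub, add_apply, sub_apply]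
  linarith [hg.riemannL_skew hu (christoffelL g u a b) c z w,
    hg.riemannL_skew hu b (christoffelL g u a c) z w,
    hg.riemannL_skew hu b c (christoffelL g u a z) w,
    hg.riemannL_skew hu b c (christoffelL g u a w) z]

theorem fderiv_riemannAuxL (hg : IsMetricOn g U) (hu : u ∈ U) (a b c z : E) :
    fderiv ℝ (riemannAuxL g) u a b c z = fderiv ℝ (fderiv ℝ (christoffelL g)) u a b c z
      + fderiv ℝ (christoffelL g) u a b (christoffelL g u c z)
      + christoffelL g u b (fderiv ℝ (christoffelL g) u a c z) := by
  have hΓ := hg.differentiableAt_christoffelL hu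
  have hc : ∀ p q, DifferentiableAt ℝ (fun y ↦ christoffelL g y p q) u := fun p q ↦
    (hΓ.clm_apply (differentiableAt_const p)).clm_apply (differentiableAt_const q)
  have hb := hΓ.clm_apply (differentiableAt_const b)
  have hd' := hg.differentiableAt_fderiv_christoffelL hu
  rw [← fderiv_clm_apply_const₃ (hg.differentiableAt_riemannAuxL hu)]
  simp only [riemannAuxL_apply]
  rw [fderiv_add_apply (((hd'.clm_apply (differentiableAt_const b)).clm_apply
      (differentiableAt_const c)).clm_apply (differentiableAt_const z)) (hb.clm_apply (hc c z)),
    fderiv_clm_apply_const₃ hd', fderiv_clm_apply_apply hb (hc c z), fderiv_clm_apply_const hΓ,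
    fderiv_clm_apply_const₂ hΓ]
  abel

theorem fderiv_riemannL (hg : IsMetricOn g U) (hu : u ∈ U) (a b c z : E) :
    fderiv ℝ (riemannL g) u a b c z =
      fderiv ℝ (riemannAuxL g) u a b c z - fderiv ℝ (riemannAuxL g) u a c b z := by
  have hA := hg.differentiableAt_riemannAuxL hu
  have hA' : ∀ p q r, DifferentiableAt ℝ (fun y ↦ riemannAuxL g y p q r) u := fun p q r ↦
    ((hA.clm_apply (differentiableAt_const p)).clm_apply (differentiableAt_const q)).clm_apply
      (differentiableAt_const r)
  rw [← fderiv_clm_apply_const₃ (hg.differentiableAt_riemannL hu)]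
  simp only [riemannL_apply]
  rw [fderiv_sub_apply (hA' b c z) (hA' c b z), fderiv_clm_apply_const₃ hA,
    fderiv_clm_apply_const₃ hA]

/-- The second Bianchi identity. -/
theorem covDerivRiemannL_bianchi (hg : IsMetricOn g U) (hu : u ∈ U) (a b c z : E) :
    covDerivRiemannL g u a b c z + covDerivRiemannL g u b c a z + covDerivRiemannL g u c a b z
      = 0 := by
  have hs := hg.christoffelL_symm hu
  have hs2 := fderiv_fderiv_symm hg.isOpen hg.contDiffOn_christoffelL hu
  simp only [covDerivRiemannL]
  rw [hs b a, hs c a, hs c b, riemannL_swap g u b (christoffelL g u a c),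
    riemannL_swap g u c (christoffelL g u a b), riemannL_swap g u a (christoffelL g u b c)]
  simp only [hg.fderiv_riemannL hu, hg.fderiv_riemannAuxL hu, riemannL_apply, riemannAuxL_apply,
    map_sub, map_add, hs2 b a, hs2 c a, hs2 c b]
  abel

end IsMetricOn

/-! ### The contracted Bianchi identity -/

/-- The endomorphism field associated with the Ricci curvature. -/
noncomputable def ricciEndL (g : E → E →L[ℝ] E →L[ℝ] ℝ) (u : E) : E →L[ℝ] E :=
  sharpL (g u) ∘L ricciL g u

namespace IsMetricOn

variable {u : E}

theorem ricciL_symm (hg : IsMetricOn g U) (hu : u ∈ U) (w z : E) :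
    ricciL g u w z = ricciL g u z w := by
  obtain ⟨e, e', h⟩ := exists_isDualPair (hg.nondegenerate u hu) (hg.symm u hu)
  -- By the first Bianchi identity, the difference is the trace of the skew endomorphism `R(w, z)`.
  have h0 : ∑ i, g u (riemannL g u w z (e i)) (e' i) = 0 := by
    have h1 := h.swap (g u ∘L riemannL g u w z)
    have h2 : ∑ i, g u (riemannL g u w z (e' i)) (e i) =
        -∑ i, g u (riemannL g u w z (e i)) (e' i) := by
      rw [← Finset.sum_neg_distrib]
      exact Finset.sum_congr rfl fun i _ ↦ hg.riemannL_skew hu w z (e' i) (e i)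
    simp only [ContinuousLinearMap.comp_apply] at h1
    linarith
  simp only [ricciL_eq_ricciTraceL, h.ricciTraceL_apply]
  rw [← sub_eq_zero, ← Finset.sum_sub_distrib, ← neg_eq_zero, ← h0, ← Finset.sum_neg_distrib]
  refine Finset.sum_congr rfl fun i _ ↦ ?_
  have hb := hg.riemannL_bianchi hu w z (e i)
  have : riemannL g u w z (e i) = riemannL g u (e i) z w - riemannL g u (e i) w z := by
    rw [riemannL_swap g u z (e i)] at hb
    rw [← sub_eq_zero, ← hb]
    abel
  rw [this, map_sub, sub_apply]
  ring

theorem fderiv_ricciL (hg : IsMetricOn g U) (hu : u ∈ U) (a : E) :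
    fderiv ℝ (ricciL g) u a = ricciTraceL (fderiv ℝ (riemannL g) u a) := by
  rw [ricciL_eq_ricciTraceL, show (fun u ↦ ricciTraceL (riemannL g u)) =
    (ricciTraceL : _ → E →L[ℝ] E →L[ℝ] ℝ) ∘ riemannL g from rfl,
    ((ricciTraceL (E := E)).hasFDerivAt.comp u
      (hg.differentiableAt_riemannL hu).hasFDerivAt).fderiv]
  rfl

/-- The covariant derivative commutes with the contraction of the curvature tensor. -/
theorem covDerivTensorL_ricciL (hg : IsMetricOn g U) (hu : u ∈ U) {ι : Type*} [Fintype ι]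
    {e e' : ι → E} (h : IsDualPair (g u) e e') (a c z : E) :
    covDerivTensorL g (ricciL g) u a c z =
      ∑ i, g u (covDerivRiemannL g u a (e i) c z) (e' i) := by
  -- The terms `tr (Γ_a ∘ L) - tr (L ∘ Γ_a)` with `L v = R(v, c) z` cancel.
  have ht := trace_comp_comm (christoffelL g u a)
    (flipCLM E E (flipCLM E (E →L[ℝ] E) (riemannL g u) c) z)
  rw [h.trace, h.trace] at ht
  simp only [ContinuousLinearMap.comp_apply, flipCLM_apply] at ht
  rw [covDerivTensorL_apply, hg.fderiv_ricciL hu]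
  simp only [ricciL_eq_ricciTraceL, h.ricciTraceL_apply]
  simp only [covDerivRiemannL, map_sub, map_add, sub_apply, add_apply, Finset.sum_sub_distrib,
    Finset.sum_add_distrib]
  linarith

theorem covDerivTensorL_symm (hg : IsMetricOn g U) {T : E → E →L[ℝ] E →L[ℝ] ℝ}
    (hT : ∀ u ∈ U, ∀ v w, T u v w = T u w v) (hu : u ∈ U) (hd : DifferentiableAt ℝ T u)
    (a b c : E) : covDerivTensorL g T u a b c = covDerivTensorL g T u a c b := by
  simp only [covDerivTensorL_apply]
  rw [← fderiv_clm_apply_const₂ hd, ← fderiv_clm_apply_const₂ hd,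
    fderiv_congr_of_eqOn hg.isOpen (fun u hu ↦ hT u hu b c) hu, hT u hu _ c, hT u hu b]
  ring

theorem inner_ricciEndL (hg : IsMetricOn g U) (hu : u ∈ U) (v w : E) :
    g u (ricciEndL g u v) w = ricciL g u v w :=
  sharpL_apply_apply (hg.nondegenerate u hu) _ _

theorem differentiableAt_ricciEndL (hg : IsMetricOn g U) (hu : u ∈ U) :
    DifferentiableAt ℝ (ricciEndL g) u :=
  differentiableAt_of_contDiffOn hg.isOpen
    (hg.contDiffOn_sharpL.clm_comp hg.contDiffOn_ricciL) hu

theorem fderiv_scalarL_eq_trace (hg : IsMetricOn g U) (hu : u ∈ U) (a : E) :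
    fderiv ℝ (scalarL g) u a = traceCLM (fderiv ℝ (ricciEndL g) u a) := by
  rw [show scalarL g = (traceCLM : (E →L[ℝ] E) → ℝ) ∘ ricciEndL g from rfl,
    ((traceCLM (E := E)).hasFDerivAt.comp u
      (hg.differentiableAt_ricciEndL hu).hasFDerivAt).fderiv]
  rfl

theorem fderiv_ricciL_eq_ricciEndL (hg : IsMetricOn g U) (hu : u ∈ U) (a v w : E) :
    fderiv ℝ (ricciL g) u a v w = fderiv ℝ g u a (ricciEndL g u v) w
      + g u (fderiv ℝ (ricciEndL g) u a v) w := by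
  have hd := hg.differentiableAt hu
  have hQ := hg.differentiableAt_ricciEndL hu
  have hQv := hQ.clm_apply (differentiableAt_const v)
  have := congrArg (fun φ ↦ φ a) (fderiv_congr_of_eqOn hg.isOpen
    (fun u hu ↦ hg.inner_ricciEndL hu v w) hu)
  rw [fderiv_clm_apply_const (hd.clm_apply hQv), fderiv_clm_apply_apply hd hQv,
    fderiv_clm_apply_const hQ, fderiv_clm_apply_const₂ (hg.differentiableAt_ricciL hu)] at this
  rw [← this, add_apply]

theorem fderiv_scalarL (hg : IsMetricOn g U) (hu : u ∈ U) {ι : Type*} [Fintype ι]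
    {e e' : ι → E} (h : IsDualPair (g u) e e') (a : E) :
    fderiv ℝ (scalarL g) u a = ∑ i, covDerivTensorL g (ricciL g) u a (e i) (e' i) := by
  have ht := trace_comp_comm (christoffelL g u a) (ricciEndL g u)
  rw [h.trace, h.trace] at ht
  simp only [ContinuousLinearMap.comp_apply, hg.inner_ricciEndL hu] at ht
  rw [hg.fderiv_scalarL_eq_trace hu, h.trace]
  simp only [covDerivTensorL_apply, hg.fderiv_ricciL_eq_ricciEndL hu, hg.fderiv_metric hu,
    hg.inner_ricciEndL hu, Finset.sum_sub_distrib, Finset.sum_add_distrib]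
  linarith

/-- The contracted second Bianchi identity `∇^i Ric_ij = (1/2) ∂_j S`. -/
theorem divTensorCovectorL_ricciL (hg : IsMetricOn g U) (hu : u ∈ U) (a : E) :
    2 * divTensorCovectorL g (ricciL g) u a = fderiv ℝ (scalarL g) u a := by
  obtain ⟨e, e', h⟩ := exists_isDualPair (hg.nondegenerate u hu) (hg.symm u hu)
  rw [h.divTensorCovectorL_apply (hg.nondegenerate u hu), hg.fderiv_scalarL hu h]
  have hs : ∀ i, covDerivTensorL g (ricciL g) u (e i) (e' i) a =
      covDerivTensorL g (ricciL g) u (e i) a (e' i) := fun i ↦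
    hg.covDerivTensorL_symm (fun u hu ↦ hg.ricciL_symm hu) hu (hg.differentiableAt_ricciL hu) _ _ _
  simp only [hs, hg.covDerivTensorL_ricciL hu h]
  have hN : ∀ i j, g u (covDerivRiemannL g u a (e i) (e j) (e' j)) (e' i) =
      g u (covDerivRiemannL g u (e i) (e j) a (e' i)) (e' j)
      + g u (covDerivRiemannL g u (e j) (e i) a (e' j)) (e' i) := by
    intro i j
    have hb := hg.covDerivRiemannL_bianchi hu a (e i) (e j) (e' j)
    rw [hg.covDerivRiemannL_swap hu (e j) a (e i)] at hb
    have hb' := congrArg (fun v ↦ g u v (e' i)) hb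
    simp only [map_add, map_neg, add_apply, neg_apply, map_zero, zero_apply] at hb'
    linarith [hg.covDerivRiemannL_skew hu (e i) (e j) a (e' j) (e' i)]
  simp only [hN, Finset.sum_add_distrib]
  rw [Finset.sum_comm]
  ring

theorem contDiffOn_einsteinL (hg : IsMetricOn g U) : ContDiffOn ℝ ∞ (einsteinL g) U :=
  hg.contDiffOn_ricciL.sub ((contDiffOn_const.mul hg.contDiffOn_scalarL).smul hg.contDiffOn)

theorem fderiv_einsteinL (hg : IsMetricOn g U) (hu : u ∈ U) (v w z : E) :
    fderiv ℝ (einsteinL g) u v w z = fderiv ℝ (ricciL g) u v w z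
      - ((1 / 2 : ℝ) * scalarL g u) * fderiv ℝ g u v w z
      - ((1 / 2 : ℝ) * fderiv ℝ (scalarL g) u v) * g u w z := by
  have hS : DifferentiableAt ℝ (scalarL g) u :=
    differentiableAt_of_contDiffOn hg.isOpen hg.contDiffOn_scalarL hu
  have : fderiv ℝ (einsteinL g) u = fderiv ℝ (ricciL g) u -
      (((1 / 2 : ℝ) * scalarL g u) • fderiv ℝ g u +
        ((1 / 2 : ℝ) • fderiv ℝ (scalarL g) u).smulRight (g u)) :=
    ((hg.differentiableAt_ricciL hu).hasFDerivAt.sub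
      ((hS.hasFDerivAt.const_mul (1 / 2 : ℝ)).smul (hg.differentiableAt hu).hasFDerivAt)).fderiv
  rw [this]
  simp
  ring

/-- The Einstein curvature is divergence-free. -/
theorem divTensorCovectorL_einsteinL (hg : IsMetricOn g U) (hu : u ∈ U) (a : E) :
    divTensorCovectorL g (einsteinL g) u a = 0 := by
  obtain ⟨e, e', h⟩ := exists_isDualPair (hg.nondegenerate u hu) (hg.symm u hu)
  have hc : ∀ v w z, covDerivTensorL g (einsteinL g) u v w z =
      covDerivTensorL g (ricciL g) u v w z
        - (1 / 2 : ℝ) * (fderiv ℝ (scalarL g) u v * g u w z) := by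
    intro v w z
    simp only [covDerivTensorL_apply, hg.fderiv_einsteinL hu, hg.fderiv_metric hu, einsteinL,
      sub_apply, smul_apply, smul_eq_mul]
    ring
  have hx : ∑ i, fderiv ℝ (scalarL g) u (e i) * g u (e' i) a = fderiv ℝ (scalarL g) u a := by
    conv_rhs => rw [← h.expand a]
    simp only [map_sum, map_smul, smul_eq_mul]
    exact Finset.sum_congr rfl fun i _ ↦ by rw [hg.symm u hu a, mul_comm]
  rw [h.divTensorCovectorL_apply (hg.nondegenerate u hu)]
  simp only [hc, Finset.sum_sub_distrib, ← Finset.mul_sum]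
  rw [hx, ← h.divTensorCovectorL_apply (hg.nondegenerate u hu),
    ← hg.divTensorCovectorL_ricciL hu a]
  ring

end IsMetricOn

/-! ### Naturality under changes of coordinates -/

/-- `τ` is a smooth isometric map from `(U', g')` to `(U, g)`, such as a change of coordinates. -/
structure IsIsometryOn (g' : E → E →L[ℝ] E →L[ℝ] ℝ) (U' : Set E)
    (g : E → E →L[ℝ] E →L[ℝ] ℝ) (U : Set E) (τ : E → E) : Prop where
  source : IsMetricOn g' U'
  target : IsMetricOn g U
  contDiffOn : ContDiffOn ℝ ∞ τ U'
  mapsTo : Set.MapsTo τ U' U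
  isometry : ∀ u ∈ U', ∀ a b, g' u a b = g (τ u) (fderiv ℝ τ u a) (fderiv ℝ τ u b)

namespace IsIsometryOn

variable {g' : E → E →L[ℝ] E →L[ℝ] ℝ} {U' : Set E} {τ : E → E} {u : E}

theorem differentiableAt (h : IsIsometryOn g' U' g U τ) (hu : u ∈ U') : DifferentiableAt ℝ τ u :=
  differentiableAt_of_contDiffOn h.source.isOpen h.contDiffOn hu

theorem contDiffOn_fderiv (h : IsIsometryOn g' U' g U τ) : ContDiffOn ℝ ∞ (fderiv ℝ τ) U' :=
  KaluzaKlein.contDiffOn_fderiv h.source.isOpen h.contDiffOn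

theorem differentiableAt_fderiv (h : IsIsometryOn g' U' g U τ) (hu : u ∈ U') :
    DifferentiableAt ℝ (fderiv ℝ τ) u :=
  differentiableAt_of_contDiffOn h.source.isOpen h.contDiffOn_fderiv hu

theorem exists_equiv (h : IsIsometryOn g' U' g U τ) (hu : u ∈ U') :
    ∃ f : E ≃L[ℝ] E, (f : E →L[ℝ] E) = fderiv ℝ τ u := by
  have hinj : Function.Injective (fderiv ℝ τ u).toLinearMap := by
    rw [injective_iff_map_eq_zero]
    intro v hv
    refine h.source.nondegenerate u hu v fun w ↦ ?_
    have : fderiv ℝ τ u v = 0 := hv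
    simp [h.isometry u hu, this]
  exact ⟨(LinearEquiv.ofInjectiveEndo _ hinj).toContinuousLinearEquiv, rfl⟩

theorem fderiv_comp_apply {H : Type*} [NormedAddCommGroup H] [NormedSpace ℝ H]
    (h : IsIsometryOn g' U' g U τ) (hu : u ∈ U') {f : E → H} (hf : DifferentiableAt ℝ f (τ u))
    (a : E) : fderiv ℝ (fun y ↦ f (τ y)) u a = fderiv ℝ f (τ u) (fderiv ℝ τ u a) := by
  rw [show (fun y ↦ f (τ y)) = f ∘ τ from rfl, fderiv_comp _ hf (h.differentiableAt hu)]
  rfl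

theorem fderiv_metric (h : IsIsometryOn g' U' g U τ) (hu : u ∈ U') (a b c : E) :
    fderiv ℝ g' u a b c =
      fderiv ℝ g (τ u) (fderiv ℝ τ u a) (fderiv ℝ τ u b) (fderiv ℝ τ u c)
        + g (τ u) (fderiv ℝ (fderiv ℝ τ) u a b) (fderiv ℝ τ u c)
        + g (τ u) (fderiv ℝ τ u b) (fderiv ℝ (fderiv ℝ τ) u a c) := by
  have hd := h.target.differentiableAt (h.mapsTo hu)
  have hT := h.differentiableAt_fderiv hu
  have hgτ : DifferentiableAt ℝ (fun y ↦ g (τ y)) u := hd.comp u (h.differentiableAt hu)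
  have hTc : ∀ q, DifferentiableAt ℝ (fun y ↦ fderiv ℝ τ y q) u := fun q ↦
    hT.clm_apply (differentiableAt_const q)
  have := congrArg (fun φ ↦ φ a) (fderiv_congr_of_eqOn h.source.isOpen
    (fun u hu ↦ h.isometry u hu b c) hu)
  rw [fderiv_clm_apply_const₂ (h.source.differentiableAt hu),
    fderiv_clm_apply_apply (hgτ.clm_apply (hTc b)) (hTc c), fderiv_clm_apply_apply hgτ (hTc b),
    fderiv_clm_apply_const hT, fderiv_clm_apply_const hT, h.fderiv_comp_apply hu hd] at this
  rw [this, add_apply]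

/-- The transformation rule of the Christoffel symbols. -/
theorem christoffelL_eq (h : IsIsometryOn g' U' g U τ) (hu : u ∈ U') (a b : E) :
    fderiv ℝ τ u (christoffelL g' u a b) = fderiv ℝ (fderiv ℝ τ) u a b
      + christoffelL g (τ u) (fderiv ℝ τ u a) (fderiv ℝ τ u b) := by
  obtain ⟨f, hf⟩ := h.exists_equiv hu
  refine eq_of_form_eq (h.target.nondegenerate _ (h.mapsTo hu)) fun c ↦ ?_
  obtain ⟨c, rfl⟩ : ∃ c', fderiv ℝ τ u c' = c := ⟨f.symm c, by rw [← hf]; simp⟩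
  have h1 := h.source.two_mul_christoffelL hu a b c
  have h2 := h.target.two_mul_christoffelL (h.mapsTo hu) (fderiv ℝ τ u a) (fderiv ℝ τ u b)
    (fderiv ℝ τ u c)
  rw [h.isometry u hu] at h1
  have hs := fderiv_fderiv_symm h.source.isOpen h.contDiffOn hu
  simp only [koszulL_apply, h.fderiv_metric hu, hs b a, hs c a, hs c b] at h1 h2
  rw [map_add, add_apply]
  have hsy := h.target.symm _ (h.mapsTo hu)
  linarith [hsy (fderiv ℝ τ u a) (fderiv ℝ (fderiv ℝ τ) u b c),
    hsy (fderiv ℝ τ u b) (fderiv ℝ (fderiv ℝ τ) u a c)]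

/-- The curvature tensor is natural. -/
theorem riemannL_eq (h : IsIsometryOn g' U' g U τ) (hu : u ∈ U') (a b c : E) :
    fderiv ℝ τ u (riemannL g' u a b c) =
      riemannL g (τ u) (fderiv ℝ τ u a) (fderiv ℝ τ u b) (fderiv ℝ τ u c) := by
  have hT := h.differentiableAt_fderiv hu
  have hT2 : DifferentiableAt ℝ (fderiv ℝ (fderiv ℝ τ)) u :=
    differentiableAt_of_contDiffOn h.source.isOpen
      (KaluzaKlein.contDiffOn_fderiv h.source.isOpen h.contDiffOn_fderiv) hu
  have hΓ' := h.source.differentiableAt_christoffelL hu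
  have hΓ := h.target.differentiableAt_christoffelL (h.mapsTo hu)
  have hΓτ : DifferentiableAt ℝ (fun y ↦ christoffelL g (τ y)) u :=
    hΓ.comp u (h.differentiableAt hu)
  have hTc : ∀ q, DifferentiableAt ℝ (fun y ↦ fderiv ℝ τ y q) u := fun q ↦
    hT.clm_apply (differentiableAt_const q)
  -- The terms with second and third derivatives of `τ` are symmetric in `a` and `b`.
  have key : ∀ a b, fderiv ℝ τ u (riemannAuxL g' u a b c) =
      riemannAuxL g (τ u) (fderiv ℝ τ u a) (fderiv ℝ τ u b) (fderiv ℝ τ u c)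
        + (fderiv ℝ (fderiv ℝ (fderiv ℝ τ)) u a b c
          + christoffelL g (τ u) (fderiv ℝ (fderiv ℝ τ) u a b) (fderiv ℝ τ u c)
          + christoffelL g (τ u) (fderiv ℝ τ u b) (fderiv ℝ (fderiv ℝ τ) u a c)
          + christoffelL g (τ u) (fderiv ℝ τ u a) (fderiv ℝ (fderiv ℝ τ) u b c)) := by
    intro a b
    have := congrArg (fun φ ↦ φ a) (fderiv_congr_of_eqOn h.source.isOpen
      (fun u hu ↦ h.christoffelL_eq hu b c) hu)
    rw [fderiv_clm_apply_apply hT ((hΓ'.clm_apply (differentiableAt_const b)).clm_apply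
        (differentiableAt_const c)), fderiv_clm_apply_const₂ hΓ',
      fderiv_add_apply ((hT2.clm_apply (differentiableAt_const b)).clm_apply
        (differentiableAt_const c)) ((hΓτ.clm_apply (hTc b)).clm_apply (hTc c)),
      fderiv_clm_apply_const₂ hT2, fderiv_clm_apply_apply (hΓτ.clm_apply (hTc b)) (hTc c),
      fderiv_clm_apply_apply hΓτ (hTc b), fderiv_clm_apply_const hT, fderiv_clm_apply_const hT,
      h.fderiv_comp_apply hu hΓ] at this
    simp only [riemannAuxL_apply, map_add, h.christoffelL_eq hu a]
    rw [eq_sub_of_add_eq' this, h.christoffelL_eq hu b c]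
    simp only [map_add, add_apply]
    abel
  have hs := fderiv_fderiv_symm h.source.isOpen h.contDiffOn hu
  have hs3 := fderiv_fderiv_symm h.source.isOpen h.contDiffOn_fderiv hu
  rw [riemannL_apply, map_sub, key, key, riemannL_apply, hs b a, hs3 b a]
  abel

theorem trace_conj {f : E ≃L[ℝ] E} {A B : E →L[ℝ] E} (h : ∀ v, f (A v) = B (f v)) :
    traceCLM A = traceCLM B := by
  have : A = (f.symm : E →L[ℝ] E) ∘L (B ∘L (f : E →L[ℝ] E)) := by
    ext v
    simp [← h]
  rw [this, trace_comp_comm]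
  congr 1
  ext v
  simp

theorem ricciL_eq (h : IsIsometryOn g' U' g U τ) (hu : u ∈ U') (b c : E) :
    ricciL g' u b c = ricciL g (τ u) (fderiv ℝ τ u b) (fderiv ℝ τ u c) := by
  obtain ⟨f, hf⟩ := h.exists_equiv hu
  have hf' : ∀ v, f v = fderiv ℝ τ u v := fun v ↦ by rw [← hf]; rfl
  simp only [ricciL_eq_ricciTraceL, ricciTraceL_apply]
  refine trace_conj (f := f) fun v ↦ ?_
  simp only [hf', flipCLM_apply, h.riemannL_eq hu]

theorem scalarL_eq (h : IsIsometryOn g' U' g U τ) (hu : u ∈ U') :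
    scalarL g' u = scalarL g (τ u) := by
  obtain ⟨f, hf⟩ := h.exists_equiv hu
  have hf' : ∀ v, f v = fderiv ℝ τ u v := fun v ↦ by rw [← hf]; rfl
  refine trace_conj (f := f) fun v ↦ ?_
  simp only [ContinuousLinearMap.comp_apply]
  symm
  rw [sharpL_eq_iff (h.target.nondegenerate _ (h.mapsTo hu))]
  intro w
  obtain ⟨w, rfl⟩ := f.surjective w
  simp only [hf', ← h.isometry u hu, ← h.ricciL_eq hu]
  exact sharpL_apply_apply (h.source.nondegenerate u hu) _ _

/-- The Einstein curvature is natural. -/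
theorem einsteinL_eq (h : IsIsometryOn g' U' g U τ) (hu : u ∈ U') (b c : E) :
    einsteinL g' u b c = einsteinL g (τ u) (fderiv ℝ τ u b) (fderiv ℝ τ u c) := by
  simp only [einsteinL, sub_apply, smul_apply, h.ricciL_eq hu, h.scalarL_eq hu, h.isometry u hu]

/-- The Levi-Civita connection is natural. -/
theorem covDerivL_eq (h : IsIsometryOn g' U' g U τ) (hu : u ∈ U') {V' V : E → E}
    (hV' : DifferentiableAt ℝ V' u) (hV : DifferentiableAt ℝ V (τ u))
    (hVV : ∀ᶠ y in 𝓝 u, fderiv ℝ τ y (V' y) = V (τ y)) (a : E) :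
    fderiv ℝ τ u (covDerivL g' V' u a) = covDerivL g V (τ u) (fderiv ℝ τ u a) := by
  have := congrArg (fun φ : E →L[ℝ] E ↦ φ a) (Filter.EventuallyEq.fderiv_eq hVV)
  rw [fderiv_clm_apply_apply (h.differentiableAt_fderiv hu) hV', h.fderiv_comp_apply hu hV] at this
  rw [covDerivL_apply, map_add, h.christoffelL_eq hu, covDerivL_apply, ← this,
    ← hVV.self_of_nhds]
  abel

end IsIsometryOn

/-! ### Killing fields -/

/-- `Y` is a smooth Killing field of the metric `g` on `U`. -/
structure IsKillingOn (g : E → E →L[ℝ] E →L[ℝ] ℝ) (U : Set E) (Y : E → E) : Prop where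
  contDiffOn : ContDiffOn ℝ ∞ Y U
  killing : ∀ u ∈ U, ∀ v w, g u (covDerivL g Y u v) w + g u v (covDerivL g Y u w) = 0

namespace IsMetricOn

variable {u : E} {V : E → E}

theorem contDiffOn_covDerivL (hg : IsMetricOn g U) (hV : ContDiffOn ℝ ∞ V U) :
    ContDiffOn ℝ ∞ (covDerivL g V) U :=
  (contDiffOn_fderiv hg.isOpen hV).add
    (((flipCLM E E).contDiff.comp_contDiffOn hg.contDiffOn_christoffelL).clm_apply hV)

theorem fderiv_covDerivL (hg : IsMetricOn g U) (hV : ContDiffOn ℝ ∞ V U) (hu : u ∈ U) (a b : E) :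
    fderiv ℝ (covDerivL g V) u a b = fderiv ℝ (fderiv ℝ V) u a b
      + fderiv ℝ (christoffelL g) u a b (V u) + christoffelL g u b (fderiv ℝ V u a) := by
  have hΓ := hg.differentiableAt_christoffelL hu
  have hd := differentiableAt_of_contDiffOn hg.isOpen hV hu
  have hd' := differentiableAt_of_contDiffOn hg.isOpen (contDiffOn_fderiv hg.isOpen hV) hu
  have hΓb := hΓ.clm_apply (differentiableAt_const b)
  rw [← fderiv_clm_apply_const (differentiableAt_of_contDiffOn hg.isOpen
    (hg.contDiffOn_covDerivL hV) hu)]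
  simp only [covDerivL_apply]
  rw [fderiv_add_apply (hd'.clm_apply (differentiableAt_const b)) (hΓb.clm_apply hd),
    fderiv_clm_apply_const hd', fderiv_clm_apply_apply hΓb hd, fderiv_clm_apply_const hΓ]
  abel

end IsMetricOn

theorem contDiffOn_extDerivOneL {θ : E → E →L[ℝ] ℝ} (hU : IsOpen U) (hθ : ContDiffOn ℝ ∞ θ U) :
    ContDiffOn ℝ ∞ (extDerivOneL θ) U :=
  (contDiffOn_fderiv hU hθ).sub
    ((flipCLM E ℝ).contDiff.comp_contDiffOn (contDiffOn_fderiv hU hθ))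

namespace IsKillingOn

variable {Y : E → E} {u : E}

theorem differentiableAt (hY : IsKillingOn g U Y) (hg : IsMetricOn g U) (hu : u ∈ U) :
    DifferentiableAt ℝ Y u :=
  differentiableAt_of_contDiffOn hg.isOpen hY.contDiffOn hu

theorem differentiableAt_fderiv (hY : IsKillingOn g U Y) (hg : IsMetricOn g U) (hu : u ∈ U) :
    DifferentiableAt ℝ (fderiv ℝ Y) u :=
  differentiableAt_of_contDiffOn hg.isOpen (contDiffOn_fderiv hg.isOpen hY.contDiffOn) hu

/-- The Lie derivative of the metric along a Killing field vanishes. -/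
theorem lie_metric (hY : IsKillingOn g U Y) (hg : IsMetricOn g U) (hu : u ∈ U) (v w : E) :
    fderiv ℝ g u (Y u) v w = -g u (fderiv ℝ Y u v) w - g u v (fderiv ℝ Y u w) := by
  have h := hY.killing u hu v w
  simp only [covDerivL_apply, map_add, add_apply] at h
  rw [hg.fderiv_metric hu, hg.christoffelL_symm hu _ v, hg.christoffelL_symm hu _ w]
  linarith

theorem fderiv_lie_metric (hY : IsKillingOn g U Y) (hg : IsMetricOn g U) (hu : u ∈ U)
    (z v w : E) :
    fderiv ℝ (fderiv ℝ g) u z (Y u) v w + fderiv ℝ g u (fderiv ℝ Y u z) v w =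
      -fderiv ℝ g u z (fderiv ℝ Y u v) w - g u (fderiv ℝ (fderiv ℝ Y) u z v) w
        - fderiv ℝ g u z v (fderiv ℝ Y u w) - g u v (fderiv ℝ (fderiv ℝ Y) u z w) := by
  have hd := hg.differentiableAt hu
  have hd' : DifferentiableAt ℝ (fderiv ℝ g) u :=
    differentiableAt_of_contDiffOn hg.isOpen (contDiffOn_fderiv hg.isOpen hg.contDiffOn) hu
  have hYd := hY.differentiableAt hg hu
  have hA := hY.differentiableAt_fderiv hg hu
  have hAc : ∀ q, DifferentiableAt ℝ (fun y ↦ fderiv ℝ Y y q) u := fun q ↦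
    hA.clm_apply (differentiableAt_const q)
  have := congrArg (fun φ ↦ φ z) (fderiv_congr_of_eqOn hg.isOpen
    (fun u hu ↦ hY.lie_metric hg hu v w) hu)
  rw [fderiv_clm_apply_const ((hd'.clm_apply hYd).clm_apply (differentiableAt_const v)),
    fderiv_clm_apply_const (hd'.clm_apply hYd), fderiv_clm_apply_apply hd' hYd,
    fderiv_sub_apply (((hd.clm_apply (hAc v)).clm_apply (differentiableAt_const w)).fun_neg)
      ((hd.clm_apply (differentiableAt_const v)).clm_apply (hAc w)),
    fderiv_fun_neg, neg_apply, fderiv_clm_apply_const (hd.clm_apply (hAc v)),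
    fderiv_clm_apply_apply hd (hAc v),
    fderiv_clm_apply_apply (hd.clm_apply (differentiableAt_const v)) (hAc w),
    fderiv_clm_apply_const hd, fderiv_clm_apply_const hA, fderiv_clm_apply_const hA] at this
  simp only [add_apply] at this
  linarith

/-- The Lie derivative of the Levi-Civita connection along a Killing field vanishes. -/
theorem lie_christoffelL (hY : IsKillingOn g U Y) (hg : IsMetricOn g U) (hu : u ∈ U) (v w : E) :
    fderiv ℝ (christoffelL g) u (Y u) v w = fderiv ℝ Y u (christoffelL g u v w)
      - christoffelL g u (fderiv ℝ Y u v) w - christoffelL g u v (fderiv ℝ Y u w)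
      - fderiv ℝ (fderiv ℝ Y) u v w := by
  refine eq_of_form_eq (hg.nondegenerate u hu) fun z ↦ ?_
  have hd := hg.differentiableAt hu
  have hΓ := hg.differentiableAt_christoffelL hu
  have hd' : DifferentiableAt ℝ (fderiv ℝ g) u :=
    differentiableAt_of_contDiffOn hg.isOpen (contDiffOn_fderiv hg.isOpen hg.contDiffOn) hu
  have hd'c : ∀ a b c, DifferentiableAt ℝ (fun y ↦ fderiv ℝ g y a b c) u := fun a b c ↦
    ((hd'.clm_apply (differentiableAt_const a)).clm_apply (differentiableAt_const b)).clm_apply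
      (differentiableAt_const c)
  have hΓc := (hΓ.clm_apply (differentiableAt_const v)).clm_apply (differentiableAt_const w)
  -- Differentiate the Koszul formula along `Y` and substitute `L_Y g = 0` and its derivatives.
  have hK := congrArg (fun φ ↦ φ (Y u)) (fderiv_congr_of_eqOn hg.isOpen
    (fun u hu ↦ (hg.two_mul_christoffelL hu v w z).trans (koszulL_apply g u v w z)) hu)
  rw [fderiv_const_mul ((hd.clm_apply hΓc).clm_apply (differentiableAt_const z)), smul_apply,
    fderiv_clm_apply_const (hd.clm_apply hΓc), fderiv_clm_apply_apply hd hΓc,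
    fderiv_clm_apply_const₂ hΓ, fderiv_sub_apply ((hd'c _ _ _).fun_add (hd'c _ _ _)) (hd'c _ _ _),
    fderiv_add_apply (hd'c _ _ _) (hd'c _ _ _), fderiv_clm_apply_const₃ hd',
    fderiv_clm_apply_const₃ hd', fderiv_clm_apply_const₃ hd'] at hK
  simp only [add_apply, smul_eq_mul, hY.lie_metric hg hu] at hK
  have hs := fderiv_fderiv_symm hg.isOpen hg.contDiffOn hu
  have hs' := fderiv_fderiv_symm hg.isOpen hY.contDiffOn hu
  rw [hs (Y u) v, hs (Y u) w, hs (Y u) z] at hK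
  have h1 := hY.fderiv_lie_metric hg hu v w z
  have h2 := hY.fderiv_lie_metric hg hu w v z
  have h3 := hY.fderiv_lie_metric hg hu z v w
  have k1 := hg.two_mul_christoffelL hu (fderiv ℝ Y u v) w z
  have k2 := hg.two_mul_christoffelL hu v (fderiv ℝ Y u w) z
  have k3 := hg.two_mul_christoffelL hu v w (fderiv ℝ Y u z)
  simp only [koszulL_apply] at k1 k2 k3
  rw [hs' w v] at h2
  rw [hs' z v, hs' z w] at h3
  simp only [map_sub, sub_apply]
  linarith [hg.symm u hu w (fderiv ℝ (fderiv ℝ Y) u v z)]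

/-- The Lie derivative of the curvature tensor along a Killing field vanishes. -/
theorem lie_riemannL (hY : IsKillingOn g U Y) (hg : IsMetricOn g U) (hu : u ∈ U) (a b c : E) :
    fderiv ℝ (riemannL g) u (Y u) a b c = fderiv ℝ Y u (riemannL g u a b c)
      - riemannL g u (fderiv ℝ Y u a) b c - riemannL g u a (fderiv ℝ Y u b) c
      - riemannL g u a b (fderiv ℝ Y u c) := by
  have hΓ := hg.differentiableAt_christoffelL hu
  have hΓ' := hg.differentiableAt_fderiv_christoffelL hu
  have hYd := hY.differentiableAt hg hu
  have hA := hY.differentiableAt_fderiv hg hu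
  have hB : DifferentiableAt ℝ (fderiv ℝ (fderiv ℝ Y)) u := differentiableAt_of_contDiffOn
    hg.isOpen (contDiffOn_fderiv hg.isOpen (contDiffOn_fderiv hg.isOpen hY.contDiffOn)) hu
  have hAc : ∀ q, DifferentiableAt ℝ (fun y ↦ fderiv ℝ Y y q) u := fun q ↦
    hA.clm_apply (differentiableAt_const q)
  have hΓc : ∀ p, DifferentiableAt ℝ (fun y ↦ christoffelL g y p) u := fun p ↦
    hΓ.clm_apply (differentiableAt_const p)
  -- The right-hand side is symmetric in `a` and `b`, so it disappears from `R`.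
  have key : ∀ a b, fderiv ℝ (riemannAuxL g) u (Y u) a b c - fderiv ℝ Y u (riemannAuxL g u a b c)
      + riemannAuxL g u (fderiv ℝ Y u a) b c + riemannAuxL g u a (fderiv ℝ Y u b) c
      + riemannAuxL g u a b (fderiv ℝ Y u c) =
      -fderiv ℝ (fderiv ℝ (fderiv ℝ Y)) u a b c
        - christoffelL g u (fderiv ℝ (fderiv ℝ Y) u a b) c
        - christoffelL g u b (fderiv ℝ (fderiv ℝ Y) u a c)
        - christoffelL g u a (fderiv ℝ (fderiv ℝ Y) u b c) := by
    intro a b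
    have h := congrArg (fun φ ↦ φ a) (fderiv_congr_of_eqOn hg.isOpen
      (fun u hu ↦ hY.lie_christoffelL hg hu b c) hu)
    have d1 := hA.clm_apply ((hΓc b).clm_apply (differentiableAt_const c))
    have d2 := (hΓ.clm_apply (hAc b)).clm_apply (differentiableAt_const c)
    have d3 := (hΓc b).clm_apply (hAc c)
    have d4 := (hB.clm_apply (differentiableAt_const b)).clm_apply (differentiableAt_const c)
    rw [fderiv_clm_apply_const ((hΓ'.clm_apply hYd).clm_apply (differentiableAt_const b)),
      fderiv_clm_apply_const (hΓ'.clm_apply hYd), fderiv_clm_apply_apply hΓ' hYd,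
      fderiv_sub_apply ((d1.fun_sub d2).fun_sub d3) d4, fderiv_sub_apply (d1.fun_sub d2) d3,
      fderiv_sub_apply d1 d2,
      fderiv_clm_apply_apply hA ((hΓc b).clm_apply (differentiableAt_const c)),
      fderiv_clm_apply_const₂ hΓ, fderiv_clm_apply_const (hΓ.clm_apply (hAc b)),
      fderiv_clm_apply_apply hΓ (hAc b), fderiv_clm_apply_apply (hΓc b) (hAc c),
      fderiv_clm_apply_const hΓ, fderiv_clm_apply_const hA, fderiv_clm_apply_const hA,
      fderiv_clm_apply_const₂ hB] at h
    rw [hg.fderiv_riemannAuxL hu,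
      fderiv_fderiv_symm hg.isOpen hg.contDiffOn_christoffelL hu (Y u) a]
    simp only [add_apply] at h
    rw [eq_sub_of_add_eq h]
    simp only [hY.lie_christoffelL hg hu, riemannAuxL_apply, map_add, map_sub]
    abel
  have h1 := key a b
  have h2 := key b a
  rw [fderiv_fderiv_symm hg.isOpen hY.contDiffOn hu b a,
    fderiv_fderiv_symm hg.isOpen (contDiffOn_fderiv hg.isOpen hY.contDiffOn) hu b a] at h2
  rw [hg.fderiv_riemannL hu, ← sub_eq_zero]
  simp only [riemannL_apply, map_sub]
  have h4 : _ - _ = _ - _ := congrArg₂ HSub.hSub h1 h2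
  rw [← sub_eq_zero] at h4
  rw [← h4]
  abel

theorem lie_ricciL (hY : IsKillingOn g U Y) (hg : IsMetricOn g U) (hu : u ∈ U) (b c : E) :
    fderiv ℝ (ricciL g) u (Y u) b c =
      -ricciL g u (fderiv ℝ Y u b) c - ricciL g u b (fderiv ℝ Y u c) := by
  obtain ⟨e, e', h⟩ := exists_isDualPair (hg.nondegenerate u hu) (hg.symm u hu)
  have ht := trace_comp_comm (fderiv ℝ Y u)
    (flipCLM E E (flipCLM E (E →L[ℝ] E) (riemannL g u) b) c)
  rw [h.trace, h.trace] at ht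
  simp only [ContinuousLinearMap.comp_apply, flipCLM_apply] at ht
  rw [hg.fderiv_ricciL hu]
  simp only [ricciL_eq_ricciTraceL, h.ricciTraceL_apply, hY.lie_riemannL hg hu, map_sub,
    sub_apply, Finset.sum_sub_distrib]
  linarith

theorem lie_scalarL (hY : IsKillingOn g U Y) (hg : IsMetricOn g U) (hu : u ∈ U) :
    fderiv ℝ (scalarL g) u (Y u) = 0 := by
  have h : fderiv ℝ (ricciEndL g) u (Y u) =
      fderiv ℝ Y u ∘L ricciEndL g u - ricciEndL g u ∘L fderiv ℝ Y u := by
    ext v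
    refine eq_of_form_eq (hg.nondegenerate u hu) fun w ↦ ?_
    have h1 := hg.fderiv_ricciL_eq_ricciEndL hu (Y u) v w
    rw [hY.lie_ricciL hg hu, hY.lie_metric hg hu, hg.inner_ricciEndL hu] at h1
    simp only [sub_apply, map_sub, ContinuousLinearMap.comp_apply, hg.inner_ricciEndL hu]
    linarith
  rw [hg.fderiv_scalarL_eq_trace hu, h, map_sub, trace_comp_comm, sub_self]

/-- The Lie derivative of the Einstein curvature along a Killing field vanishes. -/
theorem lie_einsteinL (hY : IsKillingOn g U Y) (hg : IsMetricOn g U) (hu : u ∈ U) (b c : E) :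
    fderiv ℝ (einsteinL g) u (Y u) b c =
      -einsteinL g u (fderiv ℝ Y u b) c - einsteinL g u b (fderiv ℝ Y u c) := by
  rw [hg.fderiv_einsteinL hu, hY.lie_ricciL hg hu, hY.lie_scalarL hg hu, hY.lie_metric hg hu]
  simp only [einsteinL, sub_apply, smul_apply, smul_eq_mul]
  ring

theorem inner_covDerivL_self (hY : IsKillingOn g U Y) (hg : IsMetricOn g U) (hu : u ∈ U) (v : E) :
    g u (covDerivL g Y u v) v = 0 := by
  linarith [hY.killing u hu v v, hg.symm u hu v (covDerivL g Y u v)]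

theorem inner_covDerivL_swap (hY : IsKillingOn g U Y) (hg : IsMetricOn g U) (hu : u ∈ U)
    (v w : E) : g u (covDerivL g Y u v) w = -g u (covDerivL g Y u w) v := by
  linarith [hY.killing u hu v w, hg.symm u hu v (covDerivL g Y u w)]

theorem trace_covDerivL (hY : IsKillingOn g U Y) (hg : IsMetricOn g U) (hu : u ∈ U) :
    traceCLM (covDerivL g Y u) = 0 := by
  obtain ⟨e, e', h⟩ := exists_isDualPair (hg.nondegenerate u hu) (hg.symm u hu)
  have h1 := h.swap (g u ∘L covDerivL g Y u)
  simp only [ContinuousLinearMap.comp_apply] at h1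
  have h2 : ∑ i, g u (covDerivL g Y u (e' i)) (e i) =
      -∑ i, g u (covDerivL g Y u (e i)) (e' i) := by
    rw [← Finset.sum_neg_distrib]
    exact Finset.sum_congr rfl fun i _ ↦ hY.inner_covDerivL_swap hg hu _ _
  rw [h.trace]
  linarith

/-- The differential of the `1`-form dual to a Killing field is twice its covariant derivative. -/
theorem extDerivOneL_eq (hY : IsKillingOn g U Y) (hg : IsMetricOn g U) (hu : u ∈ U) (a b : E) :
    extDerivOneL (fun y ↦ g y (Y y)) u a b = 2 * g u (covDerivL g Y u a) b := by
  have h : ∀ p q, fderiv ℝ (fun y ↦ g y (Y y)) u p q =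
      g u (covDerivL g Y u p) q + g u (Y u) (christoffelL g u p q) := fun p q ↦ by
    rw [fderiv_clm_apply_apply (hg.differentiableAt hu) (hY.differentiableAt hg hu)]
    simp only [add_apply, covDerivL_apply, map_add, hg.fderiv_metric hu]
    ring
  have : extDerivOneL (fun y ↦ g y (Y y)) u a b =
    fderiv ℝ (fun y ↦ g y (Y y)) u a b - fderiv ℝ (fun y ↦ g y (Y y)) u b a := rfl
  rw [this, h, h, hg.christoffelL_symm hu b a, hY.inner_covDerivL_swap hg hu b a]
  ring

/-- Kostant's formula `∇²_{a, b} Y = -R(Y, a) b`, written in terms of the derivatives of the field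
of endomorphisms `∇Y`. -/
theorem fderiv_covDerivL (hY : IsKillingOn g U Y) (hg : IsMetricOn g U) (hu : u ∈ U) (a b : E) :
    fderiv ℝ (covDerivL g Y) u a b = covDerivL g Y u (christoffelL g u a b)
      - christoffelL g u a (covDerivL g Y u b) - riemannL g u (Y u) a b := by
  rw [hg.fderiv_covDerivL hY.contDiffOn hu, riemannL_apply, riemannAuxL_apply, riemannAuxL_apply,
    hY.lie_christoffelL hg hu, hg.fderiv_christoffelL_symm hu a (Y u), covDerivL_apply,
    covDerivL_apply, map_add, hg.christoffelL_symm hu _ (Y u), hg.christoffelL_symm hu b (Y u),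
    hg.christoffelL_symm hu b]
  abel

/-- The divergence of the differential of a Killing field is `-2 Ric(Y)`. -/
theorem divTensorCovectorL_extDerivOneL (hY : IsKillingOn g U Y) (hg : IsMetricOn g U)
    (hu : u ∈ U) (c : E) :
    divTensorCovectorL g (extDerivOneL (fun y ↦ g y (Y y))) u c = -2 * ricciL g u (Y u) c := by
  obtain ⟨e, e', h⟩ := exists_isDualPair (hg.nondegenerate u hu) (hg.symm u hu)
  have hd := hg.differentiableAt hu
  have hN := differentiableAt_of_contDiffOn hg.isOpen (hg.contDiffOn_covDerivL hY.contDiffOn) hu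
  have hF := differentiableAt_of_contDiffOn hg.isOpen
    (contDiffOn_extDerivOneL hg.isOpen (hg.contDiffOn.clm_apply hY.contDiffOn)) hu
  have key : ∀ a b, covDerivTensorL g (extDerivOneL (fun y ↦ g y (Y y))) u a b c =
      2 * g u (riemannL g u (Y u) a c) b := by
    intro a b
    have hNb := hN.clm_apply (differentiableAt_const b)
    have := congrArg (fun φ ↦ φ a) (fderiv_congr_of_eqOn hg.isOpen
      (fun u hu ↦ hY.extDerivOneL_eq hg hu b c) hu)
    rw [fderiv_clm_apply_const₂ hF, fderiv_const_mul ((hd.clm_apply hNb).clm_apply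
        (differentiableAt_const c)), smul_apply, fderiv_clm_apply_const (hd.clm_apply hNb),
      fderiv_clm_apply_apply hd hNb, fderiv_clm_apply_const hN] at this
    rw [covDerivTensorL_apply, this]
    simp only [smul_eq_mul, add_apply, hg.fderiv_metric hu, hY.extDerivOneL_eq hg hu,
      hY.fderiv_covDerivL hg hu, map_sub, sub_apply]
    linarith [hg.riemannL_skew hu (Y u) a b c]
  rw [h.divTensorCovectorL_apply (hg.nondegenerate u hu)]
  simp only [key, ricciL_eq_ricciTraceL, h.ricciTraceL_apply, Finset.mul_sum]
  refine Finset.sum_congr rfl fun i _ ↦ ?_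
  rw [riemannL_swap g u (Y u), map_neg, neg_apply]
  ring

/-- For a Killing field of constant length, `Ric(Y, Y) = |∇Y|²`. -/
theorem ricciL_self (hY : IsKillingOn g U Y) (hg : IsMetricOn g U) {l : ℝ}
    (hl : ∀ u ∈ U, g u (Y u) (Y u) = l) (hu : u ∈ U) {ι : Type*} [Fintype ι] {e e' : ι → E}
    (h : IsDualPair (g u) e e') :
    ricciL g u (Y u) (Y u) = ∑ i, g u (covDerivL g Y u (e i)) (covDerivL g Y u (e' i)) := by
  have hd := hg.differentiableAt hu
  have hYd := hY.differentiableAt hg hu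
  have hN := differentiableAt_of_contDiffOn hg.isOpen (hg.contDiffOn_covDerivL hY.contDiffOn) hu
  have h0 : ∀ u ∈ U, ∀ a, g u (covDerivL g Y u a) (Y u) = 0 := fun u hu a ↦ by
    have hYd := hY.differentiableAt hg hu
    have := congrArg (fun φ ↦ φ a) (fderiv_congr_of_eqOn hg.isOpen hl hu)
    rw [hg.fderiv_inner hu hYd hYd, hg.symm u hu (Y u), fderiv_fun_const] at this
    simp only [Pi.zero_apply, zero_apply] at this
    linarith
  have key : ∀ a b, g u (riemannL g u (Y u) a b) (Y u) =
      g u (covDerivL g Y u b) (covDerivL g Y u a) := by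
    intro a b
    have hNb := hN.clm_apply (differentiableAt_const b)
    have := congrArg (fun φ ↦ φ a) (fderiv_congr_of_eqOn hg.isOpen
      (fun u hu ↦ h0 u hu b) hu)
    rw [hg.fderiv_inner hu hNb hYd, covDerivL_apply, fderiv_clm_apply_const hN,
      hY.fderiv_covDerivL hg hu, fderiv_fun_const] at this
    simp only [Pi.zero_apply, zero_apply, map_add, map_sub, add_apply, sub_apply, h0 u hu] at this
    linarith
  simp only [ricciL_eq_ricciTraceL, h.ricciTraceL_apply]
  refine Finset.sum_congr rfl fun i _ ↦ ?_
  rw [riemannL_swap g u _ (Y u), map_neg, neg_apply, ← hg.riemannL_skew hu, key,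
    hg.symm u hu]

end IsKillingOn

/-! ### The local form of a fluid domain and its invariance under the potential -/

variable {EB : Type*} [NormedAddCommGroup EB] [NormedSpace ℝ EB] [FiniteDimensional ℝ EB]

/-- A vector `h` is horizontal at `u` if it is orthogonal to the kernel of the differential of the
submersion `p`. -/
def IsHorizontalAt (g : E → E →L[ℝ] E →L[ℝ] ℝ) (p : E → EB) (u h : E) : Prop :=
  ∀ v, fderiv ℝ p u v = 0 → g u h v = 0

/-- A covector which vanishes on the horizontal vectors is dual to a vertical vector. -/
theorem fderiv_sharpL_eq_zero {p : E → EB} {u : E} (hb : ∀ v, (∀ w, g u v w = 0) → v = 0)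
    (hs : ∀ v w, g u v w = g u w v) {η : E →L[ℝ] ℝ} (hη : ∀ h, IsHorizontalAt g p u h → η h = 0) :
    fderiv ℝ p u (sharpL (g u) η) = 0 := by
  by_contra hne
  obtain ⟨l, hl⟩ := SeparatingDual.exists_ne_zero (R := ℝ) hne
  refine hl ?_
  -- The vectors dual to the covectors `l ∘ dp` are horizontal, so `η` kills them.
  have h1 : IsHorizontalAt g p u (sharpL (g u) (l ∘L fderiv ℝ p u)) := fun v hv ↦ by
    rw [sharpL_apply_apply hb]
    simp [hv]
  have h2 := hη _ h1
  rw [← sharpL_apply_apply hb η, hs, sharpL_apply_apply hb] at h2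
  exact h2

/-- Every vertical vector of a submersion extends to a vertical vector field. -/
theorem exists_vertical_extension {p : E → EB} {u w : E} (hU : IsOpen U)
    (hp : ContDiffOn ℝ ∞ p U) (hu : u ∈ U) (hsurj : Function.Surjective (fderiv ℝ p u))
    (hw : fderiv ℝ p u w = 0) :
    ∃ V : E → E, DifferentiableAt ℝ V u ∧ V u = w ∧ ∀ᶠ y in 𝓝 u, fderiv ℝ p y (V y) = 0 := by
  have : CompleteSpace EB := FiniteDimensional.complete ℝ EB
  obtain ⟨b, hb⟩ := (fderiv ℝ p u).toLinearMap.exists_rightInverse_of_surjective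
    (LinearMap.range_eq_top.2 hsurj)
  let B : EB →L[ℝ] E := LinearMap.toContinuousLinearMap b
  have hB : fderiv ℝ p u ∘L B =
      ((ContinuousLinearEquiv.refl ℝ EB : EB ≃L[ℝ] EB) : EB →L[ℝ] EB) := by
    ext v
    exact LinearMap.congr_fun hb v
  have hp' : DifferentiableAt ℝ (fderiv ℝ p) u :=
    differentiableAt_of_contDiffOn hU (contDiffOn_fderiv hU hp) hu
  let C : E → EB →L[ℝ] EB := fun y ↦ fderiv ℝ p y ∘L B
  have hC : DifferentiableAt ℝ C u := hp'.clm_comp (differentiableAt_const B)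
  have hinv : DifferentiableAt ℝ (fun y ↦ ContinuousLinearMap.inverse (C y)) u := by
    refine DifferentiableAt.comp (g := ContinuousLinearMap.inverse) u ?_ hC
    rw [show C u = _ from hB]
    exact (contDiffAt_map_inverse (n := 1) _).differentiableAt one_ne_zero
  -- Subtract from the constant field `w` its component along the range of a right inverse of `dp`.
  refine ⟨fun y ↦ w - B (ContinuousLinearMap.inverse (C y) (fderiv ℝ p y w)), ?_, ?_, ?_⟩
  · exact (differentiableAt_const w).sub ((differentiableAt_const B).clm_apply
      (hinv.clm_apply (hp'.clm_apply (differentiableAt_const w))))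
  · simp [hw]
  · have hnhds := hC.continuousAt.preimage_mem_nhds
      (show _ ∈ 𝓝 (C u) from by
        rw [show C u = _ from hB]
        exact ContinuousLinearEquiv.nhds (ContinuousLinearEquiv.refl ℝ EB))
    filter_upwards [hnhds] with y hy
    obtain ⟨f, hf⟩ := hy
    have h1 : ∀ x, fderiv ℝ p y (B x) = f x := fun x ↦ by
      rw [show f x = (f : EB →L[ℝ] EB) x from rfl, hf]
      rfl
    rw [map_sub, h1, ← hf]
    simp

/-- The Lie bracket of two vertical vector fields is vertical. -/
theorem fderiv_bracket_eq_zero {p : E → EB} {u : E} {Y V : E → E} (hU : IsOpen U)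
    (hp : ContDiffOn ℝ ∞ p U) (hu : u ∈ U) (hY : DifferentiableAt ℝ Y u)
    (hV : DifferentiableAt ℝ V u) (hpY : ∀ᶠ y in 𝓝 u, fderiv ℝ p y (Y y) = 0)
    (hpV : ∀ᶠ y in 𝓝 u, fderiv ℝ p y (V y) = 0) :
    fderiv ℝ p u (fderiv ℝ V u (Y u) - fderiv ℝ Y u (V u)) = 0 := by
  have hp' : DifferentiableAt ℝ (fderiv ℝ p) u :=
    differentiableAt_of_contDiffOn hU (contDiffOn_fderiv hU hp) hu
  have key : ∀ {A B : E → E}, DifferentiableAt ℝ A u → (∀ᶠ y in 𝓝 u, fderiv ℝ p y (A y) = 0) →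
      fderiv ℝ (fderiv ℝ p) u (B u) (A u) + fderiv ℝ p u (fderiv ℝ A u (B u)) = 0 := by
    intro A B hA hpA
    rw [← fderiv_clm_apply_apply hp' hA]
    have : fderiv ℝ (fun y ↦ fderiv ℝ p y (A y)) u = 0 := by
      rw [Filter.EventuallyEq.fderiv_eq (f := fun _ ↦ (0 : EB)) hpA, fderiv_fun_const]
      rfl
    rw [this, zero_apply]
  have h1 := key (B := Y) hV hpV
  have h2 := key (B := V) hY hpY
  rw [fderiv_fderiv_symm hU hp hu (V u)] at h2
  rw [map_sub, eq_neg_of_add_eq_zero_right h1, eq_neg_of_add_eq_zero_right h2]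
  simp

/-- A tensor field which is invariant under `Y` satisfies the Leibniz rule for Lie brackets. -/
theorem fderiv_invariant_apply {T : E → E →L[ℝ] E →L[ℝ] ℝ} {Y V V' : E → E} {u : E}
    (hT : DifferentiableAt ℝ T u) (hV : DifferentiableAt ℝ V u) (hV' : DifferentiableAt ℝ V' u)
    (hinv : ∀ b c, fderiv ℝ T u (Y u) b c = -T u (fderiv ℝ Y u b) c - T u b (fderiv ℝ Y u c)) :
    fderiv ℝ (fun y ↦ T y (V y) (V' y)) u (Y u) =
      T u (fderiv ℝ V u (Y u) - fderiv ℝ Y u (V u)) (V' u)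
        + T u (V u) (fderiv ℝ V' u (Y u) - fderiv ℝ Y u (V' u)) := by
  rw [fderiv_clm_apply_apply (hT.clm_apply hV) hV', fderiv_clm_apply_apply hT hV]
  simp only [add_apply, hinv, map_sub, sub_apply]
  ring

/-- A fluid domain read in a chart: `p` is the projection to the base of the spacetime, `Y` the
potential, `X₀` the apparent field of the fluid, and
`G = μ X ⊗ X + α Y ⊗ Y + P` with `X = X₀ + (e / μ) Y`. The eigenspace of `pr_H ∘ ᵉG|_H` is described
without the projection, by testing `G(v, ·) = -μ g(v, ·)` on horizontal vectors, and the vanishing of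
`P` is only required where it matters, on `(Y, Y)` and `(X₀, Y)`. -/
structure IsFluidOn (g : E → E →L[ℝ] E →L[ℝ] ℝ) (U : Set E) (p : E → EB) (Y X₀ : E → E)
    (μ e α : E → ℝ) (P : E → E →L[ℝ] E →L[ℝ] ℝ) : Prop where
  metric : IsMetricOn g U
  killing : IsKillingOn g U Y
  unit : ∀ u ∈ U, g u (Y u) (Y u) = -1
  smooth_proj : ContDiffOn ℝ ∞ p U
  surjective : ∀ u ∈ U, Function.Surjective (fderiv ℝ p u)
  vertical : ∀ u ∈ U, fderiv ℝ p u (Y u) = 0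
  smooth_field : ContDiffOn ℝ ∞ X₀ U
  smooth_mass : ContDiffOn ℝ ∞ μ U
  smooth_charge : ContDiffOn ℝ ∞ e U
  smooth_coeff : ContDiffOn ℝ ∞ α U
  smooth_pressure : ContDiffOn ℝ ∞ P U
  mass_pos : ∀ u ∈ U, 0 < μ u
  field_horizontal : ∀ u ∈ U, IsHorizontalAt g p u (X₀ u)
  field_unit : ∀ u ∈ U, g u (X₀ u) (X₀ u) = -1
  eigenspace : ∀ u ∈ U, ∀ v, IsHorizontalAt g p u v →
    ((∀ h, IsHorizontalAt g p u h → einsteinL g u v h = -μ u * g u v h) ↔ ∃ c : ℝ, v = c • X₀ u)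
  einstein_eq : ∀ u ∈ U, ∀ v w, einsteinL g u v w =
    μ u * (g u (X₀ u + (e u / μ u) • Y u) v * g u (X₀ u + (e u / μ u) • Y u) w)
      + α u * (g u (Y u) v * g u (Y u) w) + P u v w
  pressure_potential : ∀ u ∈ U, P u (Y u) (Y u) = 0
  pressure_mixed : ∀ u ∈ U, P u (X₀ u) (Y u) = 0

namespace IsFluidOn

variable {p : E → EB} {Y X₀ : E → E} {μ e α : E → ℝ} {P : E → E →L[ℝ] E →L[ℝ] ℝ} {u : E}

theorem differentiableAt_potential (h : IsFluidOn g U p Y X₀ μ e α P) (hu : u ∈ U) :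
    DifferentiableAt ℝ Y u :=
  h.killing.differentiableAt h.metric hu

theorem differentiableAt_field (h : IsFluidOn g U p Y X₀ μ e α P) (hu : u ∈ U) :
    DifferentiableAt ℝ X₀ u :=
  differentiableAt_of_contDiffOn h.metric.isOpen h.smooth_field hu

theorem differentiableAt_mass (h : IsFluidOn g U p Y X₀ μ e α P) (hu : u ∈ U) :
    DifferentiableAt ℝ μ u :=
  differentiableAt_of_contDiffOn h.metric.isOpen h.smooth_mass hu

theorem differentiableAt_charge (h : IsFluidOn g U p Y X₀ μ e α P) (hu : u ∈ U) :
    DifferentiableAt ℝ e u :=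
  differentiableAt_of_contDiffOn h.metric.isOpen h.smooth_charge hu

theorem differentiableAt_coeff (h : IsFluidOn g U p Y X₀ μ e α P) (hu : u ∈ U) :
    DifferentiableAt ℝ α u :=
  differentiableAt_of_contDiffOn h.metric.isOpen h.smooth_coeff hu

theorem differentiableAt_pressure (h : IsFluidOn g U p Y X₀ μ e α P) (hu : u ∈ U) :
    DifferentiableAt ℝ P u :=
  differentiableAt_of_contDiffOn h.metric.isOpen h.smooth_pressure hu

theorem differentiableAt_einsteinL (h : IsFluidOn g U p Y X₀ μ e α P) (hu : u ∈ U) :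
    DifferentiableAt ℝ (einsteinL g) u :=
  differentiableAt_of_contDiffOn h.metric.isOpen h.metric.contDiffOn_einsteinL hu

theorem inner_field_potential (h : IsFluidOn g U p Y X₀ μ e α P) (hu : u ∈ U) :
    g u (X₀ u) (Y u) = 0 :=
  h.field_horizontal u hu _ (h.vertical u hu)

theorem inner_potential_field (h : IsFluidOn g U p Y X₀ μ e α P) (hu : u ∈ U) :
    g u (Y u) (X₀ u) = 0 := by
  rw [h.metric.symm u hu, h.inner_field_potential hu]

/-- The bracket `[Y, X₀]` is horizontal, because `Y` preserves the metric and the vertical vector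
fields. -/
theorem isHorizontalAt_bracket (h : IsFluidOn g U p Y X₀ μ e α P) (hu : u ∈ U) :
    IsHorizontalAt g p u (fderiv ℝ X₀ u (Y u) - fderiv ℝ Y u (X₀ u)) := by
  intro w hw
  have hUu := h.metric.isOpen.mem_nhds hu
  have hYd := h.differentiableAt_potential hu
  obtain ⟨V, hV, rfl, hpV⟩ := exists_vertical_extension h.metric.isOpen h.smooth_proj hu
    (h.surjective u hu) hw
  have h1 := fderiv_invariant_apply (h.metric.differentiableAt hu) (h.differentiableAt_field hu) hV
    (fun b c ↦ h.killing.lie_metric h.metric hu b c)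
  have h2 : fderiv ℝ (fun y ↦ g y (X₀ y) (V y)) u = 0 := by
    rw [Filter.EventuallyEq.fderiv_eq (f := fun _ ↦ (0 : ℝ)), fderiv_fun_const]
    · rfl
    · filter_upwards [hUu, hpV] with y hy hy' using h.field_horizontal y hy _ hy'
  rw [h2, zero_apply, h.field_horizontal u hu _ (fderiv_bracket_eq_zero h.metric.isOpen
    h.smooth_proj hu hYd hV (Filter.eventually_of_mem hUu h.vertical) hpV), add_zero] at h1
  exact h1.symm

/-- The eigenvector equation for `X₀`, differentiated along `Y`: the vector dual to
`G(X₀, ·) + μ g(X₀, ·)` is vertical, hence so is its Lie derivative along `Y`. -/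
theorem einsteinL_bracket (h : IsFluidOn g U p Y X₀ μ e α P) (hu : u ∈ U) {w : E}
    (hw : IsHorizontalAt g p u w) :
    einsteinL g u (fderiv ℝ X₀ u (Y u) - fderiv ℝ Y u (X₀ u)) w
      + fderiv ℝ μ u (Y u) * g u (X₀ u) w
      + μ u * g u (fderiv ℝ X₀ u (Y u) - fderiv ℝ Y u (X₀ u)) w = 0 := by
  have hg := h.metric
  have hUu := hg.isOpen.mem_nhds hu
  have hYd := h.differentiableAt_potential hu
  have hX := h.differentiableAt_field hu
  have hG := h.differentiableAt_einsteinL hu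
  have hgd := hg.differentiableAt hu
  let η : E → E →L[ℝ] ℝ := fun y ↦ einsteinL g y (X₀ y) + μ y • g y (X₀ y)
  let W : E → E := fun y ↦ sharpL (g y) (η y)
  have hη : ContDiffOn ℝ ∞ η U := (hg.contDiffOn_einsteinL.clm_apply h.smooth_field).add
    (h.smooth_mass.smul (hg.contDiffOn.clm_apply h.smooth_field))
  have hW : DifferentiableAt ℝ W u :=
    differentiableAt_of_contDiffOn hg.isOpen (hg.contDiffOn_sharpL.clm_apply hη) hu
  have hpW : ∀ y ∈ U, fderiv ℝ p y (W y) = 0 := by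
    intro y hy
    refine fderiv_sharpL_eq_zero (hg.nondegenerate y hy) (hg.symm y hy) fun v hv ↦ ?_
    have := (h.eigenspace y hy (X₀ y) (h.field_horizontal y hy)).2 ⟨1, by simp⟩ v hv
    simp only [η, add_apply, smul_apply, smul_eq_mul, this]
    ring
  have hgW : ∀ y ∈ U, g y (W y) w = einsteinL g y (X₀ y) w + μ y * g y (X₀ y) w := fun y hy ↦ by
    simp only [W]
    rw [sharpL_apply_apply (hg.nondegenerate y hy)]
    simp [η]
  have hd1 := (hG.clm_apply hX).clm_apply (differentiableAt_const w)
  have hd2 := (hgd.clm_apply hX).clm_apply (differentiableAt_const w)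
  have hμ := h.differentiableAt_mass hu
  have hinv := fun b c ↦ h.killing.lie_metric hg hu b c
  have key := congrArg (fun φ ↦ φ (Y u)) (fderiv_congr_of_eqOn hg.isOpen hgW hu)
  rw [fderiv_add_apply hd1 (hμ.fun_mul hd2), fderiv_fun_mul hμ hd2, add_apply, smul_apply,
    smul_apply, fderiv_invariant_apply hgd hW (differentiableAt_const w) hinv,
    fderiv_invariant_apply hgd hX (differentiableAt_const w) hinv,
    fderiv_invariant_apply hG hX (differentiableAt_const w)
      (fun b c ↦ h.killing.lie_einsteinL hg hu b c)] at key
  have hvert := hw _ (fderiv_bracket_eq_zero hg.isOpen h.smooth_proj hu hYd hW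
    (Filter.eventually_of_mem hUu h.vertical) (Filter.eventually_of_mem hUu hpW))
  rw [hg.symm u hu] at hvert
  have hgW' : ∀ v, g u (W u) v = einsteinL g u (X₀ u) v + μ u * g u (X₀ u) v := fun v ↦ by
    simp only [W]
    rw [sharpL_apply_apply (hg.nondegenerate u hu)]
    simp [η]
  rw [hvert, hgW'] at key
  simp only [smul_eq_mul] at key
  linarith

/-- The mass density is invariant under `Y`. -/
theorem fderiv_mass (h : IsFluidOn g U p Y X₀ μ e α P) (hu : u ∈ U) :
    fderiv ℝ μ u (Y u) = 0 := by
  have h1 := h.einsteinL_bracket hu (h.field_horizontal u hu)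
  have h2 := (h.eigenspace u hu (X₀ u) (h.field_horizontal u hu)).2 ⟨1, by simp⟩ _
    (h.isHorizontalAt_bracket hu)
  have hGs : ∀ v w, einsteinL g u v w = einsteinL g u w v := fun v w ↦ by
    simp only [einsteinL, sub_apply, smul_apply, h.metric.ricciL_symm hu v w,
      h.metric.symm u hu v w]
  rw [hGs, h2, h.field_unit u hu, h.metric.symm u hu _ (X₀ u)] at h1
  linarith

/-- The apparent field of the fluid commutes with `Y`. -/
theorem bracket_eq_zero (h : IsFluidOn g U p Y X₀ μ e α P) (hu : u ∈ U) :
    fderiv ℝ X₀ u (Y u) = fderiv ℝ Y u (X₀ u) := by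
  obtain ⟨c, hc⟩ := (h.eigenspace u hu _ (h.isHorizontalAt_bracket hu)).1 fun w hw ↦ by
    have := h.einsteinL_bracket hu hw
    rw [h.fderiv_mass hu] at this
    linarith
  have hX := h.differentiableAt_field hu
  -- `[Y, X₀] = c X₀`, and `c = 0` since `g(X₀, X₀)` is constant.
  have h1 := fderiv_invariant_apply (h.metric.differentiableAt hu) hX hX
    (fun b c ↦ h.killing.lie_metric h.metric hu b c)
  rw [fderiv_congr_of_eqOn h.metric.isOpen h.field_unit hu, fderiv_fun_const, hc] at h1
  simp only [Pi.zero_apply, zero_apply, map_smul, smul_apply, h.field_unit u hu,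
    smul_eq_mul] at h1
  have h2 : c = 0 := by linarith
  rw [← sub_eq_zero, hc, h2, zero_smul]

theorem einsteinL_field_potential (h : IsFluidOn g U p Y X₀ μ e α P) (hu : u ∈ U) :
    einsteinL g u (X₀ u) (Y u) = e u := by
  have hμ := (h.mass_pos u hu).ne'
  rw [h.einstein_eq u hu, h.pressure_mixed u hu]
  simp only [map_add, map_smul, add_apply, smul_apply, smul_eq_mul, h.field_unit u hu,
    h.unit u hu, h.inner_field_potential hu, h.inner_potential_field hu]
  field_simp
  ring

theorem einsteinL_potential_self (h : IsFluidOn g U p Y X₀ μ e α P) (hu : u ∈ U) :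
    einsteinL g u (Y u) (Y u) * μ u = e u * e u + α u * μ u := by
  have hμ := (h.mass_pos u hu).ne'
  rw [h.einstein_eq u hu, h.pressure_potential u hu]
  simp only [map_add, map_smul, add_apply, smul_apply, smul_eq_mul,
    h.unit u hu, h.inner_field_potential hu]
  field_simp
  ring

/-- The charge density is invariant under `Y`. -/
theorem fderiv_charge (h : IsFluidOn g U p Y X₀ μ e α P) (hu : u ∈ U) :
    fderiv ℝ e u (Y u) = 0 := by
  rw [← fderiv_congr_of_eqOn h.metric.isOpen (fun y hy ↦ h.einsteinL_field_potential hy) hu,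
    fderiv_invariant_apply (h.differentiableAt_einsteinL hu) (h.differentiableAt_field hu)
      (h.differentiableAt_potential hu)
      (fun b c ↦ h.killing.lie_einsteinL h.metric hu b c), h.bracket_eq_zero hu]
  simp

/-- The coefficient of `Y ⊗ Y` is invariant under `Y`. -/
theorem fderiv_coeff (h : IsFluidOn g U p Y X₀ μ e α P) (hu : u ∈ U) :
    fderiv ℝ α u (Y u) = 0 := by
  have hYd := h.differentiableAt_potential hu
  have hG := h.differentiableAt_einsteinL hu
  have he := h.differentiableAt_charge hu
  have hμ := h.differentiableAt_mass hu
  have hα := h.differentiableAt_coeff hu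
  have key := congrArg (fun φ ↦ φ (Y u)) (fderiv_congr_of_eqOn h.metric.isOpen
    (fun y hy ↦ h.einsteinL_potential_self hy) hu)
  rw [fderiv_fun_mul ((hG.clm_apply hYd).clm_apply hYd) hμ,
    fderiv_add_apply (he.fun_mul he) (hα.fun_mul hμ), fderiv_fun_mul he he,
    fderiv_fun_mul hα hμ] at key
  simp only [add_apply, smul_apply, h.fderiv_mass hu, h.fderiv_charge hu,
    fderiv_invariant_apply hG hYd hYd (fun b c ↦ h.killing.lie_einsteinL h.metric hu b c),
    sub_self, map_zero, zero_apply, smul_eq_mul, mul_zero, add_zero, zero_add] at key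
  exact (mul_eq_zero.1 key.symm).resolve_left (h.mass_pos u hu).ne'

end IsFluidOn

/-! ### The equations of motion in a chart -/

section Divergence

variable {u : E} {V : E → E} {f : E → ℝ}

theorem covDerivL_smul (hf : DifferentiableAt ℝ f u) (hV : DifferentiableAt ℝ V u) (a : E) :
    covDerivL g (fun y ↦ f y • V y) u a = fderiv ℝ f u a • V u + f u • covDerivL g V u a := by
  simp only [covDerivL_apply, fderiv_fun_smul hf hV, add_apply, smul_apply, map_smul,
    ContinuousLinearMap.smulRight_apply, smul_add]
  abel

theorem covDerivL_add {V' : E → E} (hV : DifferentiableAt ℝ V u) (hV' : DifferentiableAt ℝ V' u)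
    (a : E) :
    covDerivL g (fun y ↦ V y + V' y) u a = covDerivL g V u a + covDerivL g V' u a := by
  simp only [covDerivL_apply, fderiv_add_apply hV hV', map_add]
  abel

theorem IsMetricOn.trace_covDerivL_smul (hg : IsMetricOn g U) (hu : u ∈ U)
    (hf : DifferentiableAt ℝ f u) (hV : DifferentiableAt ℝ V u) :
    traceCLM (covDerivL g (fun y ↦ f y • V y) u) =
      fderiv ℝ f u (V u) + f u * traceCLM (covDerivL g V u) := by
  obtain ⟨e, e', h⟩ := exists_isDualPair (hg.nondegenerate u hu) (hg.symm u hu)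
  simp only [h.trace, covDerivL_smul hf hV, map_add, map_smul, add_apply, smul_apply, smul_eq_mul,
    Finset.sum_add_distrib, Finset.mul_sum]
  congr 1
  conv_rhs => rw [← h.expand (V u)]
  simp only [map_sum, map_smul, smul_eq_mul]
  exact Finset.sum_congr rfl fun i _ ↦ mul_comm _ _

/-- The covariant derivative of the tensor `f V ⊗ V`. -/
theorem IsMetricOn.fderiv_tensorSquare (hg : IsMetricOn g U) (hu : u ∈ U)
    (hf : DifferentiableAt ℝ f u) (hV : DifferentiableAt ℝ V u) (a b c : E) :
    fderiv ℝ (fun y ↦ f y * (g y (V y) b * g y (V y) c)) u a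
      - f u * (g u (V u) (christoffelL g u a b) * g u (V u) c)
      - f u * (g u (V u) b * g u (V u) (christoffelL g u a c)) =
    fderiv ℝ f u a * (g u (V u) b * g u (V u) c)
      + f u * (g u (covDerivL g V u a) b * g u (V u) c)
      + f u * (g u (V u) b * g u (covDerivL g V u a) c) := by
  have hd := (hg.differentiableAt hu).clm_apply hV
  have h : ∀ b, fderiv ℝ (fun y ↦ g y (V y) b) u a =
      g u (covDerivL g V u a) b + g u (V u) (christoffelL g u a b) := fun b ↦ by
    rw [hg.fderiv_inner hu hV (differentiableAt_const b), covDerivL_apply g (fun _ ↦ b)]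
    simp
  have hb := hd.clm_apply (differentiableAt_const b)
  have hc := hd.clm_apply (differentiableAt_const c)
  rw [fderiv_fun_mul hf (hb.fun_mul hc), fderiv_fun_mul hb hc]
  simp only [add_apply, smul_apply, smul_eq_mul, h]
  ring

/-- The divergence of the tensor `f V ⊗ V` is `(∇ · (f V)) V + f ∇_V V`. -/
theorem IsMetricOn.sum_tensorSquare (hg : IsMetricOn g U) (hu : u ∈ U)
    (hf : DifferentiableAt ℝ f u) (hV : DifferentiableAt ℝ V u) {ι : Type*} [Fintype ι]
    {e e' : ι → E} (h : IsDualPair (g u) e e') (c : E) :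
    ∑ i, (fderiv ℝ f u (e i) * (g u (V u) (e' i) * g u (V u) c)
      + f u * (g u (covDerivL g V u (e i)) (e' i) * g u (V u) c)
      + f u * (g u (V u) (e' i) * g u (covDerivL g V u (e i)) c)) =
    traceCLM (covDerivL g (fun y ↦ f y • V y) u) * g u (V u) c
      + f u * g u (covDerivL g V u (V u)) c := by
  have h1 : fderiv ℝ f u (V u) = ∑ i, g u (V u) (e' i) * fderiv ℝ f u (e i) := by
    conv_lhs => rw [← h.expand (V u)]
    simp
  have h2 : g u (covDerivL g V u (V u)) c =
      ∑ i, g u (V u) (e' i) * g u (covDerivL g V u (e i)) c := by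
    have h3 := congrArg (fun v ↦ g u (covDerivL g V u v) c) (h.expand (V u))
    simp only [map_sum, map_smul, sum_apply, smul_apply, smul_eq_mul] at h3
    exact h3.symm
  rw [hg.trace_covDerivL_smul hu hf hV, h.trace, h1, h2]
  simp only [Finset.sum_add_distrib, Finset.mul_sum, Finset.sum_mul, add_mul]
  congr 2
  · exact Finset.sum_congr rfl fun i _ ↦ by ring
  · exact Finset.sum_congr rfl fun i _ ↦ by ring

end Divergence

namespace IsFluidOn

variable {EB : Type*} [NormedAddCommGroup EB] [NormedSpace ℝ EB] [FiniteDimensional ℝ EB]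
variable {p : E → EB} {Y X₀ : E → E} {μ e α : E → ℝ} {P : E → E →L[ℝ] E →L[ℝ] ℝ} {u : E}

theorem pressure_symm (h : IsFluidOn g U p Y X₀ μ e α P) (hu : u ∈ U) (v w : E) :
    P u v w = P u w v := by
  have h1 := h.einstein_eq u hu v w
  have h2 := h.einstein_eq u hu w v
  have hG : einsteinL g u v w = einsteinL g u w v := by
    simp only [einsteinL, sub_apply, smul_apply, h.metric.ricciL_symm hu v w,
      h.metric.symm u hu v w]
  linarith

theorem differentiableAt_ratio (h : IsFluidOn g U p Y X₀ μ e α P) (hu : u ∈ U) :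
    DifferentiableAt ℝ (fun y ↦ e y / μ y) u := by
  simp only [div_eq_mul_inv]
  exact (h.differentiableAt_charge hu).fun_mul
    ((h.differentiableAt_mass hu).fun_inv (h.mass_pos u hu).ne')

/-- The field `X = X₀ + (e / μ) Y` of the fluid is differentiable. -/
theorem differentiableAt_fluid (h : IsFluidOn g U p Y X₀ μ e α P) (hu : u ∈ U) :
    DifferentiableAt ℝ (fun y ↦ X₀ y + (e y / μ y) • Y y) u :=
  (h.differentiableAt_field hu).fun_add
    ((h.differentiableAt_ratio hu).fun_smul (h.differentiableAt_potential hu))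

theorem fderiv_charge_eq (h : IsFluidOn g U p Y X₀ μ e α P) (hu : u ∈ U) (a : E) :
    fderiv ℝ e u a = fderiv ℝ (fun y ↦ e y / μ y) u a * μ u + e u / μ u * fderiv ℝ μ u a := by
  have h1 := congrArg (fun φ ↦ φ a) (fderiv_congr_of_eqOn h.metric.isOpen
    (fun y hy ↦ (div_mul_cancel₀ (e y) (h.mass_pos y hy).ne').symm) hu)
  rw [fderiv_fun_mul (h.differentiableAt_ratio hu) (h.differentiableAt_mass hu)] at h1
  simp only [add_apply, smul_apply, smul_eq_mul] at h1
  linarith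

theorem fderiv_ratio (h : IsFluidOn g U p Y X₀ μ e α P) (hu : u ∈ U) :
    fderiv ℝ (fun y ↦ e y / μ y) u (Y u) = 0 := by
  have h1 := h.fderiv_charge_eq hu (Y u)
  rw [h.fderiv_charge hu, h.fderiv_mass hu, mul_zero, add_zero] at h1
  exact (mul_eq_zero.1 h1.symm).resolve_right (h.mass_pos u hu).ne'

theorem covDerivL_fluid (h : IsFluidOn g U p Y X₀ μ e α P) (hu : u ∈ U) (a : E) :
    covDerivL g (fun y ↦ X₀ y + (e y / μ y) • Y y) u a = covDerivL g X₀ u a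
      + (fderiv ℝ (fun y ↦ e y / μ y) u a • Y u + (e u / μ u) • covDerivL g Y u a) := by
  rw [covDerivL_add (h.differentiableAt_field hu)
    ((h.differentiableAt_ratio hu).fun_smul (h.differentiableAt_potential hu)),
    covDerivL_smul (h.differentiableAt_ratio hu) (h.differentiableAt_potential hu)]

theorem trace_covDerivL_fluid (h : IsFluidOn g U p Y X₀ μ e α P) (hu : u ∈ U) :
    traceCLM (covDerivL g (fun y ↦ X₀ y + (e y / μ y) • Y y) u) = traceCLM (covDerivL g X₀ u) := by
  have hr := h.differentiableAt_ratio hu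
  have hY := h.differentiableAt_potential hu
  have : covDerivL g (fun y ↦ X₀ y + (e y / μ y) • Y y) u =
      covDerivL g X₀ u + covDerivL g (fun y ↦ (e y / μ y) • Y y) u := by
    ext a
    rw [covDerivL_add (h.differentiableAt_field hu) (hr.fun_smul hY), add_apply]
  rw [this, map_add, h.metric.trace_covDerivL_smul hu hr hY, h.fderiv_ratio hu,
    h.killing.trace_covDerivL h.metric hu]
  simp

/-- A function invariant under `Y` gives the same flux along the fluid and its apparent field. -/
theorem trace_covDerivL_smul_fluid (h : IsFluidOn g U p Y X₀ μ e α P) (hu : u ∈ U) {f : E → ℝ}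
    (hf : DifferentiableAt ℝ f u) (hfY : fderiv ℝ f u (Y u) = 0) :
    traceCLM (covDerivL g (fun y ↦ f y • (X₀ y + (e y / μ y) • Y y)) u) =
      traceCLM (covDerivL g (fun y ↦ f y • X₀ y) u) := by
  rw [h.metric.trace_covDerivL_smul hu hf (h.differentiableAt_fluid hu),
    h.metric.trace_covDerivL_smul hu hf (h.differentiableAt_field hu), h.trace_covDerivL_fluid hu,
    map_add, map_smul, hfY, smul_zero, add_zero]

theorem inner_covDerivL_potential (h : IsFluidOn g U p Y X₀ μ e α P) (hu : u ∈ U) (a : E) :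
    g u (covDerivL g Y u a) (Y u) = 0 := by
  have hY := h.differentiableAt_potential hu
  have := congrArg (fun φ ↦ φ a) (fderiv_congr_of_eqOn h.metric.isOpen h.unit hu)
  rw [h.metric.fderiv_inner hu hY hY, h.metric.symm u hu (Y u), fderiv_fun_const] at this
  simp only [Pi.zero_apply, zero_apply] at this
  linarith

/-- The integral curves of the potential are geodesics. -/
theorem covDerivL_potential_self (h : IsFluidOn g U p Y X₀ μ e α P) (hu : u ∈ U) :
    covDerivL g Y u (Y u) = 0 :=
  h.metric.nondegenerate u hu _ fun w ↦ by
    rw [h.killing.inner_covDerivL_swap h.metric hu, h.inner_covDerivL_potential hu, neg_zero]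

theorem inner_covDerivL_field (h : IsFluidOn g U p Y X₀ μ e α P) (hu : u ∈ U) (a : E) :
    g u (covDerivL g X₀ u a) (X₀ u) = 0 := by
  have hX := h.differentiableAt_field hu
  have := congrArg (fun φ ↦ φ a) (fderiv_congr_of_eqOn h.metric.isOpen h.field_unit hu)
  rw [h.metric.fderiv_inner hu hX hX, h.metric.symm u hu (X₀ u), fderiv_fun_const] at this
  simp only [Pi.zero_apply, zero_apply] at this
  linarith

theorem inner_covDerivL_field_potential (h : IsFluidOn g U p Y X₀ μ e α P) (hu : u ∈ U) (a : E) :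
    g u (covDerivL g X₀ u a) (Y u) = -g u (covDerivL g Y u a) (X₀ u) := by
  have := congrArg (fun φ ↦ φ a) (fderiv_congr_of_eqOn h.metric.isOpen
    (fun y hy ↦ h.inner_field_potential hy) hu)
  rw [h.metric.fderiv_inner hu (h.differentiableAt_field hu) (h.differentiableAt_potential hu),
    h.metric.symm u hu (X₀ u), fderiv_fun_const] at this
  simp only [Pi.zero_apply, zero_apply] at this
  linarith

/-- The conservation law `∇ · G = 0`, where the term `α Y ⊗ Y` of `G` has no divergence. -/
theorem divTensorCovectorL_pressure (h : IsFluidOn g U p Y X₀ μ e α P) (hu : u ∈ U) (c : E) :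
    divTensorCovectorL g P u c =
      -(traceCLM (covDerivL g (fun y ↦ μ y • (X₀ y + (e y / μ y) • Y y)) u)
          * g u (X₀ u + (e u / μ u) • Y u) c
        + μ u * g u (covDerivL g (fun y ↦ X₀ y + (e y / μ y) • Y y) u
          (X₀ u + (e u / μ u) • Y u)) c) := by
  have hg := h.metric
  obtain ⟨b, b', hb⟩ := exists_isDualPair (hg.nondegenerate u hu) (hg.symm u hu)
  have hX := h.differentiableAt_fluid hu
  have hY := h.differentiableAt_potential hu
  have hμ := h.differentiableAt_mass hu
  have hα := h.differentiableAt_coeff hu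
  have hgd := hg.differentiableAt hu
  have hinner : ∀ {V : E → E} {f : E → ℝ}, DifferentiableAt ℝ V u → DifferentiableAt ℝ f u →
      ∀ v w, DifferentiableAt ℝ (fun y ↦ f y * (g y (V y) v * g y (V y) w)) u :=
    fun hV hf v w ↦ hf.fun_mul (((hgd.clm_apply hV).clm_apply (differentiableAt_const v)).fun_mul
      ((hgd.clm_apply hV).clm_apply (differentiableAt_const w)))
  have hcov : ∀ v w, covDerivTensorL g (einsteinL g) u v w c =
      (fderiv ℝ (fun y ↦ μ y * (g y (X₀ y + (e y / μ y) • Y y) w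
            * g y (X₀ y + (e y / μ y) • Y y) c)) u v
        - μ u * (g u (X₀ u + (e u / μ u) • Y u) (christoffelL g u v w)
          * g u (X₀ u + (e u / μ u) • Y u) c)
        - μ u * (g u (X₀ u + (e u / μ u) • Y u) w
          * g u (X₀ u + (e u / μ u) • Y u) (christoffelL g u v c)))
      + (fderiv ℝ (fun y ↦ α y * (g y (Y y) w * g y (Y y) c)) u v
        - α u * (g u (Y u) (christoffelL g u v w) * g u (Y u) c)
        - α u * (g u (Y u) w * g u (Y u) (christoffelL g u v c)))
      + covDerivTensorL g P u v w c := by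
    intro v w
    have := congrArg (fun φ ↦ φ v) (fderiv_congr_of_eqOn hg.isOpen
      (fun y hy ↦ h.einstein_eq y hy w c) hu)
    rw [fderiv_clm_apply_const₂ (h.differentiableAt_einsteinL hu),
      fderiv_add_apply ((hinner hX hμ w c).fun_add (hinner hY hα w c))
        (((h.differentiableAt_pressure hu).clm_apply (differentiableAt_const w)).clm_apply
          (differentiableAt_const c)),
      fderiv_add_apply (hinner hX hμ w c) (hinner hY hα w c),
      fderiv_clm_apply_const₂ (h.differentiableAt_pressure hu)] at this
    rw [covDerivTensorL_apply, this, h.einstein_eq u hu, h.einstein_eq u hu, covDerivTensorL_apply]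
    ring
  have h0 := hg.divTensorCovectorL_einsteinL hu c
  rw [hb.divTensorCovectorL_apply (hg.nondegenerate u hu)] at h0
  simp only [hcov, hg.fderiv_tensorSquare hu hμ hX, hg.fderiv_tensorSquare hu hα hY] at h0
  rw [Finset.sum_add_distrib, Finset.sum_add_distrib, hg.sum_tensorSquare hu hμ hX hb,
    hg.sum_tensorSquare hu hα hY hb, h.covDerivL_potential_self hu,
    hg.trace_covDerivL_smul hu hα hY, h.fderiv_coeff hu, h.killing.trace_covDerivL hg hu,
    ← hb.divTensorCovectorL_apply (hg.nondegenerate u hu)] at h0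
  simp only [map_zero, zero_apply] at h0
  linarith

/-- Conservation of energy. -/
theorem energy_conservation (h : IsFluidOn g U p Y X₀ μ e α P) (hu : u ∈ U) :
    traceCLM (covDerivL g (fun y ↦ μ y • (X₀ y + (e y / μ y) • Y y)) u) =
      divTensorCovectorL g P u (X₀ u) := by
  rw [h.divTensorCovectorL_pressure hu, h.covDerivL_fluid hu]
  have h1 : g u (covDerivL g Y u (X₀ u)) (X₀ u) = 0 :=
    h.killing.inner_covDerivL_self h.metric hu _
  simp only [map_add, map_smul, add_apply, smul_apply, smul_eq_mul, h.inner_covDerivL_field hu,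
    h.field_unit u hu, h.inner_potential_field hu, h1, h.covDerivL_potential_self hu, map_zero,
    zero_apply]
  ring

/-- Conservation of the electric charge. -/
theorem charge_conservation (h : IsFluidOn g U p Y X₀ μ e α P) (hu : u ∈ U) :
    traceCLM (covDerivL g (fun y ↦ e y • (X₀ y + (e y / μ y) • Y y)) u) =
      divTensorCovectorL g P u (Y u) := by
  have h1 : g u (covDerivL g Y u (X₀ u)) (X₀ u) = 0 :=
    h.killing.inner_covDerivL_self h.metric hu _
  have h2 : g u (covDerivL g Y u (X₀ u)) (Y u) = 0 := h.inner_covDerivL_potential hu _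
  rw [h.divTensorCovectorL_pressure hu, h.covDerivL_fluid hu,
    h.metric.trace_covDerivL_smul hu (h.differentiableAt_charge hu) (h.differentiableAt_fluid hu),
    h.metric.trace_covDerivL_smul hu (h.differentiableAt_mass hu) (h.differentiableAt_fluid hu),
    h.fderiv_charge_eq hu]
  simp only [map_add, map_smul, add_apply, smul_apply, smul_eq_mul,
    h.inner_covDerivL_field_potential hu, h.unit u hu, h.inner_field_potential hu, h1, h2,
    h.covDerivL_potential_self hu, map_zero, zero_apply]
  have hμ := (h.mass_pos u hu).ne'
  field_simp
  ring

/-- The divergence of `ᵉP(Y)`: the contraction of the symmetric tensor `P` with the skew-symmetric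
tensor `∇Y` vanishes. -/
theorem trace_covDerivL_pressure (h : IsFluidOn g U p Y X₀ μ e α P) (hu : u ∈ U) {V : E → E}
    (hV : ∀ y ∈ U, V y = sharpL (g y) ((P y).flip (Y y))) :
    traceCLM (covDerivL g V u) = divTensorCovectorL g P u (Y u) := by
  have hg := h.metric
  obtain ⟨b, b', hb⟩ := exists_isDualPair (hg.nondegenerate u hu) (hg.symm u hu)
  have hVd : DifferentiableAt ℝ V u := by
    have : ContDiffOn ℝ ∞ (fun y ↦ sharpL (g y) ((P y).flip (Y y))) U :=
      hg.contDiffOn_sharpL.clm_apply (((flipCLM E ℝ).contDiff.comp_contDiffOn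
        h.smooth_pressure).clm_apply h.killing.contDiffOn)
    exact differentiableAt_of_contDiffOn hg.isOpen (this.congr hV) hu
  have hY := h.differentiableAt_potential hu
  have hP := h.differentiableAt_pressure hu
  have hgV : ∀ y ∈ U, ∀ w, g y (V y) w = P y w (Y y) := fun y hy w ↦ by
    rw [hV y hy, sharpL_apply_apply (hg.nondegenerate y hy)]
    rfl
  have key : ∀ a w, g u (covDerivL g V u a) w =
      covDerivTensorL g P u a w (Y u) + P u w (covDerivL g Y u a) := by
    intro a w
    have := congrArg (fun φ ↦ φ a) (fderiv_congr_of_eqOn hg.isOpen (fun y hy ↦ hgV y hy w) hu)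
    rw [hg.fderiv_inner hu hVd (differentiableAt_const w), covDerivL_apply g (fun _ ↦ w),
      fderiv_clm_apply_apply (hP.clm_apply (differentiableAt_const w)) hY,
      fderiv_clm_apply_const hP, fderiv_fun_const, hgV u hu] at this
    simp only [Pi.zero_apply, zero_apply, zero_add] at this
    rw [covDerivTensorL_apply, covDerivL_apply g Y, map_add]
    linarith
  have hzero : ∑ i, P u (b' i) (covDerivL g Y u (b i)) = 0 := by
    let Q : E →L[ℝ] E := sharpL (g u) ∘L P u
    have hQ : ∀ v w, g u (Q v) w = P u v w := fun v w ↦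
      sharpL_apply_apply (hg.nondegenerate u hu) _ _
    have h1 := hb.trace (Q ∘L covDerivL g Y u)
    have h2 := hb.trace (covDerivL g Y u ∘L Q)
    have h3 := hb.swap ((P u).flip ∘L covDerivL g Y u)
    have h4 := hb.swap ((flipCLM E ℝ) ((P u).flip ∘L covDerivL g Y u))
    simp only [ContinuousLinearMap.comp_apply, ContinuousLinearMap.flip_apply, flipCLM_apply,
      hQ] at h1 h2 h3 h4
    rw [trace_comp_comm, h1] at h2
    have h5 : ∀ i, g u (covDerivL g Y u (Q (b i))) (b' i) = -P u (b i) (covDerivL g Y u (b' i)) :=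
      fun i ↦ by
        rw [h.killing.inner_covDerivL_swap hg hu, hg.symm u hu, hQ]
    simp only [h5, Finset.sum_neg_distrib] at h2
    simp only [h.pressure_symm hu _ (b' _)] at h2
    linarith
  rw [hb.trace, hb.divTensorCovectorL_apply (hg.nondegenerate u hu)]
  simp only [key, Finset.sum_add_distrib, hzero, add_zero]

/-- The motion of the fluid. -/
theorem fluid_motion (h : IsFluidOn g U p Y X₀ μ e α P) (hu : u ∈ U) :
    μ u • covDerivL g (fun y ↦ X₀ y + (e y / μ y) • Y y) u (X₀ u + (e u / μ u) • Y u) =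
      -sharpL (g u) (divTensorCovectorL g P u)
        - divTensorCovectorL g P u (X₀ u) • (X₀ u + (e u / μ u) • Y u) := by
  refine eq_of_form_eq (h.metric.nondegenerate u hu) fun c ↦ ?_
  rw [map_sub, map_neg, sub_apply, neg_apply, sharpL_apply_apply (h.metric.nondegenerate u hu),
    h.divTensorCovectorL_pressure hu c, ← h.energy_conservation hu]
  simp only [map_smul, smul_apply, smul_eq_mul]
  ring

/-- The endomorphism associated with `F = d(Y^♭)` is `-2 ∇Y`. -/
theorem sharpL_extDerivOneL_flip (h : IsFluidOn g U p Y X₀ μ e α P) (hu : u ∈ U) (v : E) :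
    sharpL (g u) ((extDerivOneL (fun y ↦ g y (Y y)) u).flip v) = (-2 : ℝ) • covDerivL g Y u v := by
  rw [sharpL_eq_iff (h.metric.nondegenerate u hu)]
  intro w
  rw [ContinuousLinearMap.flip_apply, h.killing.extDerivOneL_eq h.metric hu,
    h.killing.inner_covDerivL_swap h.metric hu w]
  simp

/-- The motion of the apparent fluid. -/
theorem apparent_motion (h : IsFluidOn g U p Y X₀ μ e α P) (hu : u ∈ U) :
    μ u • covDerivL g X₀ u (X₀ u) =
      e u • sharpL (g u) ((extDerivOneL (fun y ↦ g y (Y y)) u).flip (X₀ u))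
        - (sharpL (g u) (divTensorCovectorL g P u) + divTensorCovectorL g P u (X₀ u) • X₀ u
          + divTensorCovectorL g P u (Y u) • Y u) := by
  have hμ := (h.mass_pos u hu).ne'
  have h1 := h.fluid_motion hu
  have h2 : covDerivL g X₀ u (Y u) = covDerivL g Y u (X₀ u) := by
    rw [covDerivL_apply, covDerivL_apply, h.bracket_eq_zero hu, h.metric.christoffelL_symm hu]
  -- The charge is carried by the fluid, which gives the component along `Y`.
  have h3 : divTensorCovectorL g P u (Y u) = μ u * fderiv ℝ (fun y ↦ e y / μ y) u (X₀ u)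
      + e u / μ u * divTensorCovectorL g P u (X₀ u) := by
    rw [← h.charge_conservation hu, ← h.energy_conservation hu,
      h.metric.trace_covDerivL_smul hu (h.differentiableAt_charge hu) (h.differentiableAt_fluid hu),
      h.metric.trace_covDerivL_smul hu (h.differentiableAt_mass hu) (h.differentiableAt_fluid hu),
      h.fderiv_charge_eq hu]
    simp only [map_add, map_smul, smul_eq_mul, h.fderiv_ratio hu]
    field_simp
    ring
  rw [h.covDerivL_fluid hu] at h1
  simp only [map_add, map_smul, h2, h.fderiv_ratio hu, h.covDerivL_potential_self hu, smul_zero,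
    add_zero] at h1
  rw [h.sharpL_extDerivOneL_flip hu, h3]
  have h4 : μ u • (e u / μ u) • covDerivL g Y u (X₀ u) = e u • covDerivL g Y u (X₀ u) := by
    rw [smul_smul, mul_div_cancel₀ _ hμ]
  simp only [smul_add, h4] at h1
  have h5 : μ u • covDerivL g X₀ u (X₀ u) =
      (μ u • covDerivL g X₀ u (X₀ u) + e u • covDerivL g Y u (X₀ u)
        + (μ u • fderiv ℝ (fun y ↦ e y / μ y) u (X₀ u) • Y u
          + e u • covDerivL g Y u (X₀ u)))
        - (2 * e u) • covDerivL g Y u (X₀ u)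
        - (μ u * fderiv ℝ (fun y ↦ e y / μ y) u (X₀ u)) • Y u := by
    module
  rw [h5, h1]
  module

/-- The source equation of Maxwell. -/
theorem maxwell (h : IsFluidOn g U p Y X₀ μ e α P) (hu : u ∈ U) :
    sharpL (g u) (divTensorCovectorL g (extDerivOneL (fun y ↦ g y (Y y))) u) =
      (2 * e u) • X₀ u + ((1 / 2) * traceCLM
        ((sharpL (g u) ∘L extDerivOneL (fun y ↦ g y (Y y)) u) ∘L
          (sharpL (g u) ∘L (extDerivOneL (fun y ↦ g y (Y y)) u).flip))) • Y u
        - (2 : ℝ) • sharpL (g u) ((P u).flip (Y u)) := by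
  have hg := h.metric
  obtain ⟨b, b', hb⟩ := exists_isDualPair (hg.nondegenerate u hu) (hg.symm u hu)
  have hμ := (h.mass_pos u hu).ne'
  have hnorm : traceCLM ((sharpL (g u) ∘L extDerivOneL (fun y ↦ g y (Y y)) u) ∘L
      (sharpL (g u) ∘L (extDerivOneL (fun y ↦ g y (Y y)) u).flip)) =
      4 * ricciL g u (Y u) (Y u) := by
    rw [hb.trace, h.killing.ricciL_self hg h.unit hu hb, Finset.mul_sum]
    refine Finset.sum_congr rfl fun i _ ↦ ?_
    simp only [ContinuousLinearMap.comp_apply]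
    rw [sharpL_apply_apply (hg.nondegenerate u hu), h.sharpL_extDerivOneL_flip hu,
      h.killing.extDerivOneL_eq hg hu, h.killing.inner_covDerivL_swap hg hu, hg.symm u hu]
    simp
    ring
  -- `Ric` is recovered from `G` up to a multiple of `g`.
  have hRic : ∀ c, ricciL g u (Y u) c = -e u * g u (X₀ u) c
      + (-(e u * (e u / μ u)) - α u + (1 / 2 : ℝ) * scalarL g u) * g u (Y u) c + P u c (Y u) := by
    intro c
    have h1 := h.einstein_eq u hu (Y u) c
    have h2 : einsteinL g u (Y u) c =
      ricciL g u (Y u) c - ((1 / 2 : ℝ) * scalarL g u) * g u (Y u) c := rfl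
    rw [h.pressure_symm hu c, eq_add_of_sub_eq h2.symm, h1]
    simp only [map_add, map_smul, add_apply, smul_apply, smul_eq_mul, h.unit u hu,
      h.inner_field_potential hu]
    field_simp
    ring
  rw [sharpL_eq_iff (hg.nondegenerate u hu)]
  intro c
  rw [h.killing.divTensorCovectorL_extDerivOneL hg hu, hnorm]
  simp only [map_sub, map_add, map_smul, sub_apply, add_apply, smul_apply, smul_eq_mul]
  rw [sharpL_apply_apply (hg.nondegenerate u hu), ContinuousLinearMap.flip_apply, hRic, hRic,
    h.unit u hu, h.inner_field_potential hu, h.pressure_potential u hu]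
  ring

end IsFluidOn

/-- The exterior derivative of a closed form `dθ` vanishes. -/
theorem extDerivTwoL_extDerivOneL {θ : E → E →L[ℝ] ℝ} (hU : IsOpen U) (hθ : ContDiffOn ℝ ∞ θ U)
    {u : E} (hu : u ∈ U) (a b c : E) : extDerivTwoL (extDerivOneL θ) u a b c = 0 := by
  have hd := differentiableAt_of_contDiffOn hU (contDiffOn_fderiv hU hθ) hu
  have h : ∀ a b c, fderiv ℝ (extDerivOneL θ) u a b c =
      fderiv ℝ (fderiv ℝ θ) u a b c - fderiv ℝ (fderiv ℝ θ) u a c b := by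
    intro a b c
    have hc : ∀ p q, DifferentiableAt ℝ (fun y ↦ fderiv ℝ θ y p q) u := fun p q ↦
      (hd.clm_apply (differentiableAt_const p)).clm_apply (differentiableAt_const q)
    rw [← fderiv_clm_apply_const₂ (differentiableAt_of_contDiffOn hU
      (contDiffOn_extDerivOneL hU hθ) hu),
      show (fun y ↦ extDerivOneL θ y b c) = fun y ↦ fderiv ℝ θ y b c - fderiv ℝ θ y c b from rfl,
      fderiv_sub_apply (hc b c) (hc c b), fderiv_clm_apply_const₂ hd, fderiv_clm_apply_const₂ hd]
  have hs := fderiv_fderiv_symm hU hθ hu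
  rw [extDerivTwoL, h, h, h, hs b a, hs c a, hs c b]
  ring

end LocalCalculus

/-! ### Tensor fields in charts -/

section Charts

variable {E : Type*} [NormedAddCommGroup E] [NormedSpace ℝ E] [FiniteDimensional ℝ E]
variable {M : Type*} [TopologicalSpace M] [ChartedSpace E M] [IsManifold 𝓘(ℝ, E) ∞ M]

/-- The differential at `u` of the inverse of the chart at `c`. The tangent space at
`(chart E c).symm u` is identified with `E`, as Mathlib does. -/
noncomputable def chartFrame (c : M) (u : E) : E →L[ℝ] E :=
  mfderiv 𝓘(ℝ, E) 𝓘(ℝ, E) (chart E c).symm u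

theorem isOpen_chart_target (c : M) : IsOpen (chart E c).target :=
  isOpen_extChartAt_target c

theorem contMDiffOn_chart_symm (c : M) :
    ContMDiffOn 𝓘(ℝ, E) 𝓘(ℝ, E) ∞ (chart E c).symm (chart E c).target :=
  contMDiffOn_extChartAt_symm c

theorem continuousOn_chart_symm (c : M) : ContinuousOn (chart E c).symm (chart E c).target :=
  (contMDiffOn_chart_symm c).continuousOn

theorem isInvertible_chartFrame {c : M} {u : E} (hu : u ∈ (chart E c).target) :
    (chartFrame c u).IsInvertible := by
  have : IsManifold 𝓘(ℝ, E) 1 M := IsManifold.of_le (n := ∞) (by simp)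
  have h := isInvertible_mfderivWithin_extChartAt_symm (I := 𝓘(ℝ, E)) hu
  rw [modelWithCornersSelf_coe, Set.range_id, mfderivWithin_univ] at h
  exact h

theorem chartFrame_self (x : M) : chartFrame x (chart E x x) = ContinuousLinearMap.id ℝ E := by
  have : IsManifold 𝓘(ℝ, E) 1 M := IsManifold.of_le (n := ∞) (by simp)
  have h := mfderivWithin_range_extChartAt_symm (I := 𝓘(ℝ, E)) (x := x)
  rw [modelWithCornersSelf_coe, Set.range_id, mfderivWithin_univ] at h
  exact h

theorem toCoords_eq (x : M) : toCoords (E := E) x = ContinuousLinearMap.id ℝ E := by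
  have : IsManifold 𝓘(ℝ, E) 1 M := IsManifold.of_le (n := ∞) (by simp)
  exact mfderiv_extChartAt_self

theorem toCoords_apply (x : M) (v : TangentSpace 𝓘(ℝ, E) x) : toCoords x v = v := by
  rw [toCoords_eq]
  rfl

theorem ofCoords_apply (x : M) (v : E) : ofCoords x v = v := by
  have : ofCoords (E := E) x = ContinuousLinearMap.inverse (ContinuousLinearMap.id ℝ E) :=
    congrArg _ (toCoords_eq x)
  rw [this, ContinuousLinearMap.inverse_id]
  rfl

theorem tensorIn_apply (c : M) (T : TensorField E M) (u a b : E) :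
    tensorIn c T u a b = T ((chart E c).symm u) (chartFrame c u a) (chartFrame c u b) := rfl

theorem tensor_congr (T : TensorField E M) {x y : M} (h : x = y) (a b : E) :
    T x a b = T y a b := by
  subst h
  rfl

theorem vector_congr (V : VectorField E M) {x y : M} (h : x = y) : (V x : E) = V y := by
  subst h
  rfl

theorem chart_symm_self (x : M) : (chart E x).symm (chart E x x) = x :=
  extChartAt_to_inv x

theorem tensorIn_self (x : M) (T : TensorField E M) (a b : E) :
    tensorIn x T (chart E x x) a b = T x a b := by
  rw [tensorIn_apply, chartFrame_self]
  exact tensor_congr T (chart_symm_self x) a b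

theorem chartFrame_vectorIn {c : M} {u : E} (hu : u ∈ (chart E c).target) (V : VectorField E M) :
    chartFrame c u (vectorIn c V u) = V ((chart E c).symm u) :=
  (isInvertible_chartFrame hu).self_apply_inverse _

theorem chartFrame_injective {c : M} {u : E} (hu : u ∈ (chart E c).target) :
    Function.Injective (chartFrame c u) :=
  (isInvertible_chartFrame hu).injective

theorem chartFrame_surjective {c : M} {u : E} (hu : u ∈ (chart E c).target) :
    Function.Surjective (chartFrame c u) :=
  (isInvertible_chartFrame hu).surjective

theorem vectorIn_self (x : M) (V : VectorField E M) : vectorIn x V (chart E x x) = V x := by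
  have h := chartFrame_vectorIn (mem_extChartAt_target x) V
  rw [chartFrame_self] at h
  exact h.trans (vector_congr V (chart_symm_self x))

theorem vectorIn_smul (c : M) (f : M → ℝ) (V : VectorField E M) :
    vectorIn c (fun y ↦ f y • V y) = fun u ↦ f ((chart E c).symm u) • vectorIn c V u := by
  funext u
  exact map_smul _ _ _

theorem vectorIn_add (c : M) (V V' : VectorField E M) :
    vectorIn c (fun y ↦ V y + V' y) = fun u ↦ vectorIn c V u + vectorIn c V' u := by
  funext u
  exact map_add _ _ _

theorem isOpen_chart_preimage (c : M) {s : Set M} (hs : IsOpen s) :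
    IsOpen ((chart E c).target ∩ (chart E c).symm ⁻¹' s) :=
  (continuousOn_chart_symm c).isOpen_inter_preimage (isOpen_chart_target c) hs

theorem contDiffOn_function {F : Type*} [NormedAddCommGroup F] [NormedSpace ℝ F] (c : M)
    {f : M → F} {s : Set M} (hf : ContMDiffOn 𝓘(ℝ, E) 𝓘(ℝ, F) ∞ f s) :
    ContDiffOn ℝ ∞ (fun u ↦ f ((chart E c).symm u))
      ((chart E c).target ∩ (chart E c).symm ⁻¹' s) := by
  rw [← contMDiffOn_iff_contDiffOn]
  exact hf.comp' (contMDiffOn_chart_symm c)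

theorem SmoothVectorOn.contDiffOn {V : VectorField E M} {s : Set M} (hV : SmoothVectorOn V s)
    (hs : IsOpen s) (c : M) :
    ContDiffOn ℝ ∞ (vectorIn c V) ((chart E c).target ∩ (chart E c).symm ⁻¹' s) := by
  have : CompleteSpace E := FiniteDimensional.complete ℝ E
  intro u hu
  refine ContDiffAt.contDiffWithinAt ?_
  have h := ContMDiffAt.mpullback_vectorField_preimage (n := ∞) (m := ∞) (I := 𝓘(ℝ, E))
    (I' := 𝓘(ℝ, E)) (V := V) (f := (chart E c).symm) (x₀ := u)
    (ContMDiffOn.contMDiffAt hV (hs.mem_nhds hu.2))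
    ((contMDiffOn_chart_symm c).contMDiffAt ((isOpen_chart_target c).mem_nhds hu.1))
    (isInvertible_chartFrame (E := E) hu.1) (by simp)
  exact contMDiffAt_vectorSpace_iff_contDiffAt.1 h

/-- The vector field with constant coordinates `a` in the chart at `c`. -/
noncomputable def coordField (c : M) (a : E) : VectorField E M :=
  VectorField.mpullback 𝓘(ℝ, E) 𝓘(ℝ, E) (chart E c) (fun _ ↦ a)

theorem smoothVectorOn_coordField (c : M) (a : E) :
    SmoothVectorOn (coordField c a) (chart E c).source := by
  have : CompleteSpace E := FiniteDimensional.complete ℝ E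
  have h1 : IsManifold 𝓘(ℝ, E) 1 M := IsManifold.of_le (n := ∞) (by simp)
  intro y hy
  refine ContMDiffAt.contMDiffWithinAt ?_
  exact ContMDiffAt.mpullback_vectorField_preimage (n := ∞)
    (contMDiffAt_vectorSpace_iff_contDiffAt.2 contDiffAt_const)
    (contMDiffAt_extChartAt' (by rwa [← extChartAt_source 𝓘(ℝ, E)]))
    (isInvertible_mfderiv_extChartAt hy) (by simp)

theorem coordField_symm {c : M} {u : E} (hu : u ∈ (chart E c).target) (a : E) :
    coordField c a ((chart E c).symm u) = chartFrame c u a := by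
  have h1 : IsManifold 𝓘(ℝ, E) 1 M := IsManifold.of_le (n := ∞) (by simp)
  have hy := (chart E c).map_target hu
  have h := mfderiv_extChartAt_comp_mfderivWithin_extChartAt_symm (I := 𝓘(ℝ, E)) hu
  rw [modelWithCornersSelf_coe, Set.range_id, mfderivWithin_univ] at h
  have h2 := (isInvertible_mfderiv_extChartAt (I := 𝓘(ℝ, E)) hy).inverse_apply_self
    (chartFrame c u a)
  have h3 : mfderiv 𝓘(ℝ, E) 𝓘(ℝ, E) (chart E c) ((chart E c).symm u) (chartFrame c u a) = a :=
    congrArg (fun φ : E →L[ℝ] E ↦ φ a) h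
  rw [h3] at h2
  exact h2

theorem SmoothTensorOn.contDiffOn {T : TensorField E M} {s : Set M} (hT : SmoothTensorOn T s)
    (c : M) :
    ContDiffOn ℝ ∞ (tensorIn c T) ((chart E c).target ∩ (chart E c).symm ⁻¹' s) := by
  rw [contDiffOn_clm_apply]
  intro a
  rw [contDiffOn_clm_apply]
  intro b
  have h := ContMDiffOn.clm_bundle_apply₂ (hT.mono Set.inter_subset_right)
    ((smoothVectorOn_coordField c a).mono Set.inter_subset_left)
    ((smoothVectorOn_coordField c b).mono (Set.inter_subset_left (t := s)))
  have h' : ContMDiffOn 𝓘(ℝ, E) 𝓘(ℝ, ℝ) ∞ (fun y ↦ T y (coordField c a y) (coordField c b y))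
      ((chart E c).source ∩ s) := by
    intro y hy
    exact ((Bundle.contMDiffWithinAt_totalSpace).1 (h y hy)).2
  refine (contDiffOn_function c h').congr_mono ?_ ?_
  · intro u hu
    rw [tensorIn_apply, coordField_symm hu.1, coordField_symm hu.1]
  · intro u hu
    exact ⟨hu.1, (chart E c).map_target hu.1, hu.2⟩

end Charts

/-! ### Semi-Riemannian operators in an arbitrary chart -/

section Transition

variable {E : Type*} [NormedAddCommGroup E] [NormedSpace ℝ E] [FiniteDimensional ℝ E]
variable {M : Type*} [TopologicalSpace M] [ChartedSpace E M] [IsManifold 𝓘(ℝ, E) ∞ M]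

theorem IsMetricOn.mono {g : E → E →L[ℝ] E →L[ℝ] ℝ} {U U' : Set E} (hg : IsMetricOn g U)
    (hU' : IsOpen U') (h : U' ⊆ U) : IsMetricOn g U' where
  isOpen := hU'
  contDiffOn := hg.contDiffOn.mono h
  symm u hu := hg.symm u (h hu)
  nondegenerate u hu := hg.nondegenerate u (h hu)

/-- The expression of a semi-Riemannian metric in a chart. -/
theorem SemiRiemannianMetric.isMetricOn (g : SemiRiemannianMetric E M) (c : M) :
    IsMetricOn (tensorIn c g.val) (chart E c).target where
  isOpen := isOpen_chart_target c
  contDiffOn := (g.smooth.contDiffOn c).mono fun u hu ↦ ⟨hu, trivial⟩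
  symm u _ v w := g.symm _ _ _
  nondegenerate u hu v hv := by
    refine chartFrame_injective hu ?_
    rw [map_zero]
    refine g.nondegenerate ((chart E c).symm u) (chartFrame c u v) fun w ↦ ?_
    obtain ⟨w, rfl⟩ := chartFrame_surjective hu w
    exact hv w

/-- The change of coordinates from the chart at `c` to the chart at `c'`. -/
noncomputable def transition (c c' : M) (u : E) : E := chart E c' ((chart E c).symm u)

/-- The domain of the change of coordinates from the chart at `c` to the chart at `c'`. -/
def transitionSource (E : Type*) [NormedAddCommGroup E] [NormedSpace ℝ E] {M : Type*}
    [TopologicalSpace M] [ChartedSpace E M] (c c' : M) : Set E :=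
  (chart E c).target ∩ (chart E c).symm ⁻¹' (chart E c').source

theorem isOpen_transitionSource (c c' : M) : IsOpen (transitionSource E c c') :=
  isOpen_chart_preimage c (isOpen_extChartAt_source c')

theorem contDiffOn_transition (c c' : M) :
    ContDiffOn ℝ ∞ (transition c c') (transitionSource E c c') := by
  refine contDiffOn_function c ?_
  rw [extChartAt_source]
  exact contMDiffOn_extChartAt

theorem transition_mapsTo (c c' : M) :
    Set.MapsTo (transition c c') (transitionSource E c c') (chart E c').target :=
  fun _ hu ↦ (chart E c').map_source hu.2

theorem chart_symm_transition {c c' : M} {u : E} (hu : u ∈ transitionSource E c c') :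
    (chart E c').symm (transition c c' u) = (chart E c).symm u :=
  (chart E c').left_inv hu.2

theorem chartFrame_transition {c c' : M} {u : E} (hu : u ∈ transitionSource E c c') (a : E) :
    chartFrame c' (transition c c' u) (fderiv ℝ (transition c c') u a) = chartFrame c u a := by
  have h1 : mfderiv 𝓘(ℝ, E) 𝓘(ℝ, E) ((chart E c').symm ∘ transition c c') u =
      (mfderiv 𝓘(ℝ, E) 𝓘(ℝ, E) (chart E c').symm (transition c c' u)).comp
        (mfderiv 𝓘(ℝ, E) 𝓘(ℝ, E) (transition c c') u) := by
    refine mfderiv_comp u ?_ ?_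
    · exact ((contMDiffOn_chart_symm c').contMDiffAt
        ((isOpen_chart_target c').mem_nhds (transition_mapsTo c c' hu))).mdifferentiableAt (by simp)
    · exact (differentiableAt_of_contDiffOn (isOpen_transitionSource c c')
        (contDiffOn_transition c c') hu).mdifferentiableAt
  have h2 : (chart E c').symm ∘ transition c c' =ᶠ[𝓝 u] (chart E c).symm :=
    Filter.eventually_of_mem ((isOpen_transitionSource c c').mem_nhds hu)
      fun y hy ↦ chart_symm_transition hy
  have h3 := h2.mfderiv_eq (I := 𝓘(ℝ, E)) (I' := 𝓘(ℝ, E))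
  rw [mfderiv_eq_fderiv] at h1
  exact congrArg (fun φ : E →L[ℝ] E ↦ φ a) (h1.symm.trans h3)

theorem tensorIn_transition {c c' : M} {u : E} (hu : u ∈ transitionSource E c c')
    (T : TensorField E M) (a b : E) :
    tensorIn c T u a b = tensorIn c' T (transition c c' u) (fderiv ℝ (transition c c') u a)
      (fderiv ℝ (transition c c') u b) := by
  rw [tensorIn_apply, tensorIn_apply, chartFrame_transition hu, chartFrame_transition hu]
  exact tensor_congr T (chart_symm_transition hu).symm _ _

theorem vectorIn_transition {c c' : M} {u : E} (hu : u ∈ transitionSource E c c')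
    (V : VectorField E M) :
    fderiv ℝ (transition c c') u (vectorIn c V u) = vectorIn c' V (transition c c' u) := by
  refine chartFrame_injective (transition_mapsTo c c' hu) ?_
  rw [chartFrame_transition hu, chartFrame_vectorIn hu.1]
  exact (vector_congr V (chart_symm_transition hu).symm).trans
    (chartFrame_vectorIn (transition_mapsTo c c' hu) V).symm

theorem isIsometryOn_transition (g : SemiRiemannianMetric E M) (c c' : M) :
    IsIsometryOn (tensorIn c g.val) (transitionSource E c c') (tensorIn c' g.val)
      (chart E c').target (transition c c') where
  source := (g.isMetricOn c).mono (isOpen_transitionSource c c') Set.inter_subset_left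
  target := g.isMetricOn c'
  contDiffOn := contDiffOn_transition c c'
  mapsTo := transition_mapsTo c c'
  isometry _ hu := tensorIn_transition hu g.val

theorem mem_transitionSource {c : M} {u : E} (hu : u ∈ (chart E c).target) :
    u ∈ transitionSource E c ((chart E c).symm u) :=
  ⟨hu, mem_extChartAt_source _⟩

theorem fderiv_transition {c : M} {u : E} (hu : u ∈ (chart E c).target) (a : E) :
    fderiv ℝ (transition c ((chart E c).symm u)) u a = chartFrame c u a := by
  have h := chartFrame_transition (mem_transitionSource hu) a
  rwa [show transition c ((chart E c).symm u) u =
    chart E ((chart E c).symm u) ((chart E c).symm u) from rfl, chartFrame_self] at h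

variable (g : SemiRiemannianMetric E M)

theorem covDeriv_eq (V : VectorField E M) (x : M) (v : TangentSpace 𝓘(ℝ, E) x) :
    covDeriv g V x v = covDerivL (tensorIn x g.val) (vectorIn x V) (chart E x x) v := by
  rw [covDeriv, ofCoords_apply, toCoords_apply]

/-- The covariant derivative may be computed in any chart. -/
theorem covDeriv_chartFrame {V : VectorField E M} {s : Set M} (hs : IsOpen s)
    (hV : SmoothVectorOn V s) {c : M} {u : E} (hu : u ∈ (chart E c).target)
    (hus : (chart E c).symm u ∈ s) (a : E) :
    covDeriv g V ((chart E c).symm u) (chartFrame c u a) =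
      chartFrame c u (covDerivL (tensorIn c g.val) (vectorIn c V) u a) := by
  have hτ := mem_transitionSource hu
  have h := (isIsometryOn_transition g c ((chart E c).symm u)).covDerivL_eq hτ
    (differentiableAt_of_contDiffOn (isOpen_chart_preimage c hs) (hV.contDiffOn hs c) ⟨hu, hus⟩)
    (differentiableAt_of_contDiffOn (isOpen_chart_preimage _ hs) (hV.contDiffOn hs _)
      ⟨transition_mapsTo c _ hτ, by rwa [Set.mem_preimage, chart_symm_transition hτ]⟩)
    (Filter.eventually_of_mem ((isOpen_transitionSource c _).mem_nhds hτ)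
      fun y hy ↦ vectorIn_transition hy V) a
  rw [fderiv_transition hu, fderiv_transition hu] at h
  exact (covDeriv_eq g V _ (chartFrame c u a)).trans h.symm

theorem einstein_eq (x : M) (v w : TangentSpace 𝓘(ℝ, E) x) :
    einstein g x v w = einsteinL (tensorIn x g.val) (chart E x x) v w := by
  have h : einstein g x v w =
    einsteinL (tensorIn x g.val) (chart E x x) (toCoords x v) (toCoords x w) := rfl
  rw [h, toCoords_apply, toCoords_apply]

/-- The Einstein curvature may be computed in any chart. -/
theorem tensorIn_einstein {c : M} {u : E} (hu : u ∈ (chart E c).target) (a b : E) :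
    tensorIn c (einstein g) u a b = einsteinL (tensorIn c g.val) u a b := by
  have h := (isIsometryOn_transition g c ((chart E c).symm u)).einsteinL_eq
    (mem_transitionSource hu) a b
  rw [fderiv_transition hu, fderiv_transition hu] at h
  exact (einstein_eq g ((chart E c).symm u) (chartFrame c u a) (chartFrame c u b)).trans h.symm

variable {g}

/-- A Killing field read in a chart. -/
theorem IsKilling.isKillingOn {Y : VectorField E M} (hK : IsKilling g Y)
    (hY : SmoothVectorOn Y Set.univ) (c : M) :
    IsKillingOn (tensorIn c g.val) (chart E c).target (vectorIn c Y) where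
  contDiffOn := (hY.contDiffOn isOpen_univ c).mono fun u hu ↦ ⟨hu, trivial⟩
  killing u hu v w := by
    have h := hK ((chart E c).symm u) (chartFrame c u v) (chartFrame c u w)
    rw [covDeriv_chartFrame g isOpen_univ hY hu trivial,
      covDeriv_chartFrame g isOpen_univ hY hu trivial] at h
    exact h

theorem formIn_flat {c : M} {u : E} (hu : u ∈ (chart E c).target) (Y : VectorField E M) :
    formIn c (fun x ↦ g.val x (Y x)) u = tensorIn c g.val u (vectorIn c Y u) := by
  ext a
  rw [tensorIn_apply, chartFrame_vectorIn hu]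
  rfl

theorem electromagneticField_eq {Y : VectorField E M} (hK : IsKilling g Y)
    (hY : SmoothVectorOn Y Set.univ) (x : M) (v w : TangentSpace 𝓘(ℝ, E) x) :
    electromagneticField g Y x v w = 2 * g.val x (covDeriv g Y x v) w := by
  have h1 : electromagneticField g Y x v w = extDerivOneL (formIn x (fun x ↦ g.val x (Y x)))
      (chart E x x) (toCoords x v) (toCoords x w) := rfl
  have hx : chart E x x ∈ (chart E x).target := mem_extChartAt_target x
  have h2 : extDerivOneL (formIn x (fun x ↦ g.val x (Y x))) (chart E x x) =
      extDerivOneL (fun u ↦ tensorIn x g.val u (vectorIn x Y u)) (chart E x x) := by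
    rw [extDerivOneL, extDerivOneL, fderiv_congr_of_eqOn (isOpen_chart_target x)
      (fun u hu ↦ formIn_flat hu Y) hx]
  have h3 : g.val x (covDeriv g Y x v) w = tensorIn x g.val (chart E x x)
      (covDerivL (tensorIn x g.val) (vectorIn x Y) (chart E x x) v) w :=
    (congrArg (fun z ↦ g.val x z w) (covDeriv_eq g Y x v)).trans (tensorIn_self x g.val _ w).symm
  rw [h1, h2, h3, (hK.isKillingOn hY x).extDerivOneL_eq (g.isMetricOn x) hx, toCoords_apply,
    toCoords_apply]

/-- The electromagnetic field may be computed in any chart. -/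
theorem tensorIn_electromagneticField {Y : VectorField E M} (hK : IsKilling g Y)
    (hY : SmoothVectorOn Y Set.univ) {c : M} {u : E} (hu : u ∈ (chart E c).target) :
    tensorIn c (electromagneticField g Y) u =
      extDerivOneL (fun u ↦ tensorIn c g.val u (vectorIn c Y u)) u := by
  ext a b
  rw [(hK.isKillingOn hY c).extDerivOneL_eq (g.isMetricOn c) hu]
  refine (electromagneticField_eq hK hY ((chart E c).symm u) (chartFrame c u a)
    (chartFrame c u b)).trans ?_
  exact congrArg (fun z ↦ 2 * g.val ((chart E c).symm u) z (chartFrame c u b))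
    (covDeriv_chartFrame g isOpen_univ hY hu trivial a)

theorem inner_endo (T : TensorField E M) (x : M) (v w : TangentSpace 𝓘(ℝ, E) x) :
    g.val x (endo g T x v) w = T x w v := by
  have hx : chart E x x ∈ (chart E x).target := mem_extChartAt_target x
  have h := sharpL_apply_apply ((g.isMetricOn x).nondegenerate _ hx)
    ((tensorIn x T (chart E x x)).flip v) w
  have h1 : endo g T x v = sharpL (tensorIn x g.val (chart E x x))
      ((tensorIn x T (chart E x x)).flip v) := by
    rw [endo, ofCoords_apply, toCoords_apply]
  refine (congrArg (fun z ↦ g.val x z w) h1).trans ?_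
  exact ((tensorIn_self x g.val _ w).symm.trans h).trans (tensorIn_self x T w v)

theorem vectorIn_endo {c : M} {u : E} (hu : u ∈ (chart E c).target) (T : TensorField E M)
    (Y : VectorField E M) :
    vectorIn c (fun y ↦ endo g T y (Y y)) u =
      sharpL (tensorIn c g.val u) ((tensorIn c T u).flip (vectorIn c Y u)) := by
  symm
  rw [sharpL_eq_iff ((g.isMetricOn c).nondegenerate u hu)]
  intro w
  rw [tensorIn_apply, chartFrame_vectorIn hu, ContinuousLinearMap.flip_apply, tensorIn_apply,
    chartFrame_vectorIn hu]
  exact inner_endo T ((chart E c).symm u) (Y ((chart E c).symm u)) (chartFrame c u w)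

end Transition

/-! ### Orthogonal projections -/

section Projection

variable {E : Type*} [NormedAddCommGroup E] [NormedSpace ℝ E] [FiniteDimensional ℝ E]
variable {M : Type*} [TopologicalSpace M] [ChartedSpace E M] [IsManifold 𝓘(ℝ, E) ∞ M]
variable {g : SemiRiemannianMetric E M} {x : M} {K : Submodule ℝ (TangentSpace 𝓘(ℝ, E) x)}

/-- The projection on a subspace which meets its orthogonal trivially is characterized by its
defining property. -/
theorem orthProj_eq (hK : ∀ v ∈ K, v ∈ orth g x K → v = 0) {v w : TangentSpace 𝓘(ℝ, E) x}
    (hw : w ∈ K) (hvw : v - w ∈ orth g x K) : orthProj g x K v = w := by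
  have h : ∃ w ∈ K, v - w ∈ orth g x K := ⟨w, hw, hvw⟩
  rw [orthProj, dif_pos h]
  obtain ⟨h1, h2⟩ := h.choose_spec
  refine sub_eq_zero.1 (hK _ (K.sub_mem h1 hw) ?_)
  rw [show h.choose - w = (v - w) - (v - h.choose) by abel]
  exact (orth g x K).sub_mem hvw h2

/-- A subspace which meets its orthogonal trivially is complemented by it. -/
theorem exists_sub_mem_orth (hK : ∀ v ∈ K, v ∈ orth g x K → v = 0)
    (v : TangentSpace 𝓘(ℝ, E) x) : ∃ w ∈ K, v - w ∈ orth g x K := by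
  have : FiniteDimensional ℝ (TangentSpace 𝓘(ℝ, E) x) := inferInstanceAs (FiniteDimensional ℝ E)
  let B : LinearMap.BilinForm ℝ K :=
    LinearMap.mk₂ ℝ (fun a b ↦ g.val x a b) (by intros; simp) (by intros; simp) (by intros; simp)
      (by intros; simp)
  have hB : B.Nondegenerate := by
    have hs : B.IsSymm := ⟨fun a b ↦ g.symm x a b⟩
    refine (LinearMap.IsRefl.nondegenerate_iff_separatingLeft hs.isRefl).2 fun a ha ↦ ?_
    exact Subtype.ext (hK a a.2 fun w hw ↦ ha ⟨w, hw⟩)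
  let φ : Module.Dual ℝ K := (g.val x v).toLinearMap ∘ₗ K.subtype
  let w : K := (B.toDual hB).symm φ
  refine ⟨w, w.2, fun z hz ↦ ?_⟩
  have h1 : B w ⟨z, hz⟩ = g.val x v z :=
    LinearMap.BilinForm.apply_toDual_symm_apply (hB := hB) φ ⟨z, hz⟩
  have h2 : B w ⟨z, hz⟩ = g.val x w z := rfl
  rw [map_sub, sub_apply, ← h1, h2, sub_self]

theorem orthProj_eq_iff (hK : ∀ v ∈ K, v ∈ orth g x K → v = 0) {v w : TangentSpace 𝓘(ℝ, E) x}
    (hw : w ∈ K) : orthProj g x K v = w ↔ ∀ z ∈ K, g.val x v z = g.val x w z := by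
  constructor
  · rintro rfl z hz
    obtain ⟨w', hw', hv⟩ := exists_sub_mem_orth hK v
    rw [orthProj_eq hK hw' hv]
    have := hv z hz
    rw [map_sub, sub_apply] at this
    linarith
  · intro h
    refine orthProj_eq hK hw fun z hz ↦ ?_
    rw [map_sub, sub_apply, h z hz, sub_self]

end Projection

/-! ### Fluid domains in charts -/

section Fluid

variable {E EB ES EW : Type*} [NormedAddCommGroup E] [NormedSpace ℝ E] [FiniteDimensional ℝ E]
  [NormedAddCommGroup EB] [NormedSpace ℝ EB] [NormedAddCommGroup ES] [NormedSpace ℝ ES]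
  [NormedAddCommGroup EW] [NormedSpace ℝ EW]
variable {M B S W : Type*} [TopologicalSpace M] [ChartedSpace E M] [IsManifold 𝓘(ℝ, E) ∞ M]
  [TopologicalSpace B] [ChartedSpace EB B] [TopologicalSpace S] [ChartedSpace ES S]
  [TopologicalSpace W] [ChartedSpace EW W]

/-- The projection of a bundle is a submersion: it has smooth local sections through every point. -/
theorem IsMultiFiberBundle.surjective_mfderiv {π : M → B} {Φ : M → S × W}
    (h : IsMultiFiberBundle E EB ES EW π Φ) (y : M) :
    Function.Surjective (mfderiv 𝓘(ℝ, E) 𝓘(ℝ, EB) π y) := by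
  obtain ⟨t, ht, -, hs⟩ := h.locally_trivial (π y)
  have hy : y ∈ t.source := t.mem_source.2 ht
  let s : B → M := fun b ↦ t.toOpenPartialHomeomorph.symm (b, (t y).2)
  have htarget : ∀ b ∈ t.baseSet, (b, (t y).2) ∈ t.target := fun b hb ↦ t.mem_target.2 hb
  have hsy : s (π y) = y := by
    have : (π y, (t y).2) = t y := Prod.ext (t.coe_fst hy).symm rfl
    simp only [s, this]
    exact t.toOpenPartialHomeomorph.left_inv hy
  have hsd : MDifferentiableAt 𝓘(ℝ, EB) 𝓘(ℝ, E) s (π y) := by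
    have h1 := (hs.contMDiffAt (t.open_target.mem_nhds (htarget _ ht)))
    have h2 : ContMDiffAt 𝓘(ℝ, EB) (𝓘(ℝ, EB).prod (𝓘(ℝ, ES).prod 𝓘(ℝ, EW))) ∞
        (fun b : B ↦ (b, (t y).2)) (π y) := contMDiffAt_id.prodMk contMDiffAt_const
    exact (h1.comp (π y) h2).mdifferentiableAt (by simp)
  have hπd : MDifferentiableAt 𝓘(ℝ, E) 𝓘(ℝ, EB) π (s (π y)) :=
    h.smooth_proj.contMDiffAt.mdifferentiableAt (by simp)
  have hcomp : π ∘ s =ᶠ[𝓝 (π y)] id :=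
    Filter.eventually_of_mem (t.open_baseSet.mem_nhds ht)
      fun b hb ↦ t.proj_symm_apply (htarget b hb)
  have h1 := mfderiv_comp (π y) hπd hsd
  have h2 := hcomp.mfderiv_eq (I := 𝓘(ℝ, EB)) (I' := 𝓘(ℝ, EB))
  rw [mfderiv_id] at h2
  rw [hsy] at h1
  intro v
  refine ⟨mfderiv 𝓘(ℝ, EB) 𝓘(ℝ, E) s (π y) v, ?_⟩
  exact congrArg (fun φ : EB →L[ℝ] EB ↦ φ v) (h1.symm.trans h2)

variable [IsManifold 𝓘(ℝ, EB) ∞ B]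

/-- The projection `π` read in charts around `x` and `π x`. -/
noncomputable def projIn (EB : Type*) [NormedAddCommGroup EB] [NormedSpace ℝ EB]
    [ChartedSpace EB B] (π : M → B) (x : M) (u : E) : EB :=
  chart EB (π x) (π ((chart E x).symm u))

/-- The part of the chart at `x` over which a domain `D` and the projection `π` are read. -/
def fluidChart (E EB : Type*) [NormedAddCommGroup E] [NormedSpace ℝ E] [NormedAddCommGroup EB]
    [NormedSpace ℝ EB] {M B : Type*} [TopologicalSpace M] [ChartedSpace E M] [TopologicalSpace B]
    [ChartedSpace EB B] (π : M → B) (D : Set M) (x : M) : Set E :=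
  (chart E x).target ∩ (chart E x).symm ⁻¹' (D ∩ π ⁻¹' (chart EB (π x)).source)

theorem isOpen_fluidChart {π : M → B} {D : Set M} (hπ : ContMDiff 𝓘(ℝ, E) 𝓘(ℝ, EB) ∞ π)
    (hD : IsOpen D) (x : M) : IsOpen (fluidChart E EB π D x) :=
  isOpen_chart_preimage x
    (hD.inter ((isOpen_extChartAt_source (I := 𝓘(ℝ, EB)) (π x)).preimage hπ.continuous))

theorem contDiffOn_projIn {π : M → B} {D : Set M} (hπ : ContMDiff 𝓘(ℝ, E) 𝓘(ℝ, EB) ∞ π) (x : M) :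
    ContDiffOn ℝ ∞ (projIn EB π x) (fluidChart E EB π D x) := by
  have h : ContMDiffOn 𝓘(ℝ, E) 𝓘(ℝ, EB) ∞ (fun y ↦ chart EB (π x) (π y))
      (π ⁻¹' (chart EB (π x)).source) := by
    rw [extChartAt_source]
    exact (contMDiffOn_extChartAt (I := 𝓘(ℝ, EB)) (n := ∞)).comp hπ.contMDiffOn
      (Set.mapsTo_preimage _ _)
  exact (contDiffOn_function x h).mono fun u hu ↦ ⟨hu.1, hu.2.2⟩

theorem fderiv_projIn {π : M → B} {D : Set M} (hπ : ContMDiff 𝓘(ℝ, E) 𝓘(ℝ, EB) ∞ π) {x : M}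
    {u : E} (hu : u ∈ fluidChart E EB π D x) (a : E) :
    fderiv ℝ (projIn EB π x) u a =
      mfderiv 𝓘(ℝ, EB) 𝓘(ℝ, EB) (chart EB (π x)) (π ((chart E x).symm u))
        (mfderiv 𝓘(ℝ, E) 𝓘(ℝ, EB) π ((chart E x).symm u) (chartFrame x u a)) := by
  have : IsManifold 𝓘(ℝ, EB) 1 B := IsManifold.of_le (n := ∞) (by simp)
  have h1 : MDifferentiableAt 𝓘(ℝ, E) 𝓘(ℝ, E) (chart E x).symm u :=
    ((contMDiffOn_chart_symm x).contMDiffAt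
      ((isOpen_chart_target x).mem_nhds hu.1)).mdifferentiableAt (by simp)
  have h2 : MDifferentiableAt 𝓘(ℝ, E) 𝓘(ℝ, EB) π ((chart E x).symm u) :=
    hπ.contMDiffAt.mdifferentiableAt (by simp)
  have h3 : MDifferentiableAt 𝓘(ℝ, EB) 𝓘(ℝ, EB) (chart EB (π x)) (π ((chart E x).symm u)) :=
    mdifferentiableAt_extChartAt (by
      have := hu.2.2
      rwa [Set.mem_preimage, extChartAt_source] at this)
  have h4 := mfderiv_comp u h3 (h2.comp u h1)
  have h5 := mfderiv_comp u h2 h1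
  rw [h5] at h4
  have h6 : mfderiv 𝓘(ℝ, E) 𝓘(ℝ, EB) (projIn EB π x) u = fderiv ℝ (projIn EB π x) u :=
    mfderiv_eq_fderiv
  exact congrArg (fun φ : E →L[ℝ] EB ↦ φ a) (h6.symm.trans h4)

theorem fderiv_projIn_eq_zero_iff {π : M → B} {D : Set M}
    (hπ : ContMDiff 𝓘(ℝ, E) 𝓘(ℝ, EB) ∞ π) {x : M} {u : E} (hu : u ∈ fluidChart E EB π D x)
    (a : E) : fderiv ℝ (projIn EB π x) u a = 0 ↔
      chartFrame x u a ∈ tangentFiber EB π ((chart E x).symm u) := by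
  have : IsManifold 𝓘(ℝ, EB) 1 B := IsManifold.of_le (n := ∞) (by simp)
  rw [fderiv_projIn hπ hu]
  have hinj := (isInvertible_mfderiv_extChartAt (I := 𝓘(ℝ, EB)) hu.2.2).injective
  exact ⟨fun h ↦ hinj (h.trans (map_zero _).symm), fun h ↦ by
    have h' : mfderiv 𝓘(ℝ, E) 𝓘(ℝ, EB) π ((chart E x).symm u) (chartFrame x u a) = 0 := h
    exact (congrArg _ h').trans (map_zero _)⟩

theorem isHorizontalAt_iff {g : SemiRiemannianMetric E M} {π : M → B} {D : Set M}
    (hπ : ContMDiff 𝓘(ℝ, E) 𝓘(ℝ, EB) ∞ π) {x : M} {u : E} (hu : u ∈ fluidChart E EB π D x)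
    (a : E) : IsHorizontalAt (tensorIn x g.val) (projIn EB π x) u a ↔
      chartFrame x u a ∈ horizontal EB g π ((chart E x).symm u) := by
  constructor
  · intro h v hv
    obtain ⟨v, rfl⟩ := chartFrame_surjective hu.1 v
    exact h v ((fderiv_projIn_eq_zero_iff hπ hu v).2 hv)
  · intro h v hv
    exact h _ ((fderiv_projIn_eq_zero_iff hπ hu v).1 hv)

/-- The metric of a spacetime is nondegenerate on the horizontal spaces: a horizontal vector which
is orthogonal to all of them is orthogonal to the timelike one, hence spacelike or zero. -/
theorem IsSpacetime.horizontal_nondegenerate {m : ℕ} {g : SemiRiemannianMetric E M} {π : M → B}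
    {Φ : M → Circle × W} (hM : IsSpacetime EB EW m g π Φ) (x : M) :
    ∀ v ∈ horizontal EB g π x, v ∈ orth g x (horizontal EB g π x) → v = 0 := by
  intro v hv hv'
  obtain ⟨u, hu, -, hpos⟩ := hM.signature_horizontal x
  by_contra hne
  have h1 := hpos v hv (by rw [g.symm]; exact hv' u hu) hne
  rw [hv' v hv] at h1
  exact lt_irrefl _ h1

theorem vectorIn_fluidField (X₀ Y : VectorField E M) (μ e : M → ℝ) (x : M) :
    vectorIn x (fluidField X₀ Y μ e) = fun u ↦ vectorIn x X₀ u +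
      (e ((chart E x).symm u) / μ ((chart E x).symm u)) • vectorIn x Y u := by
  have h := vectorIn_add x X₀ (fun y ↦ (e y / μ y) • Y y)
  rw [vectorIn_smul x (fun y ↦ e y / μ y) Y] at h
  exact h

/-- A fluid domain read in a chart. -/
theorem IsFluidDomain.isFluidOn {m : ℕ} {g : SemiRiemannianMetric E M} {π : M → B}
    {Φ : M → Circle × W} (hM : IsSpacetime EB EW m g π Φ) {Y : VectorField E M}
    (hY : IsElectromagneticPotential EB EW g π Φ Y) (hK : IsKilling g Y) {D : Set M}
    {X₀ : VectorField E M} {μ e α : M → ℝ} {P : TensorField E M}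
    (hD : IsFluidDomain EB g π Y D X₀ μ e α P) (x : M) :
    IsFluidOn (tensorIn x g.val) (fluidChart E EB π D x) (projIn EB π x) (vectorIn x Y)
      (vectorIn x X₀) (fun u ↦ μ ((chart E x).symm u)) (fun u ↦ e ((chart E x).symm u))
      (fun u ↦ α ((chart E x).symm u)) (tensorIn x P) := by
  have hπ := hM.bundle.smooth_proj
  have hopen := isOpen_fluidChart hπ hD.isOpen x
  have hsub : fluidChart E EB π D x ⊆ (chart E x).target := fun u hu ↦ hu.1
  have hsubD : fluidChart E EB π D x ⊆ (chart E x).target ∩ (chart E x).symm ⁻¹' D :=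
    fun u hu ↦ ⟨hu.1, hu.2.1⟩
  have hKx := hK.isKillingOn hY.smooth x
  have hvec : ∀ u ∈ fluidChart E EB π D x, ∀ V : VectorField E M,
      chartFrame x u (vectorIn x V u) = V ((chart E x).symm u) :=
    fun u hu V ↦ chartFrame_vectorIn hu.1 V
  have hspan : ∀ u ∈ fluidChart E EB π D x, ∀ v : E,
      (chartFrame x u v ∈ Submodule.span ℝ {X₀ ((chart E x).symm u)} ↔
        ∃ c : ℝ, v = c • vectorIn x X₀ u) := by
    intro u hu v
    have hc : ∀ c : ℝ, chartFrame x u (c • vectorIn x X₀ u) = c • X₀ ((chart E x).symm u) :=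
      fun c ↦ (map_smul (chartFrame x u) c (vectorIn x X₀ u)).trans
        (congrArg (c • ·) (hvec u hu X₀))
    have hmem := Submodule.mem_span_singleton (R := ℝ)
      (M := TangentSpace 𝓘(ℝ, E) ((chart E x).symm u)) (x := chartFrame x u v)
      (y := X₀ ((chart E x).symm u))
    constructor
    · intro h
      obtain ⟨c, h⟩ := hmem.1 h
      exact ⟨c, chartFrame_injective hu.1 (h.symm.trans (hc c).symm)⟩
    · rintro ⟨c, rfl⟩
      exact hmem.2 ⟨c, (hc c).symm⟩
  have hfluid : ∀ u ∈ fluidChart E EB π D x, chartFrame x u (vectorIn x X₀ u +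
      (e ((chart E x).symm u) / μ ((chart E x).symm u)) • vectorIn x Y u) =
        fluidField X₀ Y μ e ((chart E x).symm u) := fun u hu ↦ by
    have h := hvec u hu (fluidField X₀ Y μ e)
    rwa [vectorIn_fluidField] at h
  refine
    { metric := (g.isMetricOn x).mono hopen hsub
      killing := ⟨hKx.contDiffOn.mono hsub, fun u hu ↦ hKx.killing u (hsub hu)⟩
      unit := fun u hu ↦ ?_
      smooth_proj := contDiffOn_projIn hπ x
      surjective := fun u hu ↦ ?_
      vertical := fun u hu ↦ ?_
      smooth_field := (hD.smooth_field.contDiffOn hD.isOpen x).mono hsubD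
      smooth_mass := (contDiffOn_function x hD.smooth_mass).mono hsubD
      smooth_charge := (contDiffOn_function x hD.smooth_charge).mono hsubD
      smooth_coeff := (contDiffOn_function x hD.smooth_coeff).mono hsubD
      smooth_pressure := (hD.smooth_pressure.contDiffOn x).mono hsubD
      mass_pos := fun u hu ↦ hD.mass_pos _ hu.2.1
      field_horizontal := fun u hu ↦ ?_
      field_unit := fun u hu ↦ ?_
      eigenspace := fun u hu v hv ↦ ?_
      einstein_eq := fun u hu v w ↦ ?_
      pressure_potential := fun u hu ↦ ?_
      pressure_mixed := fun u hu ↦ ?_ }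
  · rw [tensorIn_apply, hvec u hu]
    exact hY.unit _
  · intro b
    have : IsManifold 𝓘(ℝ, EB) 1 B := IsManifold.of_le (n := ∞) (by simp)
    obtain ⟨b', hb'⟩ := (isInvertible_mfderiv_extChartAt (I := 𝓘(ℝ, EB)) hu.2.2).surjective b
    obtain ⟨v, rfl⟩ := hM.bundle.surjective_mfderiv _ b'
    obtain ⟨a, rfl⟩ := chartFrame_surjective hu.1 v
    exact ⟨a, (fderiv_projIn hπ hu a).trans hb'⟩
  · rw [fderiv_projIn_eq_zero_iff hπ hu, hvec u hu]
    exact (hY.tangent _).1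
  · rw [isHorizontalAt_iff hπ hu, hvec u hu]
    exact hD.field_horizontal _ hu.2.1
  · rw [tensorIn_apply, hvec u hu]
    exact hD.field_unit _ hu.2.1
  · have hv' := (isHorizontalAt_iff hπ hu v).1 hv
    refine Iff.trans ?_ ((hD.eigenspace _ hu.2.1 _ hv').trans (hspan u hu v))
    refine Iff.trans ?_ (orthProj_eq_iff (hM.horizontal_nondegenerate _)
      ((horizontal EB g π _).smul_mem (-μ ((chart E x).symm u)) hv')).symm
    have hs : ∀ a b, einsteinL (tensorIn x g.val) u a b = einsteinL (tensorIn x g.val) u b a :=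
      fun a b ↦ by
        simp only [einsteinL, sub_apply, smul_apply, (g.isMetricOn x).ricciL_symm hu.1 a b,
          (g.isMetricOn x).symm u hu.1 a b]
    have hG : ∀ h, g.val ((chart E x).symm u) (endo g (einstein g) ((chart E x).symm u)
        (chartFrame x u v)) (chartFrame x u h) = einsteinL (tensorIn x g.val) u v h := fun h ↦ by
      rw [hs]
      exact (inner_endo (einstein g) ((chart E x).symm u) (chartFrame x u v)
        (chartFrame x u h)).trans (tensorIn_einstein g hu.1 h v)
    have hgv : ∀ h, g.val ((chart E x).symm u) ((-μ ((chart E x).symm u)) • chartFrame x u v)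
        (chartFrame x u h) = -μ ((chart E x).symm u) * tensorIn x g.val u v h := fun h ↦
      congrArg (fun φ : E →L[ℝ] ℝ ↦ φ (chartFrame x u h))
        (map_smul (g.val ((chart E x).symm u)) (-μ ((chart E x).symm u)) (chartFrame x u v))
    constructor
    · intro h z hz
      obtain ⟨z, rfl⟩ := chartFrame_surjective hu.1 z
      exact (hG z).trans ((h z ((isHorizontalAt_iff hπ hu z).2 hz)).trans (hgv z).symm)
    · intro h z hz
      exact (hG z).symm.trans ((h _ ((isHorizontalAt_iff hπ hu z).1 hz)).trans (hgv z))
  · rw [← tensorIn_einstein g hu.1, tensorIn_apply, tensorIn_apply x g.val, tensorIn_apply x g.val,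
      tensorIn_apply x g.val, tensorIn_apply x g.val, hfluid u hu, hvec u hu]
    exact hD.einstein_eq _ hu.2.1 _ _
  · rw [tensorIn_apply, hvec u hu]
    exact hD.pressure_plane _ hu.2.1 _ (Submodule.subset_span (by simp)) _
      (Submodule.subset_span (by simp))
  · rw [tensorIn_apply, hvec u hu, hvec u hu]
    exact hD.pressure_plane _ hu.2.1 _ (Submodule.subset_span (by simp)) _
      (Submodule.subset_span (by simp))

/-- The projection on the orthogonal of the plane generated by two orthogonal unit vectors of
negative square. -/
theorem orthProj_orth_fluidPlane {g : SemiRiemannianMetric E M} {X₀ Y : VectorField E M} {x : M}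
    (hX : g.val x (X₀ x) (X₀ x) = -1) (hY : g.val x (Y x) (Y x) = -1)
    (hXY : g.val x (X₀ x) (Y x) = 0) (v : TangentSpace 𝓘(ℝ, E) x) :
    orthProj g x (orth g x (fluidPlane X₀ Y x)) v =
      v + g.val x v (X₀ x) • X₀ x + g.val x v (Y x) • Y x := by
  have hYX : g.val x (Y x) (X₀ x) = 0 := by rw [g.symm, hXY]
  have hmem : ∀ w, w ∈ orth g x (fluidPlane X₀ Y x) ↔
      g.val x w (X₀ x) = 0 ∧ g.val x w (Y x) = 0 := by
    intro w
    constructor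
    · intro h
      exact ⟨h _ (Submodule.subset_span (by simp)), h _ (Submodule.subset_span (by simp))⟩
    · rintro ⟨h1, h2⟩ z hz
      obtain ⟨a, b, rfl⟩ := Submodule.mem_span_pair.1 hz
      simp [h1, h2]
  have hplane : ∀ a b : ℝ, a • X₀ x + b • Y x ∈
      orth g x (orth g x (fluidPlane X₀ Y x)) := by
    intro a b w hw
    obtain ⟨h1, h2⟩ := (hmem w).1 hw
    rw [g.symm]
    simp [h1, h2]
  refine orthProj_eq (fun w hw hw' ↦ ?_) ?_ ?_
  · refine g.nondegenerate x w fun z ↦ ?_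
    obtain ⟨h1, h2⟩ := (hmem w).1 hw
    have h3 := hw' (z + g.val x z (X₀ x) • X₀ x + g.val x z (Y x) • Y x) ((hmem _).2 (by
      constructor <;> simp [hX, hY, hXY, hYX]))
    simpa [h1, h2] using h3
  · rw [hmem]
    constructor <;> simp [hX, hY, hXY, hYX]
  · have h := hplane (-g.val x v (X₀ x)) (-g.val x v (Y x))
    rw [show v - (v + g.val x v (X₀ x) • X₀ x + g.val x v (Y x) • Y x) =
      -g.val x v (X₀ x) • X₀ x + -g.val x v (Y x) • Y x by module]
    exact h

end Fluid

end KaluzaKlein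

theorem mainTheorem2
    {E EB EW : Type*} [NormedAddCommGroup E] [NormedSpace ℝ E] [FiniteDimensional ℝ E]
    [NormedAddCommGroup EB] [NormedSpace ℝ EB] [FiniteDimensional ℝ EB]
    [NormedAddCommGroup EW] [NormedSpace ℝ EW] [FiniteDimensional ℝ EW]
    {M B W : Type*} [TopologicalSpace M] [ChartedSpace E M] [IsManifold 𝓘(ℝ, E) ∞ M]
    [TopologicalSpace B] [ChartedSpace EB B] [IsManifold 𝓘(ℝ, EB) ∞ B]
    [TopologicalSpace W] [ChartedSpace EW W] [IsManifold 𝓘(ℝ, EW) ∞ W] [CompactSpace W]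
    (m : ℕ) (g : SemiRiemannianMetric E M) (π : M → B) (Φ : M → Circle × W)
    (hM : IsSpacetime EB EW m g π Φ)
    (Y : KaluzaKlein.VectorField E M)
    (hY : IsElectromagneticPotential EB EW g π Φ Y)
    (hK : IsKilling g Y)
    (D : Set M) (X₀ : KaluzaKlein.VectorField E M) (μ e α : M → ℝ)
    (P : TensorField E M)
    (hD : IsFluidDomain EB g π Y D X₀ μ e α P) :
    ∀ x ∈ D,
      -- energy conservation
      (divergence g (fun y ↦ μ y • fluidField X₀ Y μ e y) x = g.val x (X₀ x) (divTensor g P x) ∧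
        divergence g (fun y ↦ μ y • X₀ y) x = g.val x (X₀ x) (divTensor g P x)) ∧
      -- charge conservation
      (divergence g (fun y ↦ e y • fluidField X₀ Y μ e y) x = g.val x (Y x) (divTensor g P x) ∧
        divergence g (fun y ↦ e y • X₀ y) x = g.val x (Y x) (divTensor g P x) ∧
        divergence g (fun y ↦ endo g P y (Y y)) x =
          g.val x (Y x) (divTensor g P x)) ∧
      -- equation of motion of the fluid
      μ x • covDeriv g (fluidField X₀ Y μ e) x (fluidField X₀ Y μ e x) =
        -divTensor g P x - g.val x (X₀ x) (divTensor g P x) • fluidField X₀ Y μ e x ∧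
      -- equation of motion of the apparent fluid
      μ x • covDeriv g X₀ x (X₀ x) =
        e x • endo g (electromagneticField g Y) x (X₀ x) -
          orthProj g x
            (orth g x (fluidPlane X₀ Y x)) (divTensor g P x) ∧
      -- Maxwell equations
      (∀ a b c, extDerivTwo (electromagneticField g Y) x a b c = 0) ∧
      divTensor g (electromagneticField g Y) x =
        (2 * e x) • X₀ x + ((1 / 2) * normSq g (electromagneticField g Y) x) • Y x -
          (2 : ℝ) • endo g P x (Y x) := by
  intro x hx
  have h := hD.isFluidOn hM hY hK x
  have hg := g.isMetricOn x
  have hxt : chart E x x ∈ (chart E x).target := mem_extChartAt_target x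
  have hsymm : (chart E x).symm (chart E x x) = x := chart_symm_self x
  have hu : chart E x x ∈ fluidChart E EB π D x := by
    refine ⟨hxt, ?_, ?_⟩
    · rw [hsymm]
      exact hx
    · rw [Set.mem_preimage, hsymm]
      exact mem_extChartAt_source (π x)
  -- In the chart at `x`, the coordinates of a tangent vector at `x` are the vector itself.
  have hsharp : ∀ T : TensorField E M, divTensor g T x =
      sharpL (tensorIn x g.val (chart E x x))
        (divTensorCovectorL (tensorIn x g.val) (tensorIn x T) (chart E x x)) :=
    fun T ↦ ofCoords_apply x _
  have hinner : ∀ V : KaluzaKlein.VectorField E M, g.val x (V x) (divTensor g P x) =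
      divTensorCovectorL (tensorIn x g.val) (tensorIn x P) (chart E x x)
        (vectorIn x V (chart E x x)) := by
    intro V
    have h1 := sharpL_apply_apply (hg.nondegenerate _ hxt)
      (divTensorCovectorL (tensorIn x g.val) (tensorIn x P) (chart E x x))
      (vectorIn x V (chart E x x))
    rw [tensorIn_self, vectorIn_self] at h1
    rw [vectorIn_self]
    exact ((g.symm x _ _).trans
      (congrArg (fun z ↦ g.val x z (V x)) (hsharp P))).trans h1
  have hX₀ : vectorIn x X₀ (chart E x x) = X₀ x := vectorIn_self x X₀
  have hYx : vectorIn x Y (chart E x x) = Y x := vectorIn_self x Y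
  have hF : Set.EqOn (tensorIn x (electromagneticField g Y))
      (extDerivOneL fun u ↦ tensorIn x g.val u (vectorIn x Y u)) (chart E x).target :=
    fun u hu ↦ tensorIn_electromagneticField hK hY.smooth hu
  have hdF : fderiv ℝ (tensorIn x (electromagneticField g Y)) (chart E x x) =
      fderiv ℝ (extDerivOneL fun u ↦ tensorIn x g.val u (vectorIn x Y u)) (chart E x x) :=
    fderiv_congr_of_eqOn hg.isOpen hF hxt
  have hendo : ∀ (T : TensorField E M) (v : TangentSpace 𝓘(ℝ, E) x), endo g T x v =
      sharpL (tensorIn x g.val (chart E x x)) ((tensorIn x T (chart E x x)).flip v) := by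
    intro T v
    rw [endo, ofCoords_apply, toCoords_apply]
  have hdiv : ∀ f : M → ℝ, divergence g (fun y ↦ f y • fluidField X₀ Y μ e y) x =
      traceCLM (covDerivL (tensorIn x g.val) (fun u ↦ f ((chart E x).symm u) • (vectorIn x X₀ u +
        (e ((chart E x).symm u) / μ ((chart E x).symm u)) • vectorIn x Y u)) (chart E x x)) := by
    intro f
    rw [divergence, vectorIn_smul x f, vectorIn_fluidField]
  have hdiv₀ : ∀ f : M → ℝ, divergence g (fun y ↦ f y • X₀ y) x =
      traceCLM (covDerivL (tensorIn x g.val)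
        (fun u ↦ f ((chart E x).symm u) • vectorIn x X₀ u) (chart E x x)) := by
    intro f
    rw [divergence, vectorIn_smul x f]
  refine ⟨⟨?_, ?_⟩, ⟨?_, ?_, ?_⟩, ?_, ?_, fun a b c ↦ ?_, ?_⟩
  · exact ((hdiv μ).trans (h.energy_conservation hu)).trans (hinner X₀).symm
  · exact ((hdiv₀ μ).trans ((h.trace_covDerivL_smul_fluid hu (h.differentiableAt_mass hu)
      (h.fderiv_mass hu)).symm.trans (h.energy_conservation hu))).trans (hinner X₀).symm
  · exact ((hdiv e).trans (h.charge_conservation hu)).trans (hinner Y).symm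
  · exact ((hdiv₀ e).trans ((h.trace_covDerivL_smul_fluid hu (h.differentiableAt_charge hu)
      (h.fderiv_charge hu)).symm.trans (h.charge_conservation hu))).trans (hinner Y).symm
  · exact (h.trace_covDerivL_pressure hu fun u hu ↦ vectorIn_endo hu.1 P Y).trans (hinner Y).symm
  · have h1 := h.fluid_motion hu
    have h2 := vectorIn_fluidField X₀ Y μ e x
    have h3 := congrFun h2 (chart E x x)
    rw [vectorIn_self] at h3
    beta_reduce at h1 h3
    rw [← h3, ← h2, hsymm, ← hinner, ← hsharp, ← covDeriv_eq] at h1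
    exact h1
  · have hvec := orthProj_orth_fluidPlane (hD.field_unit x hx) (hY.unit x)
      (hD.field_horizontal x hx _ (hY.tangent x).1) (divTensor g P x)
    have h1 := h.apparent_motion hu
    beta_reduce at h1
    rw [← hF hxt, ← hinner, ← hinner, hX₀, hYx, hsymm, ← hsharp, ← covDeriv_eq, ← hendo] at h1
    rw [hvec, g.symm x _ (X₀ x), g.symm x _ (Y x)]
    exact h1
  · have hθ : ContDiffOn ℝ ∞ (fun u ↦ tensorIn x g.val u (vectorIn x Y u)) (chart E x).target :=
      hg.contDiffOn.clm_apply (hK.isKillingOn hY.smooth x).contDiffOn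
    have h1 := extDerivTwoL_extDerivOneL hg.isOpen hθ hxt (toCoords x a) (toCoords x b)
      (toCoords x c)
    rw [extDerivTwoL, ← hdF] at h1
    exact h1
  · have h1 := h.maxwell hu
    have h2 : divTensorCovectorL (tensorIn x g.val)
        (extDerivOneL fun u ↦ tensorIn x g.val u (vectorIn x Y u)) (chart E x x) =
        divTensorCovectorL (tensorIn x g.val) (tensorIn x (electromagneticField g Y))
          (chart E x x) := by
      rw [divTensorCovectorL, divTensorCovectorL, covDerivTensorL, covDerivTensorL, hdF, hF hxt]
    beta_reduce at h1
    rw [h2, ← hF hxt, hX₀, hYx, hsymm, ← hsharp, ← hendo] at h1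
    exact h1
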